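/- All graphs are finite and simple; $P_7$ is the path on $7$ vertices, $C_m$ the cycle on $m$ vertices, and the shell is the graph on $7$ vertices that consists of a $6$-cycle $v_0v_1\cdots v_5$ and one further vertex $p$ adjacent to exactly $v_0$ and $v_3$. A graph is $\mathcal F$-free if no induced subgraph of it is isomorphic to a member of $\mathcal F$. A graph $G$ is clean if (i) there are no distinct non-adjacent vertices $u,v$ with $N(v)\subseteq N(u)$, and (ii) there are no disjoint non-empty stable sets $A,B\subseteq V(G)$ with $2<|A|+|B|<|V(G)|$ such that every vertex outside $A\cup B$ is adjacent to all or to none of the vertices of $A$, and to all or to none of the vertices of $B$. Then there is an algorithm with the following specifications. Input: a clean, connected $\{P_7,C_3,C_7,\text{shell}\}$-free graph $G$ which contains an induced $5$-cycle. Output: a $3$-coloring of $G$ (a map $c:V(G)\to\{1,2,3\}$ with $c(x)\neq c(y)$ for adjacent $x,y$), or a determination that none exists. Running time: $O(|V(G)|^6)$. Here an algorithm is a single program for a random access machine that receives $n=|V(G)|$ and the adjacency matrix of $G$ on the vertex set $\{0,\dots,n-1\}$; each elementary step (an assignment, addition, subtraction, multiplication, array access, or test of a register for zero) costs one unit of time,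 and all numbers that occur are at most $n^{k}$ for a constant $k$, i.e. have $O(\log n)$ bits. -/

import Mathlib

open scoped SimpleGraph

namespace ThreeCol

/-! ## Graphs -/

section Graphs

variable {V : Type*}

/-- The shell: the 6-cycle `0-1-2-3-4-5-0` together with one more vertex `6` whose neighbours are the
two opposite vertices `0` and `3` of the cycle. -/
def shell : SimpleGraph (Fin 7) :=
  SimpleGraph.fromEdgeSet
    {s(0, 1), s(1, 2), s(2, 3), s(3, 4), s(4, 5), s(5, 0), s(6, 0), s(6, 3)}

/-- `G` is `H`-free in the induced sense: no induced subgraph of `G` is isomorphic to `H`. -/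
def InducedFree {W : Type*} (H : SimpleGraph W) (G : SimpleGraph V) : Prop :=
  ¬ H ⊴ G

/-- The vertex `v` is dominated by the vertex `u`. -/
def DominatedBy (G : SimpleGraph V) (v u : V) : Prop :=
  u ≠ v ∧ ¬ G.Adj u v ∧ G.neighborSet v ⊆ G.neighborSet u

/-- The vertex `v` is complete to `A`. -/
def CompleteTo (G : SimpleGraph V) (v : V) (A : Finset V) : Prop :=
  ∀ a ∈ A, G.Adj v a

/-- The vertex `v` is anticomplete to `A`. -/
def AnticompleteTo (G : SimpleGraph V) (v : V) (A : Finset V) : Prop :=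
  ∀ a ∈ A, ¬ G.Adj v a

/-- The vertex `v` is mixed on `A` (used for vertices outside `A`). -/
def MixedOn (G : SimpleGraph V) (v : V) (A : Finset V) : Prop :=
  ¬ CompleteTo G v A ∧ ¬ AnticompleteTo G v A

/-- `(A, B)` is a non-trivial homogeneous pair of stable sets of `G`. -/
structure NontrivialHomogeneousPair [Fintype V] (G : SimpleGraph V) (A B : Finset V) : Prop where
  disjoint : Disjoint A B
  nonempty_left : A.Nonempty
  nonempty_right : B.Nonempty
  stable_left : G.IsIndepSet (A : Set V)
  stable_right : G.IsIndepSet (B : Set V)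
  two_lt : 2 < A.card + B.card
  lt_card : A.card + B.card < Fintype.card V
  not_mixed : ∀ v, v ∉ A → v ∉ B → ¬ MixedOn G v A ∧ ¬ MixedOn G v B

/-- `G` is clean: it has no dominated vertex and no non-trivial homogeneous pair of stable sets. -/
def Clean [Fintype V] (G : SimpleGraph V) : Prop :=
  (¬ ∃ v u, DominatedBy G v u) ∧ ¬ ∃ A B, NontrivialHomogeneousPair G A B

end Graphs

/-! ## Random access machines with a step count

A program uses word registers and random access arrays of words; as it is a finite object, it names
only finitely many of each. Words are natural numbers that must not exceed a bound `B`: the machine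
gets stuck as soon as an instruction produces a larger number. -/

/-- Programs. Registers and arrays are named by (fixed) natural numbers. -/
inductive Prog : Type
  /-- `x := c` -/
  | const (x c : ℕ)
  /-- `x := y` -/
  | move (x y : ℕ)
  /-- `x := y + z` -/
  | add (x y z : ℕ)
  /-- `x := y - z`, truncated at `0` -/
  | sub (x y z : ℕ)
  /-- `x := y * z` -/
  | mul (x y z : ℕ)
  /-- `x := a[i]` -/
  | load (x a i : ℕ)
  /-- `a[i] := x` -/
  | store (a i x : ℕ)
  /-- do nothing -/
  | skip
  /-- first `p`, then `q` -/
  | seq (p q : Prog)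
  /-- if `x ≠ 0` then `p` else `q` -/
  | ite (x : ℕ) (p q : Prog)
  /-- while `x ≠ 0` do `p` -/
  | loop (x : ℕ) (p : Prog)

/-- A memory: `reg x` is the content of register `x`, and `arr a i` is cell `i` of array `a`. -/
@[ext]
structure Store where
  reg : ℕ → ℕ
  arr : ℕ → ℕ → ℕ

/-- Overwrite the register `x` with `w`. -/
def Store.setReg (s : Store) (x w : ℕ) : Store :=
  { s with reg := Function.update s.reg x w }

/-- Overwrite the cell `i` of the array `a` with `w`. -/
def Store.setArr (s : Store) (a i w : ℕ) : Store :=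
  { s with arr := Function.update s.arr a (Function.update (s.arr a) i w) }

/-- Write the word `w` to the register `x`; the machine is stuck if `w` exceeds the bound `B`. -/
def Store.write (B : ℕ) (s : Store) (x w : ℕ) : Option Store :=
  if w ≤ B then some (s.setReg x w) else none

/-- One step of the machine with word bound `B`. A configuration consists of the program pieces that
are still to be executed, in this order, and of the memory. There is no step from a configuration
with nothing left to execute (the machine has halted) or when a word exceeds `B`. -/
def step (B : ℕ) : List Prog × Store → Option (List Prog × Store)
  | ([], _) => none
  | (.const x c :: K, s) => (s.write B x c).map (K, ·)
  | (.move x y :: K, s) => (s.write B x (s.reg y)).map (K, ·)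
  | (.add x y z :: K, s) => (s.write B x (s.reg y + s.reg z)).map (K, ·)
  | (.sub x y z :: K, s) => (s.write B x (s.reg y - s.reg z)).map (K, ·)
  | (.mul x y z :: K, s) => (s.write B x (s.reg y * s.reg z)).map (K, ·)
  | (.load x a i :: K, s) => (s.write B x (s.arr a (s.reg i))).map (K, ·)
  | (.store a i x :: K, s) => some (K, s.setArr a (s.reg i) (s.reg x))
  | (.skip :: K, s) => some (K, s)
  | (.seq p q :: K, s) => some (p :: q :: K, s)
  | (.ite x p q :: K, s) => some (if s.reg x ≠ 0 then p :: K else q :: K, s)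
  | (.loop x p :: K, s) => some (if s.reg x ≠ 0 then p :: .loop x p :: K else K, s)

/-- The configuration after exactly `t` steps, if the machine makes that many. -/
def run (B : ℕ) : ℕ → List Prog × Store → Option (List Prog × Store)
  | 0, c => some c
  | t + 1, c => (step B c).bind (run B t)

/-- Started on the memory `s`, the program `P` halts properly after exactly `t` steps, with the memory
`s'`, and all words that it produces are at most `B`. -/
def HaltsIn (B : ℕ) (P : Prog) (s : Store) (t : ℕ) (s' : Store) : Prop :=
  run B t ([P], s) = some ([], s')

/-! ## Input and output -/

open Classical in
/-- The memory that presents the graph `G` on the vertices `0, …, n - 1` to the machine: register `0`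
holds `n`, array `0` holds the adjacency matrix row by row, everything else is `0`. -/
noncomputable def input {n : ℕ} (G : SimpleGraph (Fin n)) : Store where
  reg := fun x => if x = 0 then n else 0
  arr := fun a m =>
    if a = 0 ∧ ∃ i j : Fin n, G.Adj i j ∧ m = (i : ℕ) * n + j then 1 else 0

/-- The memory `s` presents a 3-coloring of `G`, or the answer that there is none: either register `0`
holds `1` and the cells `0, …, n - 1` of array `1` are the colors, from `{1, 2, 3}`, of the vertices in
a 3-coloring of `G`; or register `0` holds `0` and `G` is not 3-colorable. -/
def CorrectOutput {n : ℕ} (G : SimpleGraph (Fin n)) (s : Store) : Prop :=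
  (s.reg 0 = 1 ∧ ∃ C : G.Coloring (Fin 3), ∀ v : Fin n, s.arr 1 v = (C v : ℕ) + 1) ∨
    (s.reg 0 = 0 ∧ ¬ G.Colorable 3)

end ThreeCol

/-! Every 3-coloring of a pentagon is, after a rotation and a renaming of the colors, `0, 1, 0, 1,
2` on `c0, …, c4`. Fix it and propagate singleton lists. A vertex that keeps all three colors has no
neighbour on the pentagon, and none among the common neighbours of two differently colored pentagon
vertices, as these are forced. What remains are the classes `T = N(c0) ∩ N(c2)` and `T' = N(c3) ∩
N(c1)`, which a reflection exchanges.

For `T`, let `Y` be the set of vertices without neighbours on the path `c2 c3 c4 c0`. The excluded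
subgraphs imply that a vertex outside `Y` that sees one end of a two-edge path in `G[Y]` sees the
other end too (`Excl.adj_of_far`). The two sides of a component would thus be a homogeneous pair of
stable sets, so cleanness leaves only single vertices and single edges (`eq_of_adj_of_clean`). As
there is no induced `P_7`, the sets of edges of `G[Y]` seen from `T` form a chain
(`Excl.sees_nested`). Order `T` such that vertices that see more come first. It suffices to guess
the color `d` of the first vertex and the first vertex `s` of another color `e` (or the last vertex,
if `T` has only one color): then every vertex that has a neighbour in `T` and lies on an edge of
`G[Y]` loses a color (`Guess.not_full`). Since no vertex is dominated, every remaining candidate for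
a full list is of this kind for `T` or for `T'` (`Excl.exists_far_edge`). So the right guesses leave
lists of at most two colors.

Such lists are solved as in 2-SAT: try a color and propagate; if no list becomes empty, the choice
can be kept (`exists_listColoring_of_closed`), otherwise the color can be deleted. A coloring is
reported only if closed, non-empty lists of one color exhibit it, so wrong guesses are harmless.

There are `n ^ 2` pairs of guessed vertices and boundedly many colors and rotations. Propagation
takes `3 * n` passes over all pairs, and the solver propagates `O(n)` times, so a branch costs `O(n
^ 4)`, the search `O(n ^ 6)`. The program is written in a small language with loops of length `n`,
which the machine simulates in time given by the nesting depth (`Cmd.exec_compile`). -/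

namespace ThreeCol

/-! ## Excluded induced subgraphs -/

section Structure

variable {V : Type*} {G : SimpleGraph V}

/-- A map that reflects and preserves adjacency, from a graph without twins, is an embedding. -/
theorem isIndContained_of_adj_iff {W : Type*} {H : SimpleGraph W} (f : W → V)
    (hf : ∀ i j, G.Adj (f i) (f j) ↔ H.Adj i j)
    (twin : ∀ i j, (∀ k, H.Adj i k ↔ H.Adj j k) → i = j) : H ⊴ G := by
  refine ⟨⟨⟨f, fun i j h => twin i j fun k => ?_⟩, fun {i j} => hf i j⟩⟩
  rw [← hf, ← hf, h]

/-- The consequences of the excluded induced subgraphs in the form in which they are used: distances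
two in the excluded graph are taken care of by the absence of triangles. -/
structure Excl (G : SimpleGraph V) : Prop where
  tri : ∀ {a b c}, G.Adj a b → G.Adj b c → ¬ G.Adj a c
  path : ∀ a b c d e f g, G.Adj a b → G.Adj b c → G.Adj c d → G.Adj d e → G.Adj e f → G.Adj f g →
    ¬ G.Adj a d → ¬ G.Adj a e → ¬ G.Adj a f → ¬ G.Adj a g → ¬ G.Adj b e → ¬ G.Adj b f →
    ¬ G.Adj b g → ¬ G.Adj c f → ¬ G.Adj c g → ¬ G.Adj d g → False
  cycle : ∀ a b c d e f g, G.Adj a b → G.Adj b c → G.Adj c d → G.Adj d e → G.Adj e f → G.Adj f g →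
    G.Adj g a → ¬ G.Adj a d → ¬ G.Adj a e → ¬ G.Adj b e → ¬ G.Adj b f → ¬ G.Adj c f →
    ¬ G.Adj c g → ¬ G.Adj d g → False
  shell : ∀ a b c d e f p, G.Adj a b → G.Adj b c → G.Adj c d → G.Adj d e → G.Adj e f → G.Adj f a →
    G.Adj p a → G.Adj p d → ¬ G.Adj b e → ¬ G.Adj c f → False

theorem Excl.of_inducedFree (h7 : InducedFree (SimpleGraph.pathGraph 7) G)
    (h3 : InducedFree (SimpleGraph.cycleGraph 3) G)
    (hc : InducedFree (SimpleGraph.cycleGraph 7) G) (hs : InducedFree ThreeCol.shell G) : Excl G := by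
  have tri : ∀ {a b c}, G.Adj a b → G.Adj b c → ¬ G.Adj a c := by
    intro a b c hab hbc hac
    refine h3 (isIndContained_of_adj_iff ![a, b, c] ?_ ?_)
    · intro i j
      fin_cases i <;> fin_cases j <;>
        simp [SimpleGraph.cycleGraph_adj, hab, hbc, hac, hab.symm, hbc.symm, hac.symm] <;> decide
    · simp only [SimpleGraph.cycleGraph_adj]; decide
  refine ⟨tri, ?_, ?_, ?_⟩
  · intro a b c d e f g ab bc cd de ef fg ad ae af ag be bf bg cf cg dg
    have ac := tri ab bc
    have bd := tri bc cd
    have ce := tri cd de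
    have df := tri de ef
    have eg := tri ef fg
    refine h7 (isIndContained_of_adj_iff ![a, b, c, d, e, f, g] ?_ ?_)
    · intro i j
      fin_cases i <;> fin_cases j <;>
        simp [SimpleGraph.pathGraph_adj, G.adj_comm, *]
    · simp only [SimpleGraph.pathGraph_adj]; decide
  · intro a b c d e f g ab bc cd de ef fg ga ad ae be bf cf cg dg
    have ac := tri ab bc
    have bd := tri bc cd
    have ce := tri cd de
    have df := tri de ef
    have eg := tri ef fg
    have af : ¬ G.Adj a f := fun h => tri fg ga h.symm
    have bg : ¬ G.Adj b g := fun h => tri ga ab h.symm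
    have ag := ga.symm
    refine hc (isIndContained_of_adj_iff ![a, b, c, d, e, f, g] ?_ ?_)
    · intro i j
      fin_cases i <;> fin_cases j <;>
        simp [SimpleGraph.cycleGraph_adj, G.adj_comm, *] <;> decide
    · simp only [SimpleGraph.cycleGraph_adj]; decide
  · intro a b c d e f p ab bc cd de ef fa pa pd be cf
    have ac := tri ab bc
    have bd := tri bc cd
    have ce := tri cd de
    have df := tri de ef
    have ae : ¬ G.Adj a e := fun h => tri ef fa h.symm
    have bf : ¬ G.Adj b f := fun h => tri fa ab h.symm
    have bp : ¬ G.Adj b p := fun h => tri pa ab h.symm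
    have fp : ¬ G.Adj f p := fun h => tri pa fa.symm h.symm
    have cp : ¬ G.Adj c p := fun h => tri pd cd.symm h.symm
    have ep : ¬ G.Adj e p := fun h => tri pd de h.symm
    have ad := tri pa.symm pd
    have af := fa.symm
    have ap := pa.symm
    have dp := pd.symm
    refine hs (isIndContained_of_adj_iff ![a, b, c, d, e, f, p] ?_ ?_)
    · intro i j
      fin_cases i <;> fin_cases j <;>
        simp [ThreeCol.shell, G.adj_comm, *] 
    · simp only [ThreeCol.shell, SimpleGraph.fromEdgeSet_adj]; decide

end Structure

/-! ### Pentagons and the vertices far from a path of four of their vertices -/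

section Pentagon

variable {V : Type*} {G : SimpleGraph V}

/-- `c0, …, c4` is a closed walk of length five; without triangles it is an induced cycle. -/
structure Pentagon (G : SimpleGraph V) (c0 c1 c2 c3 c4 : V) : Prop where
  adj01 : G.Adj c0 c1
  adj12 : G.Adj c1 c2
  adj23 : G.Adj c2 c3
  adj34 : G.Adj c3 c4
  adj40 : G.Adj c4 c0

theorem Pentagon.rotate {c0 c1 c2 c3 c4 : V} (C : Pentagon G c0 c1 c2 c3 c4) :
    Pentagon G c1 c2 c3 c4 c0 := ⟨C.2, C.3, C.4, C.5, C.1⟩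

/-- The mirror image that fixes `c4` exchanges `c0` with `c3` and `c1` with `c2`. It thus exchanges
the two classes for which guesses are made. -/
theorem Pentagon.reflect {c0 c1 c2 c3 c4 : V} (C : Pentagon G c0 c1 c2 c3 c4) :
    Pentagon G c3 c2 c1 c0 c4 := ⟨C.3.symm, C.2.symm, C.1.symm, C.5.symm, C.4.symm⟩

/-- `v` has no neighbour on the path `c2, c3, c4, c0`. -/
def FarFrom (G : SimpleGraph V) (c0 c2 c3 c4 v : V) : Prop :=
  ¬ G.Adj c0 v ∧ ¬ G.Adj c2 v ∧ ¬ G.Adj c3 v ∧ ¬ G.Adj c4 v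

/-- This belongs to the mirror image that fixes `c1`, not to `Pentagon.reflect`. -/
theorem FarFrom.reflect {c0 c2 c3 c4 v : V} (h : FarFrom G c0 c2 c3 c4 v) :
    FarFrom G c2 c0 c4 c3 v := ⟨h.2.1, h.1, h.2.2.2, h.2.2.1⟩

/-- The hexagon `c1 c2 c3 s x a` and the vertex `c0`, adjacent to its opposite vertices `c1` and
`s`, would form a shell. -/
theorem Excl.not_adj_of_attach_right {c0 c1 c2 c3 c4 x a s : V} (E : Excl G)
    (C : Pentagon G c0 c1 c2 c3 c4)
    (hx : FarFrom G c0 c2 c3 c4 x) (ha : FarFrom G c0 c2 c3 c4 a) (xa : G.Adj x a)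
    (ca : G.Adj c1 a) (sx : G.Adj s x) (s0 : G.Adj c0 s) (s3 : G.Adj c3 s) : False := by
  obtain ⟨x0, x2, x3, x4⟩ := hx
  obtain ⟨a0, a2, a3, a4⟩ := ha
  exact E.shell c1 c2 c3 s x a c0 C.2 C.3 s3 sx xa ca.symm C.1 s0 x2 a3

/-- A vertex with a neighbour attached to `c1` only also has a neighbour that is attached to both
neighbours of `c1`. -/
theorem Excl.exists_twin_nbr {c0 c1 c2 c3 c4 x a : V} (E : Excl G)
    (hdom : ∀ v u, ¬ DominatedBy G v u) (C : Pentagon G c0 c1 c2 c3 c4)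
    (hx : FarFrom G c0 c2 c3 c4 x) (ha : FarFrom G c0 c2 c3 c4 a) (xa : G.Adj x a)
    (ca : G.Adj c1 a) : ∃ t, G.Adj c0 t ∧ G.Adj c2 t ∧ G.Adj t x := by
  have x1 : ¬ G.Adj c1 x := fun h => E.tri h xa ca
  have hne : c1 ≠ x := by
    rintro rfl
    exact hx.1 C.1
  -- As `c1` does not dominate `x`, some neighbour `w` of `x` is not adjacent to `c1`. This `w` is
  -- the vertex sought.
  have : ¬ G.neighborSet x ⊆ G.neighborSet c1 := fun h => hdom x c1 ⟨hne, x1, h⟩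
  obtain ⟨w, xw, w1⟩ := Set.not_subset.1 this
  simp only [SimpleGraph.mem_neighborSet] at xw w1
  have n02 := E.tri C.1 C.2
  have n13 := E.tri C.2 C.3
  have n24 := E.tri C.3 C.4
  have n30 := E.tri C.4 C.5
  have n41 := E.tri C.5 C.1
  -- The neighbours of `w` on the path form a stable set. The pairs `c0, c3` and `c2, c4` give
  -- shells, `c3` or `c4` alone gives a 7-cycle, and `c0` alone, `c2` alone or no neighbour gives an
  -- induced path on seven vertices. Only `c0` together with `c2` is left.
  have h4 := E.not_adj_of_attach_right (s := w) C hx ha xa ca xw.symm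
  have h3 := E.not_adj_of_attach_right (s := w)
    (⟨C.2.symm, C.1.symm, C.5.symm, C.4.symm, C.3.symm⟩ : Pentagon G c2 c1 c0 c4 c3)
    hx.reflect ha.reflect xa ca xw.symm
  obtain ⟨x0, x2, x3, x4⟩ := hx
  obtain ⟨a0, a2, a3, a4⟩ := ha
  obtain ⟨e01, e12, e23, e34, e40⟩ := C
  have hp := E.path w x a c1 c2 c3 c4
  have hq := E.path w x a c1 c0 c4 c3
  have hc := E.cycle x a c1 c0 c4 c3 w
  have hd := E.cycle x a c1 c2 c3 c4 w
  have t0 := E.tri (a := w) (b := c0) (c := c4)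
  have t2 := E.tri (a := w) (b := c2) (c := c3)
  have t3 := E.tri (a := w) (b := c3) (c := c4)
  refine ⟨w, ?_, ?_, xw.symm⟩ <;> grind [SimpleGraph.adj_comm]

/-- Every vertex outside sees an alternating side of a component of the part far from the path. -/
theorem Excl.adj_of_far {c0 c1 c2 c3 c4 s u m w : V} (E : Excl G)
    (hdom : ∀ v u, ¬ DominatedBy G v u) (C : Pentagon G c0 c1 c2 c3 c4)
    (hs : ¬ FarFrom G c0 c2 c3 c4 s) (hu : FarFrom G c0 c2 c3 c4 u)
    (hm : FarFrom G c0 c2 c3 c4 m) (hw : FarFrom G c0 c2 c3 c4 w)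
    (um : G.Adj u m) (mw : G.Adj m w) (su : G.Adj s u) : G.Adj s w := by
  -- The case that `s` sees `c0` and `c3`. If `c1` sees `u` or `m`, there is a shell. Otherwise
  -- there is an induced 7-vertex path, starting with `u m w c1` or with `w m u s` according to
  -- whether `c1` sees `w`. The path names are quantified so that the mirror image is covered.
  have key : ∀ {c0 c2 c3 c4 : V}, Pentagon G c0 c1 c2 c3 c4 → FarFrom G c0 c2 c3 c4 u →
      FarFrom G c0 c2 c3 c4 m → FarFrom G c0 c2 c3 c4 w → ¬ G.Adj s w →
      G.Adj c0 s → G.Adj c3 s → False := by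
    intro c0 c2 c3 c4 C hu hm hw sw s0 s3
    by_cases c1u : G.Adj c1 u
    · obtain ⟨t, t0, t2, tm⟩ := E.exists_twin_nbr hdom C hm hu um.symm c1u
      exact E.shell s c3 c2 t m u c0 s3.symm C.3.symm t2 tm um.symm su.symm s0 t0 hm.2.2.1 hu.2.1
    by_cases c1m : G.Adj c1 m
    · exact E.not_adj_of_attach_right C hu hm um c1m su s0 s3
    have n02 := E.tri C.1 C.2
    have n13 := E.tri C.2 C.3
    have n24 := E.tri C.3 C.4
    have n41 := E.tri C.5 C.1
    have hp := E.path u m w c1 c2 c3 c4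
    have hq := E.path w m u s c3 c2 c1
    have t0 := E.tri (a := s) (b := c0) (c := c1)
    have t2 := E.tri (a := s) (b := c3) (c := c2)
    have t3 := E.tri (a := s) (b := c3) (c := c4)
    obtain ⟨x0, x2, x3, x4⟩ := hu
    obtain ⟨a0, a2, a3, a4⟩ := hm
    obtain ⟨b0, b2, b3, b4⟩ := hw
    obtain ⟨e01, e12, e23, e34, e40⟩ := C
    grind [SimpleGraph.adj_comm]
  by_contra sw
  have sm := E.tri su um
  have C' : Pentagon G c2 c1 c0 c4 c3 := ⟨C.2.symm, C.1.symm, C.5.symm, C.4.symm, C.3.symm⟩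
  have k1 := key C hu hm hw sw
  have k2 := key C' hu.reflect hm.reflect hw.reflect sw
  have n02 := E.tri C.1 C.2
  have n24 := E.tri C.3 C.4
  have n30 := E.tri C.4 C.5
  -- Now `s` sees a single vertex of `c2 c3 c4 c0`, or exactly `c0` and `c2`. A path that comes from
  -- `w` or `m` through `u` and `s` continues along these vertices to seven vertices.
  have p1 := E.path w m u s c0 c4 c3
  have p2 := E.path m u s c0 c4 c3 c2
  have p3 := E.path m u s c2 c3 c4 c0
  have p4 := E.path w m u s c3 c4 c0
  have p5 := E.path w m u s c4 c3 c2
  have t0 := E.tri (a := s) (b := c0) (c := c4)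
  have t2 := E.tri (a := s) (b := c2) (c := c3)
  have t3 := E.tri (a := s) (b := c3) (c := c4)
  clear key
  unfold FarFrom at hs
  obtain ⟨x0, x2, x3, x4⟩ := hu
  obtain ⟨a0, a2, a3, a4⟩ := hm
  obtain ⟨b0, b2, b3, b4⟩ := hw
  obtain ⟨e01, e12, e23, e34, e40⟩ := C
  grind [SimpleGraph.adj_comm]

end Pentagon

/-! ### Components of the far part are vertices or edges -/

section Matching

variable {V : Type*} {G : SimpleGraph V}

/-- `w` is reached from `u` in two steps inside `Y`. -/
def TwoStep (G : SimpleGraph V) (Y : V → Prop) (u w : V) : Prop :=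
  Y w ∧ ∃ m, Y m ∧ G.Adj u m ∧ G.Adj m w

theorem mem_of_twoStep {Y : V → Prop} {x u : V} (hx : Y x)
    (h : Relation.ReflTransGen (TwoStep G Y) x u) : Y u := by
  cases h with
  | refl => exact hx
  | tail _ h => exact h.1

/-- An edge inside `Y` leads from the class of `x` to the class of `y`, so these two classes exhaust
the component of `xy` in `G[Y]`. That they are stable and disjoint is a separate matter. -/
theorem twoStep_of_adj {Y : V → Prop} {x y u v : V} (hx : Y x) (xy : G.Adj x y)
    (h : Relation.ReflTransGen (TwoStep G Y) x u) (hv : Y v) (uv : G.Adj u v) :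
    Relation.ReflTransGen (TwoStep G Y) y v := by
  induction h generalizing v with
  | refl => exact .single ⟨hv, x, hx, xy.symm, uv⟩
  | tail _ h ih =>
    obtain ⟨hw, m, hm, um, mw⟩ := h
    exact (ih hm um).tail ⟨hv, _, hw, mw, uv⟩

theorem adj_of_twoStep {Y : V → Prop} {s x u : V}
    (hs : ∀ {u m w}, Y u → Y m → Y w → G.Adj u m → G.Adj m w → G.Adj s u → G.Adj s w)
    (hx : Y x) (h : Relation.ReflTransGen (TwoStep G Y) x u) : G.Adj s x ↔ G.Adj s u := by
  induction h with
  | refl => rfl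
  | tail h' h ih =>
    obtain ⟨hw, m, hm, um, mw⟩ := h
    have := mem_of_twoStep hx h'
    exact ih.trans ⟨hs this hm hw um mw, hs hw hm this mw.symm um.symm⟩

theorem adj_of_twoStep₂ {Y : V → Prop} {s x u v : V}
    (hs : ∀ {u m w}, Y u → Y m → Y w → G.Adj u m → G.Adj m w → G.Adj s u → G.Adj s w)
    (hx : Y x) (h : Relation.ReflTransGen (TwoStep G Y) x u)
    (h' : Relation.ReflTransGen (TwoStep G Y) x v) : G.Adj s u ↔ G.Adj s v :=
  (adj_of_twoStep hs hx h).symm.trans (adj_of_twoStep hs hx h')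

/-- If all vertices outside `Y` see alternating sides of the components of `Y`, then the components of
`Y` have at most two vertices. -/
theorem eq_of_adj_of_clean [Fintype V] (hG : Clean G) (hconn : G.Connected)
    (tri : ∀ {a b c}, G.Adj a b → G.Adj b c → ¬ G.Adj a c) {Y : V → Prop}
    (hY : ∀ {s u m w}, ¬ Y s → Y u → Y m → Y w → G.Adj u m → G.Adj m w → G.Adj s u → G.Adj s w)
    (hne : ∃ s, ¬ Y s) {x y z : V} (hx : Y x) (hy : Y y) (hz : Y z) (xy : G.Adj x y)
    (xz : G.Adj x z) : y = z := by
  classical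
  by_contra yz
  set P := Relation.ReflTransGen (TwoStep G Y) x with hP
  set Q := Relation.ReflTransGen (TwoStep G Y) y with hQ
  have PY : ∀ {u}, P u → Y u := mem_of_twoStep hx
  have QY : ∀ {u}, Q u → Y u := mem_of_twoStep hy
  have PQ : ∀ {u v}, P u → Y v → G.Adj u v → Q v := twoStep_of_adj hx xy
  have QP : ∀ {u v}, Q u → Y v → G.Adj u v → P v := twoStep_of_adj hy xy.symm
  have hPs : ∀ {s u v}, ¬ Y s → P u → P v → (G.Adj s u ↔ G.Adj s v) :=
    fun hs hu hv => adj_of_twoStep₂ (hY hs) hx hu hv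
  have hQs : ∀ {s u v}, ¬ Y s → Q u → Q v → (G.Adj s u ↔ G.Adj s v) :=
    fun hs hu hv => adj_of_twoStep₂ (hY hs) hy hu hv
  obtain ⟨r, hr⟩ := hne
  -- Connectedness gives an edge that leaves the component. Its outer end is not in `Y`, since
  -- neighbours in `Y` belong to one of the two classes.
  obtain ⟨d, -, hd1, hd2⟩ := (hconn.preconnected x r).some.exists_boundary_dart {v | P v ∨ Q v}
    (Or.inl .refl) (fun h => hr (h.elim PY QY))
  have hs : ¬ Y d.snd := fun h => hd2 <| hd1.elim (fun h1 => Or.inr (PQ h1 h d.adj))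
    (fun h1 => Or.inl (QP h1 h d.adj))
  have hst : (∀ u, P u → ∀ v, P v → ¬ G.Adj u v) ∧ (∀ u, Q u → ∀ v, Q v → ¬ G.Adj u v) ∧
      ∀ u, P u → ¬ Q u := by
    -- The vertex `d.snd` sees all of the class of `d.fst`, hence nothing of the other class, as
    -- there are no triangles. This single witness makes the classes disjoint and both of them
    -- stable.
    have aux : ∀ {P Q : V → Prop}, P d.fst → P x ∨ P y → (∀ {u}, P u → Y u) → (∀ {u}, Q u → Y u) →
        (∀ {u v}, P u → Y v → G.Adj u v → Q v) → (∀ {u v}, Q u → Y v → G.Adj u v → P v) →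
        (∀ {s u v}, ¬ Y s → P u → P v → (G.Adj s u ↔ G.Adj s v)) →
        (∀ {s u v}, ¬ Y s → Q u → Q v → (G.Adj s u ↔ G.Adj s v)) →
        (∀ {u}, Q u → ∃ v, P v ∧ G.Adj u v) → (∃ u, Q u) →
        (∀ u, P u → ∀ v, P v → ¬ G.Adj u v) ∧ (∀ u, Q u → ∀ v, Q v → ¬ G.Adj u v) ∧
          ∀ u, P u → ¬ Q u := by
      intro P Q h1 hP PY QY PQ QP hPs hQs hQ hne
      have hsP : ∀ u, P u → G.Adj d.snd u := fun u hu => (hPs hs h1 hu).1 d.adj.symm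
      have hsQ : ∀ u, Q u → ¬ G.Adj d.snd u := by
        intro u hu
        obtain ⟨v, hv, uv⟩ := hQ hu
        exact fun h => tri h uv (hsP v hv)
      refine ⟨fun u hu v hv h => tri (hsP u hu) h (hsP v hv), fun u hu v hv h => ?_,
        fun u hu hu' => hsQ u hu' (hsP u hu)⟩
      exact hsQ v hv (hsP v (QP hu (QY hv) h))
    have nb : ∀ {x y u : V}, Y x → Y y → G.Adj x y → Relation.ReflTransGen (TwoStep G Y) y u →
        ∃ v, Relation.ReflTransGen (TwoStep G Y) x v ∧ G.Adj u v := by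
      intro x y u hx hy xy h
      cases h with
      | refl => exact ⟨x, .refl, xy.symm⟩
      | tail h h' =>
        obtain ⟨hw, m, hm, um, mw⟩ := h'
        exact ⟨m, twoStep_of_adj hy xy.symm h hm um, mw.symm⟩
    rcases hd1 with h1 | h1
    · exact aux h1 (Or.inl .refl) PY QY PQ QP hPs hQs (nb hx hy xy) ⟨y, .refl⟩
    · obtain ⟨h1, h2, h3⟩ := aux h1 (Or.inr .refl) QY PY QP PQ hQs hPs (nb hy hx xy.symm) ⟨x, .refl⟩
      exact ⟨h2, h1, fun u hu hu' => h3 u hu' hu⟩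
  obtain ⟨stP, stQ, disj⟩ := hst
  -- With `y` and `z` in the same class the pair has more than two vertices; `r` keeps it from
  -- covering `V`.
  have hQz : Q z := .single ⟨hz, x, hx, xy.symm, xz⟩
  have hdisj : Disjoint (Finset.univ.filter P) (Finset.univ.filter Q) :=
    Finset.disjoint_left.2 fun u hu hu' => disj u (by simpa using hu) (by simpa using hu')
  refine hG.2 ⟨Finset.univ.filter P, Finset.univ.filter Q, hdisj, ⟨x, by simpa using .refl⟩,
    ⟨y, by simpa using .refl⟩, ?_, ?_, ?_, ?_, ?_⟩
  · intro u hu v hv _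
    exact stP u (by simpa using hu) v (by simpa using hv)
  · intro u hu v hv _
    exact stQ u (by simpa using hu) v (by simpa using hv)
  · have h1 : 0 < (Finset.univ.filter P).card := Finset.card_pos.2 ⟨x, by simpa using .refl⟩
    have h2 : 1 < (Finset.univ.filter Q).card :=
      Finset.one_lt_card.2 ⟨y, by simpa using .refl, z, by simpa using hQz, yz⟩
    omega
  · rw [← Finset.card_union_of_disjoint hdisj]
    refine Finset.card_lt_univ_of_notMem (x := r) fun h => ?_
    rw [Finset.mem_union, Finset.mem_filter, Finset.mem_filter] at h
    exact hr (h.elim (fun h => PY h.2) (fun h => QY h.2))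
  · intro v hvP hvQ
    have hvP : ¬ P v := by simpa using hvP
    have hvQ : ¬ Q v := by simpa using hvQ
    unfold MixedOn CompleteTo AnticompleteTo
    simp only [Finset.mem_filter, Finset.mem_univ, true_and]
    by_cases hv : Y v
    · exact ⟨fun h => h.2 fun a ha h' => hvQ (PQ ha hv h'.symm),
        fun h => h.2 fun a ha h' => hvP (QP ha hv h'.symm)⟩
    · refine ⟨fun h => h.2 fun a ha h' => h.1 fun b hb => (hPs hv ha hb).1 h',
        fun h => h.2 fun a ha h' => h.1 fun b hb => (hQs hv ha hb).1 h'⟩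

end Matching

/-! ### The edges of the far part seen from a class are nested -/

section Lists

variable {V : Type*} {G : SimpleGraph V}

/-- The vertex `t` sees the edge `xy`. -/
def Sees (G : SimpleGraph V) (t x y : V) : Prop := G.Adj t x ∨ G.Adj t y

/-- By `Excl.adj_of_far` the general statement applies to the far part; `c3` is a vertex outside,
being adjacent to `c2`. -/
theorem Excl.eq_of_adj_far [Fintype V] {c0 c1 c2 c3 c4 x y z : V} (E : Excl G) (hG : Clean G)
    (hconn : G.Connected) (C : Pentagon G c0 c1 c2 c3 c4) (hx : FarFrom G c0 c2 c3 c4 x)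
    (hy : FarFrom G c0 c2 c3 c4 y) (hz : FarFrom G c0 c2 c3 c4 z) (xy : G.Adj x y)
    (xz : G.Adj x z) : y = z :=
  eq_of_adj_of_clean hG hconn E.tri
    (fun hs hu hm hw um mw su => E.adj_of_far (fun v u h => hG.1 ⟨v, u, h⟩) C hs hu hm hw um mw su)
    ⟨c3, fun h => h.2.1 C.3⟩ hx hy hz xy xz

/-- The common neighbours of `c0` and `c2` are nested in what they see of the part far from the path
`c2, c3, c4, c0`. -/
theorem Excl.sees_nested [Fintype V] {c0 c1 c2 c3 c4 t t' x y x' y' : V} (E : Excl G) (hG : Clean G)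
    (hconn : G.Connected) (C : Pentagon G c0 c1 c2 c3 c4) (ht : G.Adj c0 t) (ht' : G.Adj c0 t')
    (hx : FarFrom G c0 c2 c3 c4 x) (hy : FarFrom G c0 c2 c3 c4 y) (xy : G.Adj x y)
    (hx' : FarFrom G c0 c2 c3 c4 x') (hy' : FarFrom G c0 c2 c3 c4 y') (xy' : G.Adj x' y')
    (h1 : Sees G t x y) (h2 : ¬ Sees G t x' y') (h3 : Sees G t' x' y') (h4 : ¬ Sees G t' x y) :
    False := by
  have key : ∀ {x y x' y'}, FarFrom G c0 c2 c3 c4 x → FarFrom G c0 c2 c3 c4 y → G.Adj x y →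
      FarFrom G c0 c2 c3 c4 x' → FarFrom G c0 c2 c3 c4 y' → G.Adj x' y' → G.Adj t x →
      ¬ Sees G t x' y' → G.Adj t' x' → ¬ Sees G t' x y → False := by
    intro x y x' y' hx hy xy hx' hy' xy' tx h2 tx' h4
    have m1 := fun z => E.eq_of_adj_far (z := z) hG hconn C hx hy
    have m2 := fun z => E.eq_of_adj_far (z := z) hG hconn C hy hx
    -- This induced path on seven vertices is the contradiction. There is no edge between `xy` and
    -- `x'y'`: the far part has components of at most two vertices, so the two edges would coincide,
    -- and then they would be seen by the same vertices.
    have p := E.path y x t c0 t' x' y'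
    have tt := E.tri ht.symm ht'
    unfold Sees at h2 h4
    have n1 : ¬ G.Adj x x' := fun h => by
      have := m1 x' hx' xy h; subst this; exact h4 (Or.inr tx')
    have n2 : ¬ G.Adj x y' := fun h => by
      have := m1 y' hy' xy h; subst this; exact h2 (Or.inr (by
        have := E.eq_of_adj_far hG hconn C hy hx hx' xy.symm xy'.symm
        subst this; exact absurd (Or.inl tx') h4))
    have n3 : ¬ G.Adj y x' := fun h => by
      have := m2 x' hx' xy.symm h; subst this; exact h2 (Or.inl tx)
    have n4 : ¬ G.Adj y y' := fun h => by
      have := m2 y' hy' xy.symm h; subst this; exact h2 (Or.inr tx)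
    obtain ⟨x0, -⟩ := hx
    obtain ⟨y0, -⟩ := hy
    obtain ⟨a0, -⟩ := hx'
    obtain ⟨b0, -⟩ := hy'
    grind [SimpleGraph.adj_comm]
  have sw : ∀ {t x y}, ¬ Sees G t x y → ¬ Sees G t y x := fun h h' => h h'.symm
  rcases h1 with h1 | h1 <;> rcases h3 with h3 | h3
  · exact key hx hy xy hx' hy' xy' h1 h2 h3 h4
  · exact key hx hy xy hy' hx' xy'.symm h1 (sw h2) h3 h4
  · exact key hy hx xy.symm hx' hy' xy' h1 h2 h3 (sw h4)
  · exact key hy hx xy.symm hy' hx' xy'.symm h1 (sw h2) h3 (sw h4)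

end Lists

/-! ### Where vertices with a full list can lie -/

section Undetermined

variable {V : Type*} {G : SimpleGraph V}

/-- A vertex without neighbours on the pentagon, and without neighbours in three of the five classes of
vertices with two neighbours on the pentagon, lies on an edge of one of two special kinds. -/
theorem Excl.exists_far_edge [Fintype V] {c0 c1 c2 c3 c4 v : V} (E : Excl G) (hG : Clean G)
    (hconn : G.Connected) (C : Pentagon G c0 c1 c2 c3 c4)
    (v0 : ¬ G.Adj c0 v) (v1 : ¬ G.Adj c1 v) (v2 : ¬ G.Adj c2 v) (v3 : ¬ G.Adj c3 v)
    (v4 : ¬ G.Adj c4 v) (h0 : ∀ t, G.Adj c4 t → G.Adj c1 t → ¬ G.Adj t v)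
    (h3 : ∀ t, G.Adj c2 t → G.Adj c4 t → ¬ G.Adj t v)
    (h4 : ∀ t, G.Adj c3 t → G.Adj c0 t → ¬ G.Adj t v) :
    (∃ y t, FarFrom G c0 c2 c3 c4 y ∧ G.Adj v y ∧ G.Adj c0 t ∧ G.Adj c2 t ∧ G.Adj t v) ∨
    (∃ y t, FarFrom G c3 c1 c0 c4 y ∧ G.Adj v y ∧ G.Adj c3 t ∧ G.Adj c1 t ∧ G.Adj t v) := by
  have hdom : ∀ v u, ¬ DominatedBy G v u := fun v u h => hG.1 ⟨v, u, h⟩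
  -- A neighbour of `v` attached to one pentagon vertex only forces, by `exists_twin_nbr`, a
  -- neighbour of `v` adjacent to both pentagon neighbours of that vertex. For `c0`, `c3`, `c4` the
  -- hypotheses exclude this; for `c1`, `c2` it is one of the two desired outcomes.
  have a0 : ∀ a, G.Adj v a → G.Adj c0 a → FarFrom G c4 c1 c2 c3 a → False := fun a va ca ha => by
    obtain ⟨t, t1, t2, t3⟩ := E.exists_twin_nbr hdom C.rotate.rotate.rotate.rotate
      (x := v) ⟨v4, v1, v2, v3⟩ ha va ca
    exact h0 t t1 t2 t3
  have a3 : ∀ a, G.Adj v a → G.Adj c3 a → FarFrom G c2 c4 c0 c1 a → False := fun a va ca ha => by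
    obtain ⟨t, t1, t2, t3⟩ := E.exists_twin_nbr hdom C.rotate.rotate
      (x := v) ⟨v2, v4, v0, v1⟩ ha va ca
    exact h3 t t1 t2 t3
  have a4 : ∀ a, G.Adj v a → G.Adj c4 a → FarFrom G c3 c0 c1 c2 a → False := fun a va ca ha => by
    obtain ⟨t, t1, t2, t3⟩ := E.exists_twin_nbr hdom C.rotate.rotate.rotate
      (x := v) ⟨v3, v0, v1, v2⟩ ha va ca
    exact h4 t t1 t2 t3
  by_cases a1 : ∃ a, G.Adj v a ∧ G.Adj c1 a ∧ FarFrom G c0 c2 c3 c4 a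
  · obtain ⟨a, va, ca, ha⟩ := a1
    obtain ⟨t, t1, t2, t3⟩ := E.exists_twin_nbr hdom C (x := v) ⟨v0, v2, v3, v4⟩ ha va ca
    exact Or.inl ⟨a, t, ha, va, t1, t2, t3⟩
  by_cases a2 : ∃ a, G.Adj v a ∧ G.Adj c2 a ∧ FarFrom G c3 c1 c0 c4 a
  · obtain ⟨a, va, ca, ha⟩ := a2
    obtain ⟨t, t1, t2, t3⟩ := E.exists_twin_nbr hdom C.reflect (x := v) ⟨v3, v1, v0, v4⟩ ha va ca
    exact Or.inr ⟨a, t, ha, va, t1, t2, t3⟩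
  -- A neighbour of `v` sees a stable set of pentagon vertices. Single ones are settled, and three
  -- of the five non-adjacent pairs are excluded by hypothesis.
  have kind : ∀ w, G.Adj v w → (¬ G.Adj c0 w ∧ ¬ G.Adj c1 w ∧ ¬ G.Adj c2 w ∧ ¬ G.Adj c3 w ∧
      ¬ G.Adj c4 w) ∨ (G.Adj c0 w ∧ G.Adj c2 w) ∨ (G.Adj c3 w ∧ G.Adj c1 w) := by
    intro w vw
    have b0 := a0 w vw
    have b1 : G.Adj c1 w → ¬ FarFrom G c0 c2 c3 c4 w := fun h h' => a1 ⟨w, vw, h, h'⟩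
    have b2 : G.Adj c2 w → ¬ FarFrom G c3 c1 c0 c4 w := fun h h' => a2 ⟨w, vw, h, h'⟩
    have b3 := a3 w vw
    have b4 := a4 w vw
    have h0 := h0 w
    have h3 := h3 w
    have h4 := h4 w
    have n0 := E.tri (a := w) (b := c0) (c := c1)
    have n1 := E.tri (a := w) (b := c1) (c := c2)
    have n2 := E.tri (a := w) (b := c2) (c := c3)
    have n3 := E.tri (a := w) (b := c3) (c := c4)
    have n4 := E.tri (a := w) (b := c4) (c := c0)
    obtain ⟨e01, e12, e23, e34, e40⟩ := C
    unfold FarFrom at b0 b1 b2 b3 b4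
    clear a0 a1 a2 a3 a4 hdom
    grind [SimpleGraph.adj_comm]
  -- The hexagon `t' c3 c4 c0 t v` with `c1`, adjacent to the opposite vertices `t'` and `c0`, is a
  -- shell.
  have excl : ∀ t t', G.Adj v t → G.Adj v t' → G.Adj c0 t → G.Adj c2 t → G.Adj c3 t' →
      G.Adj c1 t' → False := fun t t' vt vt' t0 t2 t3 t1 =>
    E.shell t' c3 c4 c0 t v c1 t3.symm C.4 C.5 t0 vt.symm vt' t1 C.1.symm (E.tri C.3.symm t2) v4
  by_cases hy : ∃ y, G.Adj v y ∧ ¬ G.Adj c0 y ∧ ¬ G.Adj c1 y ∧ ¬ G.Adj c2 y ∧ ¬ G.Adj c3 y ∧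
      ¬ G.Adj c4 y
  · obtain ⟨y, vy, y0, y1, y2, y3, y4⟩ := hy
    by_cases ht : ∃ t, G.Adj v t ∧ ((G.Adj c0 t ∧ G.Adj c2 t) ∨ (G.Adj c3 t ∧ G.Adj c1 t))
    · obtain ⟨t, vt, ht | ht⟩ := ht
      · exact Or.inl ⟨y, t, ⟨y0, y2, y3, y4⟩, vy, ht.1, ht.2, vt.symm⟩
      · exact Or.inr ⟨y, t, ⟨y3, y1, y0, y4⟩, vy, ht.1, ht.2, vt.symm⟩
    -- Here `v` has degree one, and any other neighbour of `y` dominates it; connectedness provides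
    -- such a neighbour.
    · have uniq : ∀ w, G.Adj v w → w = y := fun w vw => by
        rcases kind w vw with h | h
        · exact E.eq_of_adj_far hG hconn C (x := v) ⟨v0, v2, v3, v4⟩ ⟨h.1, h.2.2⟩
            ⟨y0, y2, y3, y4⟩ vw vy
        · exact absurd ⟨w, vw, h⟩ ht
      obtain ⟨d, -, hd1, hd2⟩ := (hconn.preconnected v c0).some.exists_boundary_dart {v, y}
        (by simp) (by
          rintro (h | h)
          · exact v1 (h ▸ C.1.symm)
          · rw [Set.mem_singleton_iff] at h
            exact v0 (h ▸ vy.symm))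
      have hv : d.snd ≠ v := fun h => hd2 (Or.inl h)
      have hy : G.Adj y d.snd := by
        rcases hd1 with h | h
        · exact absurd (Or.inr (uniq _ (h ▸ d.adj))) hd2
        · rw [Set.mem_singleton_iff] at h
          exact h ▸ d.adj
      refine absurd ⟨hv, fun h => E.tri vy hy h.symm, fun w hw => ?_⟩ (hdom v d.snd)
      rw [uniq w hw]
      exact hy.symm
  · have kind' : ∀ w, G.Adj v w → (G.Adj c0 w ∧ G.Adj c2 w) ∨ (G.Adj c3 w ∧ G.Adj c1 w) :=
      fun w vw => (kind w vw).resolve_left fun h => hy ⟨w, vw, h⟩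
    -- By `excl` all neighbours of `v` lie in the same class, so `c0` or `c1` dominates `v`.
    by_cases ht : ∃ t, G.Adj v t ∧ G.Adj c0 t ∧ G.Adj c2 t
    · obtain ⟨t, vt, t0, t2⟩ := ht
      refine absurd ⟨?_, v0, fun w hw => ?_⟩ (hdom v c0)
      · rintro rfl
        exact v1 C.1.symm
      · rcases kind' w hw with h | h
        · exact h.1
        · exact (excl t w vt hw t0 t2 h.1 h.2).elim
    · refine absurd ⟨?_, v1, fun w hw => ?_⟩ (hdom v c1)
      · rintro rfl
        exact v0 C.1
      · rcases kind' w hw with h | h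
        · exact absurd ⟨w, hw, h⟩ ht
        · exact h.2

end Undetermined

/-! ### Guesses, and why they leave lists of at most two colors -/

section Guess

variable {V : Type*} {G : SimpleGraph V}

/-- `v` comes before `s`: it sees more edges of `G[Y]`, where ties are broken by the order of `V`. -/
def Before [LT V] (G : SimpleGraph V) (Y : V → Prop) (v s : V) : Prop :=
  (∃ x y, Y x ∧ Y y ∧ G.Adj x y ∧ Sees G v x y ∧ ¬ Sees G s x y) ∨
    ((¬ ∃ x y, Y x ∧ Y y ∧ G.Adj x y ∧ Sees G s x y ∧ ¬ Sees G v x y) ∧ v < s)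

/-- On `T` the sets of seen edges form a chain, so inclusion amounts to comparing cardinalities.
Subtracting the cardinality from a common bound puts vertices that see more first; the vertex as
second component breaks ties and makes the key injective. -/
theorem before_iff [Fintype V] [LinearOrder V] {Y T : V → Prop}
    (hT : ∀ {t t' x y x' y'}, T t → T t' → Y x → Y y → G.Adj x y → Y x' → Y y' → G.Adj x' y' →
      Sees G t x y → ¬ Sees G t x' y' → Sees G t' x' y' → ¬ Sees G t' x y → False) :
    ∃ key : V → ℕ ×ₗ V, Function.Injective key ∧
      ∀ v s, T v → T s → (Before G Y v s ↔ key v < key s) := by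
  classical
  let S : V → Finset (V × V) := fun v =>
    Finset.univ.filter fun p => Y p.1 ∧ Y p.2 ∧ G.Adj p.1 p.2 ∧ Sees G v p.1 p.2
  have hS : ∀ v s, (∃ x y, Y x ∧ Y y ∧ G.Adj x y ∧ Sees G v x y ∧ ¬ Sees G s x y) ↔ ¬ S v ⊆ S s := by
    intro v s
    rw [Finset.not_subset]
    simp only [S, Finset.mem_filter, Finset.mem_univ, true_and, Prod.exists]
    grind
  have hle : ∀ v, (S v).card ≤ (Finset.univ : Finset (V × V)).card := fun v =>
    Finset.card_le_univ _
  have hnest : ∀ v s, T v → T s → S v ⊆ S s ∨ S s ⊆ S v := by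
    intro v s hv hs
    by_contra! h
    obtain ⟨x, y, hx, hy, xy, h1, h2⟩ := (hS v s).2 h.1
    obtain ⟨x', y', hx', hy', xy', h3, h4⟩ := (hS s v).2 h.2
    exact hT hv hs hx hy xy hx' hy' xy' h1 h4 h3 h2
  refine ⟨fun v => toLex ((Finset.univ : Finset (V × V)).card - (S v).card, v), ?_, ?_⟩
  · intro v s h
    simpa using congrArg (fun p => (ofLex p).2) h
  · intro v s hv hs
    unfold Before
    rw [hS, hS, Prod.Lex.toLex_lt_toLex, not_not]
    have := hle v
    have := hle s
    rcases hnest v s hv hs with h | h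
    · have hc := Finset.card_le_card h
      have : (S s ⊆ S v) ↔ (S v).card = (S s).card :=
        ⟨fun h' => le_antisymm hc (Finset.card_le_card h'),
          fun h' => (Finset.eq_of_subset_of_card_le h h'.ge).ge⟩
      rw [this]
      simp only [h, not_true_eq_false, false_or]
      constructor
      · rintro ⟨h1, h2⟩
        exact Or.inr ⟨by omega, h2⟩
      · rintro (h1 | ⟨h1, h2⟩)
        · omega
        · exact ⟨by omega, h2⟩
    · have hc := Finset.card_le_card h
      have : (S v ⊆ S s) ↔ (S v).card = (S s).card :=
        ⟨fun h' => le_antisymm (Finset.card_le_card h') hc,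
          fun h' => (Finset.eq_of_subset_of_card_le h h'.le).ge⟩
      rw [this]
      simp only [h, true_and]
      constructor
      · rintro (h1 | h1)
        · exact Or.inl (by omega)
        · rcases hc.lt_or_eq with h2 | h2
          · exact Or.inl (by omega)
          · exact Or.inr ⟨by omega, h1⟩
      · rintro (h1 | ⟨h1, h2⟩)
        · exact Or.inl (by omega)
        · exact Or.inr h2

/-- The colors `d` and `e` describe the coloring `f` on an initial segment of `T` that either is all
of `T` or has two colors. -/
structure Guess [LT V] (G : SimpleGraph V) (Y T : V → Prop) (f : V → Fin 3) (s : V) (d e : Fin 3) :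
    Prop where
  mem : T s
  last : f s = e
  before : ∀ v, T v → Before G Y v s → f v = d
  full : (∀ v, T v → Before G Y v s ∨ v = s) ∨ (d ≠ e ∧ ∃ u, T u ∧ Before G Y u s)
  total : ∀ v, T v → Before G Y v s ∨ v = s ∨ Before G Y s v
  mono : ∀ v v' x y, T v → T v' → Before G Y v v' → Y x → Y y → G.Adj x y → Sees G v' x y →
    Sees G v x y
  color : ∃ v, T v ∧ f v = d

/-- If `f` is not constant on `T`, let `s` be the first vertex whose color differs from that of the
very first one. Otherwise let `s` be the last vertex, with `d = e`. -/
theorem exists_guess [Fintype V] [LinearOrder V] {Y T : V → Prop}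
    (hT : ∀ {t t' x y x' y'}, T t → T t' → Y x → Y y → G.Adj x y → Y x' → Y y' → G.Adj x' y' →
      Sees G t x y → ¬ Sees G t x' y' → Sees G t' x' y' → ¬ Sees G t' x y → False)
    (hne : ∃ t, T t) (f : V → Fin 3) : ∃ s d e, Guess G Y T f s d e := by
  classical
  obtain ⟨key, inj, hkey⟩ := before_iff hT
  have mono : ∀ v v' x y, T v → T v' → Before G Y v v' → Y x → Y y → G.Adj x y → Sees G v' x y →
      Sees G v x y := by
    rintro v v' x y hv hv' (⟨x', y', hx', hy', xy', h1, h2⟩ | ⟨h1, -⟩) hx hy xy hs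
    · by_contra h
      exact hT hv hv' hx' hy' xy' hx hy xy h1 h hs h2
    · by_contra h
      exact h1 ⟨x, y, hx, hy, xy, hs, h⟩
  have tot : ∀ s, T s → ∀ v, T v → Before G Y v s ∨ v = s ∨ Before G Y s v := by
    intro s hs v hv
    rw [hkey v s hv hs, hkey s v hs hv]
    rcases lt_trichotomy (key v) (key s) with h | h | h
    · exact Or.inl h
    · exact Or.inr (Or.inl (inj h))
    · exact Or.inr (Or.inr h)
  have ne : (Finset.univ.filter T).Nonempty := by
    obtain ⟨t, ht⟩ := hne
    exact ⟨t, by simpa using ht⟩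
  obtain ⟨t, ht, hmin⟩ := Finset.exists_min_image _ key ne
  simp only [Finset.mem_filter, Finset.mem_univ, true_and] at ht hmin
  by_cases h : ∃ v, T v ∧ f v ≠ f t
  · have ne' : (Finset.univ.filter fun v => T v ∧ f v ≠ f t).Nonempty := by
      obtain ⟨v, hv⟩ := h
      exact ⟨v, by simpa using hv⟩
    obtain ⟨s, hs, hmin'⟩ := Finset.exists_min_image _ key ne'
    simp only [Finset.mem_filter, Finset.mem_univ, true_and] at hs hmin'
    refine ⟨s, f t, f s, hs.1, rfl, fun v hv hvs => ?_, Or.inr ⟨hs.2.symm, t, ht, ?_⟩, tot s hs.1,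
      mono, t, ht, rfl⟩
    · by_contra hne
      exact absurd ((hkey v s hv hs.1).1 hvs) (hmin' v ⟨hv, hne⟩).not_gt
    · rw [hkey t s ht hs.1]
      refine lt_of_le_of_ne (hmin s hs.1) fun h => hs.2 (by rw [inj h])
  · push Not at h
    obtain ⟨s, hs, hmax⟩ := Finset.exists_max_image _ key ne
    simp only [Finset.mem_filter, Finset.mem_univ, true_and] at hs hmax
    refine ⟨s, f t, f s, hs, rfl, fun v hv _ => h v hv, Or.inl fun v hv => ?_, tot s hs, mono,
      t, ht, rfl⟩
    rw [hkey v s hv hs]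
    exact (hmax v hv).lt_or_eq.imp_right fun h => inj h

/-- The lists `L` are stable under unit propagation. -/
def Closed (G : SimpleGraph V) (L : V → Fin 3 → Prop) : Prop :=
  ∀ u v c, G.Adj u v → L u c → (∀ c', L u c' → c' = c) → ¬ L v c

/-- `f` is a 3-coloring that takes its colors from the lists `L`. -/
structure ListColoring (G : SimpleGraph V) (L : V → Fin 3 → Prop) (f : V → Fin 3) : Prop where
  mem : ∀ v, L v (f v)
  proper : ∀ u v, G.Adj u v → f u ≠ f v

/-- The coloring `f` certifies that the list of `u` is not empty, so an upper bound on this list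
suffices for propagation. -/
theorem not_mem_of_forced {L : V → Fin 3 → Prop} {f : V → Fin 3} (hL : Closed G L)
    (hf : ListColoring G L f) {u v : V} {c : Fin 3} (h : ∀ c', L u c' → c' = c) (uv : G.Adj u v) :
    ¬ L v c :=
  hL u v c uv (h _ (hf.mem u) ▸ hf.mem u) h

/-- If `v` had a full list, no vertex of known color would be adjacent to it, so its neighbour `t`
would come after `s`. By nestedness, `s` and an earlier `u` also see the edge `vy`, necessarily at
`y`. Then `y` loses the colors `d ≠ e` and is forced to `α`, the color that `T` avoids, and so `v`
loses `α`. -/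
theorem Guess.not_full [LT V] {Y T : V → Prop} {L : V → Fin 3 → Prop} {f : V → Fin 3}
    {s : V} {d e α : Fin 3} (g : Guess G Y T f s d e) (hα : ∀ v, T v → f v ≠ α)
    (hL : Closed G L) (hf : ListColoring G L f)
    (h1 : ∀ v, T v → Before G Y v s → ∀ c, L v c → c = d) (h2 : ∀ c, L s c → c = e)
    {v y t : V} (hv : Y v) (hy : Y y) (vy : G.Adj v y) (ht : T t) (tv : G.Adj t v) :
    ∃ c, ¬ L v c := by
  by_contra! full
  have nb : ∀ u, T u → Before G Y u s → ¬ G.Adj u v := fun u hu hus huv =>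
    not_mem_of_forced hL hf (h1 u hu hus) huv (full d)
  have ns : ¬ G.Adj s v := fun h => not_mem_of_forced hL hf h2 h (full e)
  rcases g.full with h | ⟨hde, u, hu, hus⟩
  · rcases h t ht with h | rfl
    · exact nb t ht h tv
    · exact ns tv
  · have hst : Before G Y s t := by
      rcases g.total t ht with h | rfl | h
      · exact absurd tv (nb t ht h)
      · exact absurd tv ns
      · exact h
    have hs := g.mono s t v y g.mem ht hst hv hy vy (Or.inl tv)
    have hu' := g.mono u s v y hu g.mem hus hv hy vy hs
    have sy := hs.resolve_left ns
    have uy := hu'.resolve_left (nb u hu hus)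
    have e1 := not_mem_of_forced hL hf h2 sy
    have e2 := not_mem_of_forced hL hf (h1 u hu hus) uy
    have hd : d ≠ α := by
      obtain ⟨w, hw, rfl⟩ := g.color
      exact hα w hw
    have he : e ≠ α := g.last ▸ hα s g.mem
    refine not_mem_of_forced hL hf (u := y) (v := v) (c := α) (fun c hc => ?_) vy.symm (full α)
    have hc1 : c ≠ e := fun h => e1 (h ▸ hc)
    have hc2 : c ≠ d := fun h => e2 (h ▸ hc)
    clear * - hc1 hc2 hd he hde
    revert c d e α
    decide

/-- With the right guesses all lists have at most two colors. -/
theorem Excl.exists_not_mem [Fintype V] [LT V] {c0 c1 c2 c3 c4 : V} (E : Excl G) (hG : Clean G)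
    (hconn : G.Connected) (C : Pentagon G c0 c1 c2 c3 c4) {L : V → Fin 3 → Prop} {f : V → Fin 3}
    (hL : Closed G L) (hf : ListColoring G L f)
    (h0 : ∀ c, L c0 c → c = 0) (h1 : ∀ c, L c1 c → c = 1) (h2 : ∀ c, L c2 c → c = 0)
    (h3 : ∀ c, L c3 c → c = 1) (h4 : ∀ c, L c4 c → c = 2) {s d e s' d' e'}
    (g : Guess G (FarFrom G c0 c2 c3 c4) (fun t => G.Adj c0 t ∧ G.Adj c2 t) f s d e)
    (g' : Guess G (FarFrom G c3 c1 c0 c4) (fun t => G.Adj c3 t ∧ G.Adj c1 t) f s' d' e')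
    (k1 : ∀ v, G.Adj c0 v ∧ G.Adj c2 v → Before G (FarFrom G c0 c2 c3 c4) v s →
      ∀ c, L v c → c = d) (k2 : ∀ c, L s c → c = e)
    (k1' : ∀ v, G.Adj c3 v ∧ G.Adj c1 v → Before G (FarFrom G c3 c1 c0 c4) v s' →
      ∀ c, L v c → c = d') (k2' : ∀ c, L s' c → c = e') (v : V) : ∃ c, ¬ L v c := by
  by_contra! full
  have v0 : ¬ G.Adj c0 v := fun h => not_mem_of_forced hL hf h0 h (full _)
  have v1 : ¬ G.Adj c1 v := fun h => not_mem_of_forced hL hf h1 h (full _)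
  have v2 : ¬ G.Adj c2 v := fun h => not_mem_of_forced hL hf h2 h (full _)
  have v3 : ¬ G.Adj c3 v := fun h => not_mem_of_forced hL hf h3 h (full _)
  have v4 : ¬ G.Adj c4 v := fun h => not_mem_of_forced hL hf h4 h (full _)
  -- A common neighbour of vertices with distinct colors `i` and `j` is forced to the third color
  -- `k`, so it has no neighbour with a full list.
  have det : ∀ {a b t : V} (i j k : Fin 3), i ≠ j → j ≠ k → i ≠ k → (∀ c, L a c → c = i) →
      (∀ c, L b c → c = j) → G.Adj a t → G.Adj b t → ¬ G.Adj t v := by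
    intro a b t i j k ij jk ik ha hb hat hbt htv
    have e1 := not_mem_of_forced hL hf ha hat
    have e2 := not_mem_of_forced hL hf hb hbt
    refine not_mem_of_forced hL hf (u := t) (v := v) (c := k) (fun c hc => ?_) htv (full k)
    have hc1 : c ≠ i := fun h => e1 (h ▸ hc)
    have hc2 : c ≠ j := fun h => e2 (h ▸ hc)
    clear * - hc1 hc2 ij jk ik
    revert c i j k
    decide
  rcases E.exists_far_edge hG hconn C v0 v1 v2 v3 v4
    (fun t => det 2 1 0 (by decide) (by decide) (by decide) h4 h1)
    (fun t => det 0 2 1 (by decide) (by decide) (by decide) h2 h4)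
    (fun t => det 1 0 2 (by decide) (by decide) (by decide) h3 h0) with
    ⟨y, t, hy, vy, ht, ht', tv⟩ | ⟨y, t, hy, vy, ht, ht', tv⟩
  -- Neighbours of `c0` avoid the color `0`; in the reflected case, neighbours of `c3` avoid `1`.
  · obtain ⟨c, hc⟩ := g.not_full (α := 0)
      (fun w hw => h0 _ (hf.mem c0) ▸ (hf.proper _ _ hw.1).symm) hL hf k1 k2
      (v := v) ⟨v0, v2, v3, v4⟩ hy vy ⟨ht, ht'⟩ tv
    exact hc (full c)
  · obtain ⟨c, hc⟩ := g'.not_full (α := 1)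
      (fun w hw => h3 _ (hf.mem c3) ▸ (hf.proper _ _ hw.1).symm) hL hf k1' k2'
      (v := v) ⟨v3, v1, v0, v4⟩ hy vy ⟨ht, ht'⟩ tv
    exact hc (full c)

end Guess

/-! ## A structured language with for-loops -/

section Execution

theorem run_add (B a b : ℕ) (c : List Prog × Store) :
    run B (a + b) c = (run B a c).bind (run B b) := by
  induction a generalizing c with
  | zero => simp [run]
  | succ a ih =>
    rw [Nat.succ_add]
    simp only [run]
    cases step B c with
    | none => rfl
    | some c' => simpa using ih c'

/-- The program piece `P` turns the memory `s` into `s'` in exactly `t` steps. -/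
def Exec (B : ℕ) (P : Prog) (s : Store) (t : ℕ) (s' : Store) : Prop :=
  ∀ K, run B t (P :: K, s) = some (K, s')

variable {B : ℕ} {s s' s'' : Store} {p q : Prog}

theorem Exec.of_step {P : Prog} (h : ∀ K, step B (P :: K, s) = some (K, s')) : Exec B P s 1 s' := by
  intro K
  simp [run, h]

theorem Exec.cons {P p : Prog} {t : ℕ} (h : ∀ K, step B (P :: K, s) = some (p :: K, s))
    (hp : Exec B p s t s') : Exec B P s (t + 1) s' := by
  intro K
  simpa [run, h] using hp K

theorem Exec.seq {t t' : ℕ} (hp : Exec B p s t s') (hq : Exec B q s' t' s'') :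
    Exec B (.seq p q) s (t + t' + 1) s'' := by
  intro K
  simp only [run, step, Option.bind_some]
  rw [run_add, hp]
  exact hq K

theorem Exec.loop_step {x t t' : ℕ} (hx : s.reg x ≠ 0) (hp : Exec B p s t s')
    (hq : Exec B (.loop x p) s' t' s'') : Exec B (.loop x p) s (t + t' + 1) s'' := by
  intro K
  simp only [run, step, Option.bind_some, if_pos hx]
  rw [run_add, hp]
  exact hq K

theorem Exec.loop_zero {x : ℕ} (hx : s.reg x = 0) : Exec B (.loop x p) s 1 s :=
  .of_step fun K => by simp [step, hx]

theorem Exec.const {x c : ℕ} (h : c ≤ B) : Exec B (.const x c) s 1 (s.setReg x c) :=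
  .of_step fun K => by simp [step, Store.write, h]

theorem Exec.move {x y : ℕ} (h : s.reg y ≤ B) : Exec B (.move x y) s 1 (s.setReg x (s.reg y)) :=
  .of_step fun K => by simp [step, Store.write, h]

theorem Exec.add {x y z : ℕ} (h : s.reg y + s.reg z ≤ B) :
    Exec B (.add x y z) s 1 (s.setReg x (s.reg y + s.reg z)) :=
  .of_step fun K => by simp [step, Store.write, h]

theorem Exec.sub {x y z : ℕ} (h : s.reg y - s.reg z ≤ B) :
    Exec B (.sub x y z) s 1 (s.setReg x (s.reg y - s.reg z)) :=
  .of_step fun K => by simp [step, Store.write, h]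

theorem Exec.mul {x y z : ℕ} (h : s.reg y * s.reg z ≤ B) :
    Exec B (.mul x y z) s 1 (s.setReg x (s.reg y * s.reg z)) :=
  .of_step fun K => by simp [step, Store.write, h]

theorem Exec.load {x a i : ℕ} (h : s.arr a (s.reg i) ≤ B) :
    Exec B (.load x a i) s 1 (s.setReg x (s.arr a (s.reg i))) :=
  .of_step fun K => by simp [step, Store.write, h]

theorem Exec.store {a i x : ℕ} : Exec B (.store a i x) s 1 (s.setArr a (s.reg i) (s.reg x)) :=
  .of_step fun K => by simp [step]

@[simp] theorem Store.reg_setReg (s : Store) (x w y : ℕ) :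
    (s.setReg x w).reg y = if y = x then w else s.reg y := by
  simp [Store.setReg, Function.update_apply]

@[simp] theorem Store.arr_setReg (s : Store) (x w : ℕ) : (s.setReg x w).arr = s.arr := rfl

@[simp] theorem Store.reg_setArr (s : Store) (a i w : ℕ) : (s.setArr a i w).reg = s.reg := rfl

@[simp] theorem Store.arr_setArr (s : Store) (a i w b j : ℕ) :
    (s.setArr a i w).arr b j = if b = a ∧ j = i then w else s.arr b j := by
  by_cases h : b = a
  · subst h
    simp [Store.setArr, Function.update_apply]
  · simp [Store.setArr, h]

end Execution

/-! ### Expressions: values, bounds and compilation -/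

/-- Expressions. -/
inductive Exp : Type
  | reg (x : ℕ)
  | lit (c : ℕ)
  | arr (a : ℕ) (e : Exp)
  | add (e f : Exp)
  | sub (e f : Exp)
  | mul (e f : Exp)

namespace Exp

/-- The value of an expression. -/
def eval (s : Store) : Exp → ℕ
  | reg x => s.reg x
  | lit c => c
  | arr a e => s.arr a (e.eval s)
  | add e f => e.eval s + f.eval s
  | sub e f => e.eval s - f.eval s
  | mul e f => e.eval s * f.eval s

/-- A program that evaluates an expression into the register `k`, using the registers from `k` on. -/
def compile (k : ℕ) : Exp → Prog
  | reg x => .move k x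
  | lit c => .const k c
  | arr a e => .seq (e.compile k) (.load k a k)
  | add e f => .seq (.seq (e.compile k) (f.compile (k + 1))) (.add k k (k + 1))
  | sub e f => .seq (.seq (e.compile k) (f.compile (k + 1))) (.sub k k (k + 1))
  | mul e f => .seq (.seq (e.compile k) (f.compile (k + 1))) (.mul k k (k + 1))

/-- The number of steps of `compile`. -/
def time : Exp → ℕ
  | reg _ => 1
  | lit _ => 1
  | arr _ e => e.time + 1 + 1
  | add e f => e.time + f.time + 1 + 1 + 1
  | sub e f => e.time + f.time + 1 + 1 + 1
  | mul e f => e.time + f.time + 1 + 1 + 1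

/-- An exponent `d` for which the value is at most `n ^ d` if the memory contains numbers up to `n`. -/
def deg : Exp → ℕ
  | reg _ => 1
  | lit _ => 1
  | arr _ _ => 1
  | add e f => max e.deg f.deg + 1
  | sub e _ => e.deg
  | mul e f => e.deg + f.deg

/-- The exponent of the word bound. -/
def maxDeg : ℕ := 20

/-- The registers from here on hold temporary values. -/
def tempBase : ℕ := 100

/-- The expression names no temporary registers and its intermediate results are bounded. -/
def ok : Exp → Bool
  | reg x => decide (x < tempBase)
  | lit c => decide (c ≤ 5)
  | arr _ e => e.ok
  | add e f => e.ok && f.ok && decide (max e.deg f.deg + 1 ≤ maxDeg)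
  | sub e f => e.ok && f.ok
  | mul e f => e.ok && f.ok && decide (e.deg + f.deg ≤ maxDeg)

end Exp

/-- The memory contains only numbers up to `n`, except in temporary registers. -/
structure Store.Bounded (n : ℕ) (s : Store) : Prop where
  reg : ∀ x < Exp.tempBase, s.reg x ≤ n
  arr : ∀ a i, s.arr a i ≤ n

/-- The memories agree except in temporary registers. -/
structure Store.Agree (s s' : Store) : Prop where
  reg : ∀ x < Exp.tempBase, s.reg x = s'.reg x
  arr : s.arr = s'.arr

namespace Exp

theorem eval_congr {s s' : Store} (h : s.Agree s') {e : Exp} (he : e.ok) : e.eval s = e.eval s' := by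
  induction e with
  | reg x => exact h.reg x (by simpa [ok] using he)
  | lit c => rfl
  | arr a e ih => simp [eval, ih he, h.arr]
  | add e f ihe ihf | sub e f ihe ihf | mul e f ihe ihf =>
    simp only [ok, Bool.and_eq_true] at he
    simp [eval, ihe (by tauto), ihf (by tauto)]

theorem deg_le {e : Exp} (he : e.ok) : e.deg ≤ maxDeg := by
  induction e with
  | reg | lit | arr => simp [deg, maxDeg]
  | add | mul =>
    simp only [ok, Bool.and_eq_true, decide_eq_true_eq] at he
    exact he.2
  | sub e f ihe ihf =>
    simp only [ok, Bool.and_eq_true] at he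
    exact ihe he.1

/-- Literals are at most `5 ≤ n`, and a sum costs one more exponent because `2 * n ^ d ≤ n ^ (d +
1)`. -/
theorem eval_le {n : ℕ} (hn : 5 ≤ n) {s : Store} (h : s.Bounded n) {e : Exp} (he : e.ok) :
    e.eval s ≤ n ^ e.deg := by
  induction e with
  | reg x => simpa [eval, deg] using h.reg x (by simpa [ok] using he)
  | lit c => simpa [eval, deg] using (show c ≤ 5 by simpa [ok] using he).trans hn
  | arr a e ih => simpa [eval, deg] using h.arr a _
  | add e f ihe ihf =>
    simp only [ok, Bool.and_eq_true] at he
    have h1 := (ihe he.1.1).trans (Nat.pow_le_pow_right (by omega) (le_max_left e.deg f.deg))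
    have h2 := (ihf he.1.2).trans (Nat.pow_le_pow_right (by omega) (le_max_right e.deg f.deg))
    simp only [eval, deg, pow_succ]
    nlinarith
  | sub e f ihe ihf =>
    simp only [ok, Bool.and_eq_true] at he
    exact (Nat.sub_le _ _).trans (ihe he.1)
  | mul e f ihe ihf =>
    simp only [ok, Bool.and_eq_true] at he
    simp only [eval, deg, pow_add]
    exact Nat.mul_le_mul (ihe he.1.1) (ihf he.1.2)

/-- The registers from `k` on act as an evaluation stack: the second operand is computed in `k + 1`
and above, which leaves the first one in `k` intact. -/
theorem exec_compile {n : ℕ} (hn : 5 ≤ n) {e : Exp} (he : e.ok) {s : Store} (h : s.Bounded n) {k : ℕ}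
    (hk : tempBase ≤ k) : ∃ s', Exec (n ^ maxDeg) (e.compile k) s e.time s' ∧
      s'.reg k = e.eval s ∧ s'.arr = s.arr ∧ ∀ x < k, s'.reg x = s.reg x := by
  have hle : e.eval s ≤ n ^ maxDeg :=
    (eval_le hn h he).trans (Nat.pow_le_pow_right (by omega) (deg_le he))
  have stay : ∀ {s' : Store} {k : ℕ}, tempBase ≤ k → s'.arr = s.arr →
      (∀ x < k, s'.reg x = s.reg x) → s'.Bounded n ∧ s.Agree s' := fun hk ha hr =>
    ⟨⟨fun x hx => hr x (hx.trans_le hk) ▸ h.reg x hx, ha ▸ h.arr⟩,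
      fun x hx => (hr x (hx.trans_le hk)).symm, ha.symm⟩
  have setReg : ∀ (s' : Store) (w : ℕ), s'.arr = s.arr → (∀ x < k, s'.reg x = s.reg x) →
      (s'.setReg k w).reg k = w ∧ (s'.setReg k w).arr = s.arr ∧
        ∀ x < k, (s'.setReg k w).reg x = s.reg x := fun s' w ha hr =>
    ⟨by simp, ha, fun x hx => by simp [hx.ne, hr x hx]⟩
  induction e generalizing s k with
  | reg x => exact ⟨_, .move hle, setReg s _ rfl fun _ _ => rfl⟩
  | lit c => exact ⟨_, .const hle, setReg s _ rfl fun _ _ => rfl⟩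
  | arr a e ih =>
    have he' : e.ok := he
    obtain ⟨s1, h1, r1, a1, k1⟩ := ih he' h hk
      ((eval_le hn h he').trans (Nat.pow_le_pow_right (by omega) (deg_le he'))) stay setReg
    have e1 : s1.arr a (s1.reg k) = (arr a e).eval s := by rw [r1, a1]; rfl
    refine ⟨_, .seq h1 (.load (by rwa [e1])), ?_⟩
    rw [e1]
    exact setReg s1 _ a1 k1
  | add e f ihe ihf | sub e f ihe ihf | mul e f ihe ihf =>
    simp only [ok, Bool.and_eq_true] at he
    have he1 : e.ok := by tauto
    have hf1 : f.ok := by tauto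
    obtain ⟨s1, h1, r1, a1, k1⟩ := ihe he1 h hk
      ((eval_le hn h he1).trans (Nat.pow_le_pow_right (by omega) (deg_le he1))) stay setReg
    obtain ⟨b1, g1⟩ := stay hk a1 k1
    have le2 := (eval_le hn b1 hf1).trans (Nat.pow_le_pow_right (by omega) (deg_le hf1))
    obtain ⟨s2, h2, r2, a2, k2⟩ := ihf hf1 b1 (hk.trans k.le_succ) le2
      (fun hk ha hr => ⟨⟨fun x hx => hr x (hx.trans_le hk) ▸ b1.reg x hx, ha ▸ b1.arr⟩,
        fun x hx => (hr x (hx.trans_le hk)).symm, ha.symm⟩)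
      (fun s' w ha hr => ⟨by simp, ha, fun x hx => by simp [hx.ne, hr x hx]⟩)
    rw [← eval_congr g1 hf1] at r2
    have r1' : s2.reg k = e.eval s := by rw [k2 k k.lt_succ_self, r1]
    have k2' : ∀ x < k, s2.reg x = s.reg x := fun x hx => by
      rw [k2 x (hx.trans k.lt_succ_self), k1 x hx]
    simp only [eval] at hle ⊢
    rw [← r1', ← r2] at hle ⊢
    have h12 := h1.seq h2
    first
    | have h3 := h12.seq (.add (x := k) hle)
      exact ⟨_, h3, setReg s2 _ (a2.trans a1) k2'⟩
    | have h3 := h12.seq (.sub (x := k) hle)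
      exact ⟨_, h3, setReg s2 _ (a2.trans a1) k2'⟩
    | have h3 := h12.seq (.mul (x := k) hle)
      exact ⟨_, h3, setReg s2 _ (a2.trans a1) k2'⟩

end Exp

/-! ### Commands: semantics, compilation and running time -/

/-- Commands. The loop `loop i p` runs `p` with `i = n - 1, …, 1, 0`, where `n` is the content of the
register `0`. -/
inductive Cmd : Type
  | skip
  | assign (x : ℕ) (e : Exp)
  | store (a : ℕ) (i e : Exp)
  | seq (p q : Cmd)
  | ite (e : Exp) (p q : Cmd)
  | loop (i : ℕ) (p : Cmd)

/-- The iterations `i = k - 1, …, 1, 0` of a loop. -/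
def iter (f : Store → Store) (i : ℕ) : ℕ → Store → Store
  | 0, s => s
  | k + 1, s => iter f i k (f (s.setReg i k))

namespace Cmd

open Exp (tempBase maxDeg)

/-- The effect of a command. -/
def sem : Cmd → Store → Store
  | skip, s => s
  | assign x e, s => s.setReg x (e.eval s)
  | store a i e, s => s.setArr a (i.eval s) (e.eval s)
  | seq p q, s => q.sem (p.sem s)
  | ite e p q, s => if e.eval s ≠ 0 then p.sem s else q.sem s
  | loop i p, s => iter p.sem i (s.reg 0) (s.setReg i (s.reg 0))

/-- The translation of commands into programs. -/
def compile : Cmd → Prog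
  | skip => .skip
  | assign x e => .seq (e.compile tempBase) (.move x tempBase)
  | store a i e => .seq (.seq (i.compile tempBase) (e.compile (tempBase + 1)))
      (.store a tempBase (tempBase + 1))
  | seq p q => .seq p.compile q.compile
  | ite e p q => .seq (e.compile tempBase) (.ite tempBase p.compile q.compile)
  | loop i p => .seq (.move i 0)
      (.loop i (.seq (.seq (.const tempBase 1) (.sub i i tempBase)) p.compile))

/-- The registers that a command assigns to. -/
def writes : Cmd → List ℕ
  | skip => []
  | assign x _ => [x]
  | store _ _ _ => []
  | seq p q => p.writes ++ q.writes
  | ite _ p q => p.writes ++ q.writes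
  | loop i p => i :: p.writes

/-- The arrays that a command stores to. -/
def stores : Cmd → List ℕ
  | skip => []
  | assign _ _ => []
  | store a _ _ => [a]
  | seq p q => p.stores ++ q.stores
  | ite _ p q => p.stores ++ q.stores
  | loop _ p => p.stores

/-- The exponent of the running time. -/
def deg : Cmd → ℕ
  | skip => 0
  | assign _ _ => 0
  | store _ _ _ => 0
  | seq p q => max p.deg q.deg
  | ite _ p q => max p.deg q.deg
  | loop _ p => p.deg + 1

/-- The coefficient of the running time. -/
def coef : Cmd → ℕ
  | skip => 1
  | assign _ e => e.time + 1 + 1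
  | store _ i e => i.time + e.time + 1 + 1 + 1
  | seq p q => p.coef + q.coef + 1
  | ite e p q => e.time + p.coef + q.coef + 2
  | loop _ p => p.coef + 8

/-- The command respects the word bound, the temporary registers, the size register and the loop
variables. -/
def ok : Cmd → Bool
  | skip => true
  | assign x e => decide (x ≠ 0) && decide (x < tempBase) && e.ok && decide (e.deg ≤ 1)
  | store _ i e => i.ok && e.ok && decide (e.deg ≤ 1)
  | seq p q => p.ok && q.ok
  | ite e p q => e.ok && p.ok && q.ok
  | loop i p => decide (i ≠ 0) && decide (i < tempBase) && p.ok && decide (i ∉ p.writes)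

theorem reg_sem {x : ℕ} {p : Cmd} (hx : x ∉ p.writes) (s : Store) : (p.sem s).reg x = s.reg x := by
  induction p generalizing s with
  | skip => rfl
  | assign y e => simp_all [sem, writes]
  | store => rfl
  | seq p q ihp ihq =>
    simp only [writes, List.mem_append, not_or] at hx
    simp [sem, ihp hx.1, ihq hx.2]
  | ite e p q ihp ihq =>
    simp only [writes, List.mem_append, not_or] at hx
    simp only [sem]
    split <;> simp [ihp hx.1, ihq hx.2]
  | loop i p ih =>
    simp only [writes, List.mem_cons, not_or] at hx
    have : ∀ k s, (iter p.sem i k s).reg x = s.reg x := by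
      intro k
      induction k with
      | zero => simp [iter]
      | succ k ihk => simp [iter, ihk, ih hx.2, hx.1]
    simp [sem, this, hx.1]

theorem arr_sem {a : ℕ} {p : Cmd} (ha : a ∉ p.stores) (s : Store) : (p.sem s).arr a = s.arr a := by
  induction p generalizing s with
  | skip => rfl
  | assign y e => rfl
  | store b =>
    funext j
    simp_all [sem, stores]
  | seq p q ihp ihq =>
    simp only [stores, List.mem_append, not_or] at ha
    simp [sem, ihp ha.1, ihq ha.2]
  | ite e p q ihp ihq =>
    simp only [stores, List.mem_append, not_or] at ha
    simp only [sem]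
    split <;> simp [ihp ha.1, ihq ha.2]
  | loop i p ih =>
    have : ∀ k s, (iter p.sem i k s).arr a = s.arr a := by
      intro k
      induction k with
      | zero => simp [iter]
      | succ k ihk => simp [iter, ihk, ih ha]
    simp [sem, this]

theorem zero_notMem_writes {p : Cmd} (hp : p.ok) : 0 ∉ p.writes := by
  induction p with
  | skip | store => simp [writes]
  | assign x e =>
    simp only [ok, Bool.and_eq_true, decide_eq_true_eq] at hp
    simpa [writes] using hp.1.1.1.symm
  | seq p q ihp ihq =>
    simp only [ok, Bool.and_eq_true] at hp
    simp [writes, ihp hp.1, ihq hp.2]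
  | ite e p q ihp ihq =>
    simp only [ok, Bool.and_eq_true] at hp
    simp [writes, ihp hp.1.2, ihq hp.2]
  | loop i p ih =>
    simp only [ok, Bool.and_eq_true, decide_eq_true_eq] at hp
    simpa [writes, ih hp.1.2] using hp.1.1.1.symm

/-- A simulation: `s` is the memory of the semantics, which knows no temporaries, and `s₁` that of
the machine. Other words stay at most `n`, since assigned and stored expressions have degree at most
one. Register `0` is never written, so every loop has length `n` and the nesting depth is the
exponent. -/
theorem exec_compile {n : ℕ} (hn : 5 ≤ n) {p : Cmd} (hp : p.ok) {s s₁ : Store} (hs : s.Bounded n)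
    (h0 : s.reg 0 = n) (hss : s.Agree s₁) : ∃ t s₁', t ≤ p.coef * n ^ p.deg ∧
      Exec (n ^ maxDeg) p.compile s₁ t s₁' ∧ (p.sem s).Agree s₁' ∧ (p.sem s).Bounded n := by
  have bd : ∀ {s s₁ : Store}, s.Bounded n → s.Agree s₁ → s₁.Bounded n := fun hs h =>
    ⟨fun x hx => h.reg x hx ▸ hs.reg x hx, h.arr ▸ hs.arr⟩
  have nB : n ≤ n ^ maxDeg := Nat.le_self_pow (by simp [maxDeg]) n
  have one_le : ∀ d, 1 ≤ n ^ d := fun d => Nat.one_le_pow _ _ (by omega)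
  have evn : ∀ {s : Store} {e : Exp}, s.Bounded n → e.ok → e.deg ≤ 1 → e.eval s ≤ n := fun hs he hd =>
    (Exp.eval_le hn hs he).trans ((Nat.pow_le_pow_right (by omega) hd).trans (by simp))
  induction p generalizing s s₁ with
  | skip => exact ⟨1, s₁, by simp [coef, deg], .of_step fun K => by simp [step, compile], hss, hs⟩
  | assign x e =>
    simp only [ok, Bool.and_eq_true, decide_eq_true_eq] at hp
    obtain ⟨⟨⟨-, hx⟩, he⟩, hd⟩ := hp
    obtain ⟨s', h1, r1, a1, k1⟩ := Exp.exec_compile hn he (bd hs hss) le_rfl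
    have ev := evn hs he hd
    rw [← Exp.eval_congr hss he] at r1
    refine ⟨_, _, by simp [coef, deg], .seq h1 (.move (by omega)), ⟨fun y hy => ?_, ?_⟩,
      ⟨fun y hy => ?_, hs.arr⟩⟩
    · simp [sem, r1, k1 y hy, hss.reg y hy]
    · simpa [sem, a1] using hss.arr
    · have := hs.reg y hy
      simp only [sem, Store.reg_setReg]
      split <;> assumption
  | store a i e =>
    simp only [ok, Bool.and_eq_true, decide_eq_true_eq] at hp
    obtain ⟨⟨hi, he⟩, hd⟩ := hp
    obtain ⟨s', h1, r1, a1, k1⟩ := Exp.exec_compile hn hi (bd hs hss) le_rfl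
    have hss' : s₁.Agree s' := ⟨fun x hx => (k1 x hx).symm, a1.symm⟩
    obtain ⟨s'', h2, r2, a2, k2⟩ := Exp.exec_compile hn he (bd (bd hs hss) hss')
      (Nat.le_succ tempBase)
    have ev := evn hs he hd
    rw [← Exp.eval_congr hss hi] at r1
    rw [← Exp.eval_congr hss' he, ← Exp.eval_congr hss he] at r2
    have r1' : s''.reg tempBase = i.eval s := by rw [k2 _ (Nat.lt_succ_self _), r1]
    refine ⟨_, _, by simp [coef, deg], .seq (.seq h1 h2) .store, ⟨fun y hy => ?_, ?_⟩,
      ⟨hs.reg, fun b j => ?_⟩⟩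
    · simp [sem, k2 y (hy.trans (Nat.lt_succ_self _)), k1 y hy, hss.reg y hy]
    · funext b j
      simp only [sem, Store.arr_setArr, r1', r2, a2, a1, hss.arr]
    · have := hs.arr b j
      simp only [sem, Store.arr_setArr]
      split <;> assumption
  | seq p q ihp ihq =>
    simp only [ok, Bool.and_eq_true] at hp
    obtain ⟨t, s', ht, h1, g1, b1⟩ := ihp hp.1 hs h0 hss
    obtain ⟨t', s'', ht', h2, g2, b2⟩ := ihq hp.2 b1
      (by rw [reg_sem (zero_notMem_writes hp.1), h0]) g1
    refine ⟨_, _, ?_, .seq h1 h2, g2, b2⟩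
    have e1 : n ^ p.deg ≤ n ^ max p.deg q.deg := Nat.pow_le_pow_right (by omega) (le_max_left _ _)
    have e2 : n ^ q.deg ≤ n ^ max p.deg q.deg := Nat.pow_le_pow_right (by omega) (le_max_right _ _)
    have := Nat.mul_le_mul_left p.coef e1
    have := Nat.mul_le_mul_left q.coef e2
    have := one_le (max p.deg q.deg)
    simp only [coef, deg, add_mul]
    omega
  | ite e p q ihp ihq =>
    simp only [ok, Bool.and_eq_true] at hp
    obtain ⟨⟨he, hp⟩, hq⟩ := hp
    obtain ⟨s', h1, r1, a1, k1⟩ := Exp.exec_compile hn he (bd hs hss) le_rfl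
    have hss' : s.Agree s' := ⟨fun x hx => (hss.reg x hx).trans (k1 x hx).symm, hss.arr.trans a1.symm⟩
    rw [← Exp.eval_congr hss he] at r1
    have e1 : n ^ p.deg ≤ n ^ max p.deg q.deg := Nat.pow_le_pow_right (by omega) (le_max_left _ _)
    have e2 : n ^ q.deg ≤ n ^ max p.deg q.deg := Nat.pow_le_pow_right (by omega) (le_max_right _ _)
    have f1 := Nat.mul_le_mul_left p.coef e1
    have f2 := Nat.mul_le_mul_left q.coef e2
    have f3 := one_le (max p.deg q.deg)
    have f4 := Nat.mul_le_mul_left e.time f3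
    simp only [sem, coef, deg, add_mul]
    by_cases hev : e.eval s ≠ 0
    · obtain ⟨t, s'', ht, h2, g2, b2⟩ := ihp hp hs h0 hss'
      refine ⟨_, _, ?_, .seq h1 (.cons (fun K => ?_) h2), ?_⟩
      · omega
      · simp [step, r1, hev]
      · rw [if_pos hev]
        exact ⟨g2, b2⟩
    · obtain ⟨t, s'', ht, h2, g2, b2⟩ := ihq hq hs h0 hss'
      refine ⟨_, _, ?_, .seq h1 (.cons (fun K => ?_) h2), ?_⟩
      · omega
      · simp [step, r1, not_not.1 hev]
      · rw [if_neg hev]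
        exact ⟨g2, b2⟩
  | loop i p ih =>
    simp only [ok, Bool.and_eq_true, decide_eq_true_eq] at hp
    obtain ⟨⟨⟨hi0, hi⟩, hp⟩, hw⟩ := hp
    -- Besides the body, an iteration costs 3 steps for the decrement, one for sequencing and one
    -- for the loop test; the final `1` is the last test. With the initial move and its sequencing
    -- this accounts for the 8 in `coef`.
    have main : ∀ k ≤ n, ∀ s s₁ : Store, s.Bounded n → s.reg 0 = n → s.Agree s₁ → s.reg i = k →
        ∃ t s₁', t ≤ k * (p.coef * n ^ p.deg + 5) + 1 ∧
          Exec (n ^ maxDeg) (.loop i (.seq (.seq (.const tempBase 1) (.sub i i tempBase)) p.compile))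
            s₁ t s₁' ∧ (iter p.sem i k s).Agree s₁' ∧ (iter p.sem i k s).Bounded n := by
      intro k
      induction k with
      | zero =>
        intro _ s s₁ hs h0 hss hk
        exact ⟨1, s₁, by omega, .loop_zero (by rw [← hss.reg i hi, hk]), hss, hs⟩
      | succ k ihk =>
        intro hkn s s₁ hs h0 hss hk
        have hk1 : s₁.reg i = k + 1 := by rw [← hss.reg i hi, hk]
        have hit : i ≠ tempBase := hi.ne
        have hB : k ≤ n ^ maxDeg := by omega
        set s₂ := (s₁.setReg tempBase 1).setReg i k with hs₂
        have e1 : Exec (n ^ maxDeg) (.seq (.const tempBase 1) (.sub i i tempBase)) s₁ 3 s₂ := by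
          have := Exec.sub (B := n ^ maxDeg) (s := s₁.setReg tempBase 1) (x := i) (y := i)
            (z := tempBase) (by simp [hit, hk1, hB])
          simp only [Store.reg_setReg, if_neg hit, hk1, if_true, Nat.add_sub_cancel] at this
          exact .seq (.const (one_le _)) this
        have g1 : (s.setReg i k).Agree s₂ := ⟨fun x hx => by
          simp [hs₂, (show x ≠ tempBase from hx.ne), hss.reg x hx], by simpa [hs₂] using hss.arr⟩
        have b1 : (s.setReg i k).Bounded n := ⟨fun x hx => by
          have := hs.reg x hx
          simp only [Store.reg_setReg]
          split <;> omega, hs.arr⟩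
        have z1 : (s.setReg i k).reg 0 = n := by simp [hi0.symm, h0]
        obtain ⟨t, s₃, ht, h2, g2, b2⟩ := ih hp b1 z1 g1
        -- The body does not write its loop variable, so register `i` still contains `k` when the
        -- remaining iterations start.
        obtain ⟨t', s₄, ht', h3, g3, b3⟩ := ihk (by omega) _ _ b2
          (by rw [reg_sem (zero_notMem_writes hp), z1]) g2 (by rw [reg_sem hw]; simp)
        refine ⟨_, _, ?_, .loop_step (by omega) (.seq e1 h2) h3, g3, b3⟩
        rw [add_mul]
        omega
    obtain ⟨t, s', ht, h1, g1, b1⟩ := main n le_rfl (s.setReg i n) (s₁.setReg i n)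
      ⟨fun x hx => by
        have := hs.reg x hx
        simp only [Store.reg_setReg]
        split <;> omega, hs.arr⟩
      (by simp [hi0.symm, h0])
      ⟨fun x hx => by simp [hss.reg x hx], hss.arr⟩ (by simp)
    have z : s₁.reg 0 = n := by rw [← hss.reg 0 (by simp [tempBase]), h0]
    have mv := Exec.move (B := n ^ maxDeg) (s := s₁) (x := i) (y := 0) (by rw [z]; exact nB)
    rw [z] at mv
    refine ⟨_, _, ?_, .seq mv h1, ?_⟩
    · simp only [coef, deg, pow_succ]
      have := one_le p.deg
      nlinarith
    · simp only [sem, h0]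
      exact ⟨g1, b1⟩

end Cmd

/-! ## Unit propagation and lists of size two -/

section Pure

variable {V : Type*} {G : SimpleGraph V} {L L' : V → Fin 3 → Prop}

/-- The list of `u` is `{c}`. -/
def Forced (L : V → Fin 3 → Prop) (u : V) (c : Fin 3) : Prop := L u c ∧ ∀ c', L u c' → c' = c

/-- Remove the color `c` from the list of `v`. -/
def remove (L : V → Fin 3 → Prop) (v : V) (c : Fin 3) : V → Fin 3 → Prop :=
  fun w c' => L w c' ∧ ¬ (w = v ∧ c' = c)

/-- Set the list of `v` to `{c}`. -/
def setTo (L : V → Fin 3 → Prop) (v : V) (c : Fin 3) : V → Fin 3 → Prop :=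
  fun w c' => (w = v ∧ c' = c) ∨ (w ≠ v ∧ L w c')

/-- `L'` arises from `L` by unit propagation, where the triples in `D` were examined. -/
structure Pass (G : SimpleGraph V) (L L' : V → Fin 3 → Prop) (D : V → V → Fin 3 → Prop) : Prop where
  le : ∀ v c, L' v c → L v c
  keep : ∀ f, ListColoring G L f → ListColoring G L' f
  idle : Closed G L → L' = L
  stable : L' = L → ∀ u v c, D u v c → G.Adj u v → Forced L u c → ¬ L v c

theorem Pass.refl (G : SimpleGraph V) (L : V → Fin 3 → Prop) : Pass G L L fun _ _ _ => False :=
  ⟨fun _ _ h => h, fun _ h => h, fun _ => rfl, fun _ _ _ _ h => h.elim⟩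

theorem Pass.mono {D D' : V → V → Fin 3 → Prop} (h : Pass G L L' D)
    (hD : ∀ u v c, D' u v c → D u v c) : Pass G L L' D' :=
  ⟨h.le, h.keep, h.idle, fun he u v c hd => h.stable he u v c (hD u v c hd)⟩

-- Removing a forced color from a neighbour loses no list coloring. If the final lists equal `L`,
-- then by monotonicity all intermediate lists did too, so what was found for earlier triples
-- remains valid.
open Classical in
theorem Pass.step {D : V → V → Fin 3 → Prop} (h : Pass G L L' D) (a b : V) (c : Fin 3) :
    Pass G L (if G.Adj a b ∧ Forced L' a c then remove L' b c else L')
      fun u v c' => D u v c' ∨ (u = a ∧ v = b ∧ c' = c) := by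
  split_ifs with hs
  · obtain ⟨hab, hc⟩ := hs
    refine ⟨fun v c h' => h.le v c h'.1, fun f hf => ?_, fun hL => ?_, fun he => ?_⟩
    · have hf' := h.keep f hf
      refine ⟨fun v => ⟨hf'.mem v, ?_⟩, hf.proper⟩
      rintro ⟨rfl, h2⟩
      exact hf.proper a v hab ((hc.2 _ (hf'.mem a)).trans h2.symm)
    · have e := h.idle hL
      subst e
      funext v c'
      have := hL a b c hab hc.1 hc.2
      simp only [remove, eq_iff_iff, and_iff_left_iff_imp]
      rintro h1 ⟨rfl, rfl⟩
      exact this h1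
    · have e : L' = L := by
        funext v c'
        refine propext ⟨h.le v c', fun h1 => ?_⟩
        rw [← he] at h1
        exact h1.1
      rintro u v c' (hd | ⟨rfl, rfl, rfl⟩) huv hu
      · exact h.stable e u v c' hd huv hu
      · intro h1
        rw [← he] at h1
        exact h1.2 ⟨rfl, rfl⟩
  · refine ⟨h.le, h.keep, h.idle, fun he => ?_⟩
    rintro u v c' (hd | ⟨rfl, rfl, rfl⟩) huv hu
    · exact h.stable he u v c' hd huv hu
    · subst he
      exact absurd ⟨huv, hu⟩ hs

/-- `L'` is stable and arises from `L` by unit propagation. -/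
structure Propagated (G : SimpleGraph V) (L L' : V → Fin 3 → Prop) : Prop where
  le : ∀ v c, L' v c → L v c
  keep : ∀ f, ListColoring G L f → ListColoring G L' f
  closed : Closed G L'

/-- Transfer of colorings to lists of size at most two after a successful propagation. -/
theorem exists_listColoring_of_closed {f : V → Fin 3} (hf : ListColoring G L f)
    (h2 : ∀ v, ∃ c, ¬ L v c) (hle : ∀ v c, L' v c → L v c) (hc : Closed G L')
    (hne : ∀ v, ∃ c, L' v c) : ∃ g, ListColoring G L' g := by
  classical
  choose h hh using hne
  -- Use the only color where `L'` has one, and `f v` elsewhere: two colors in `L' v` are all of `L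
  -- v`, hence include `f v`. Closedness prevents conflicts at vertices with a single color.
  refine ⟨fun v => if ∀ c, L' v c → c = h v then h v else f v, fun v => ?_, fun u v uv => ?_⟩
  · by_cases hv : ∀ c, L' v c → c = h v
    · simpa only [if_pos hv] using hh v
    · simp only [if_neg hv]
      push Not at hv
      obtain ⟨c, hc1, hc2⟩ := hv
      obtain ⟨d, hd⟩ := h2 v
      have e1 : d ≠ c := fun e => hd (e ▸ hle v c hc1)
      have e2 : d ≠ h v := fun e => hd (e ▸ hle v _ (hh v))
      have e3 : d ≠ f v := fun e => hd (e ▸ hf.mem v)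
      have : f v = c ∨ f v = h v := by
        generalize f v = a at *
        generalize h v = b at *
        clear * - e1 e2 e3 hc2
        revert a b c d
        decide
      rcases this with e | e
      · rwa [e]
      · rw [e]
        exact hh v
  · have mem : ∀ v, (¬ ∀ c, L' v c → c = h v) → L' v (f v) := by
      intro v hv
      push Not at hv
      obtain ⟨c, hc1, hc2⟩ := hv
      obtain ⟨d, hd⟩ := h2 v
      have e1 : d ≠ c := fun e => hd (e ▸ hle v c hc1)
      have e2 : d ≠ h v := fun e => hd (e ▸ hle v _ (hh v))
      have e3 : d ≠ f v := fun e => hd (e ▸ hf.mem v)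
      have : f v = c ∨ f v = h v := by
        generalize f v = a at *
        generalize h v = b at *
        clear * - e1 e2 e3 hc2
        revert a b c d
        decide
      rcases this with e | e
      · rwa [e]
      · rw [e]
        exact hh v
    by_cases hu : ∀ c, L' u c → c = h u <;> by_cases hv : ∀ c, L' v c → c = h v
    · simp only [if_pos hu, if_pos hv]
      exact fun e => hc u v _ uv (hh u) hu (e ▸ hh v)
    · simp only [if_pos hu, if_neg hv]
      exact fun e => hc u v _ uv (hh u) hu (e ▸ mem v hv)
    · simp only [if_neg hu, if_pos hv]
      exact fun e => hc v u _ uv.symm (hh v) hv (e ▸ mem u hu)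
    · simp only [if_neg hu, if_neg hv]
      exact hf.proper u v uv

end Pure

/-! ### Reading the memory -/

section Memory

variable {n : ℕ} {G : SimpleGraph (Fin n)} {s : Store}

/-- The memory still contains the input. -/
structure Base (G : SimpleGraph (Fin n)) (s : Store) : Prop where
  size : s.reg 0 = n
  adj : s.arr 0 = (input G).arr 0

theorem Base.setReg (h : Base G s) {x w : ℕ} (hx : x ≠ 0) : Base G (s.setReg x w) :=
  ⟨by simp [hx.symm, h.size], h.adj⟩

theorem Base.sem (h : Base G s) {p : Cmd} (h1 : 0 ∉ p.writes) (h2 : 0 ∉ p.stores) :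
    Base G (p.sem s) :=
  ⟨by rw [Cmd.reg_sem h1, h.size], by rw [Cmd.arr_sem h2, h.adj]⟩

/-- Loops count downwards, so `Inv k` describes the memory once the indices `k, …, n - 1` are done.
-/
theorem sem_loop {i : ℕ} {p : Cmd} (Inv : ℕ → Store → Prop) (s : Store) (hn : s.reg 0 = n)
    (h0 : Inv n (s.setReg i n))
    (hstep : ∀ (k : Fin n) s, Inv (k + 1) s → Inv k (p.sem (s.setReg i k))) :
    Inv 0 ((Cmd.loop i p).sem s) := by
  have : ∀ k ≤ n, ∀ s, Inv k s → Inv 0 (iter p.sem i k s) := by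
    intro k
    induction k with
    | zero => exact fun _ s h => h
    | succ k ih => exact fun hk s h => ih (by omega) _ (hstep ⟨k, hk⟩ s h)
  simp only [Cmd.sem, hn]
  exact this n le_rfl _ h0

namespace Exp

/-- Test of adjacency. -/
def adj (x y : ℕ) : Exp := arr 0 (add (mul (reg x) (reg 0)) (reg y))

/-- Negation. -/
def not (e : Exp) : Exp := sub (lit 1) e

theorem eval_adj (h : Base G s) {x y : ℕ} {a b : Fin n} (hx : s.reg x = a) (hy : s.reg y = b) :
    (adj x y).eval s ≠ 0 ↔ G.Adj a b := by
  simp only [adj, eval, h.size, h.adj, hx, hy, input]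
  split_ifs with hc
  · simp only [ne_eq, one_ne_zero, not_false_eq_true, true_iff]
    obtain ⟨-, i, j, hij, e⟩ := hc
    -- Division by `n` recovers row and column, so distinct pairs use distinct cells.
    have hdiv : ∀ i j : Fin n, ((i : ℕ) * n + j) / n = i ∧ ((i : ℕ) * n + j) % n = j := by
      intro i j
      have hpos : 0 < n := i.pos
      constructor
      · rw [mul_comm, Nat.mul_add_div hpos, Nat.div_eq_of_lt j.2, add_zero]
      · rw [mul_comm, Nat.mul_add_mod, Nat.mod_eq_of_lt j.2]
    have e1 : a = i := Fin.ext (by rw [← (hdiv a b).1, e, (hdiv i j).1])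
    have e2 : b = j := Fin.ext (by rw [← (hdiv a b).2, e, (hdiv i j).2])
    rwa [e1, e2]
  · simp only [ne_eq, not_true_eq_false, false_iff]
    exact fun h => hc ⟨rfl, a, b, h, rfl⟩

theorem eval_not (e : Exp) : e.not.eval s ≠ 0 ↔ ¬ e.eval s ≠ 0 := by
  simp only [not, eval]
  omega

theorem eval_mul (e f : Exp) : (mul e f).eval s ≠ 0 ↔ e.eval s ≠ 0 ∧ f.eval s ≠ 0 := by
  simp only [eval, ne_eq, mul_eq_zero, not_or]

theorem eval_add (e f : Exp) : (add e f).eval s ≠ 0 ↔ e.eval s ≠ 0 ∨ f.eval s ≠ 0 := by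
  simp only [eval, ne_eq, Nat.add_eq_zero_iff]
  tauto

end Exp

/-- The lists in the arrays `a`, `a + 1`, `a + 2`. -/
def lists (n a : ℕ) (s : Store) : Fin n → Fin 3 → Prop := fun v c => s.arr (a + c) v ≠ 0

@[simp] theorem lists_setReg (a : ℕ) (s : Store) (x w : ℕ) :
    lists n a (s.setReg x w) = lists n a s := rfl

/-- The list of the vertex in register `x` is `{c}`. -/
def Exp.forced (x : ℕ) (c : Fin 3) : Exp :=
  .mul (.arr (2 + c) (.reg x))
    (.mul (.not (.arr (2 + (c + 1 : Fin 3)) (.reg x))) (.not (.arr (2 + (c + 2 : Fin 3)) (.reg x))))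

theorem Exp.eval_forced {x : ℕ} {u : Fin n} (hx : s.reg x = u) (c : Fin 3) :
    (Exp.forced x c).eval s ≠ 0 ↔ Forced (lists n 2 s) u c := by
  rw [Exp.forced, eval_mul, eval_mul, eval_not, eval_not]
  simp only [eval, hx, Forced, lists]
  have : ∀ c' : Fin 3, c' = c ∨ c' = c + 1 ∨ c' = c + 2 := by
    clear * -
    revert c
    decide
  have h1 : c + 1 ≠ c := by clear * -; revert c; decide
  have h2 : c + 2 ≠ c := by clear * -; revert c; decide
  constructor
  · rintro ⟨h, h3, h4⟩
    refine ⟨h, fun c' hc' => ?_⟩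
    rcases this c' with e | e | e
    · exact e
    · exact absurd (e ▸ hc') h3
    · exact absurd (e ▸ hc') h4
  · rintro ⟨h, h3⟩
    exact ⟨h, fun h4 => h1 (h3 _ h4), fun h4 => h2 (h3 _ h4)⟩

end Memory

/-! ### Programs for unit propagation and for lists of two colors -/

namespace Cmd

open Exp (adj)

variable {n : ℕ} {G : SimpleGraph (Fin n)} {s : Store}

/-- Remove the color `c` from the list of the vertex in the register `x`. -/
def erase (x : ℕ) (c : Fin 3) : Cmd := .store (2 + c) (.reg x) (.lit 0)

theorem lists_erase {x : ℕ} {v : Fin n} (hx : s.reg x = v) (c : Fin 3) :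
    lists n 2 ((erase x c).sem s) = remove (lists n 2 s) v c := by
  funext w c'
  simp only [lists, erase, sem, Store.arr_setArr, Exp.eval, hx, remove, Nat.add_left_cancel_iff,
    Fin.val_inj, and_comm (a := w = v)]
  split_ifs with h <;> simp [h]

/-- Examine one triple. -/
def unit (u v : ℕ) (c : Fin 3) : Cmd := .ite (.mul (adj u v) (.forced u c)) (erase v c) .skip

open Classical in
theorem lists_unit (h : Base G s) {u v : ℕ} {a b : Fin n} (hu : s.reg u = a) (hv : s.reg v = b)
    (c : Fin 3) : lists n 2 ((unit u v c).sem s) =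
      if G.Adj a b ∧ Forced (lists n 2 s) a c then remove (lists n 2 s) b c else lists n 2 s := by
  have e : (Exp.mul (adj u v) (.forced u c)).eval s ≠ 0 ↔ G.Adj a b ∧ Forced (lists n 2 s) a c := by
    rw [Exp.eval_mul, Exp.eval_adj h hu hv, Exp.eval_forced hu]
  simp only [unit, sem, e]
  split_ifs with hc
  · exact lists_erase hv c
  · rfl

/-- One pass of unit propagation. -/
def round : Cmd := .loop 20 (.loop 21 (.seq (unit 20 21 0) (.seq (unit 20 21 1) (unit 20 21 2))))

theorem writes_round : round.writes = [20, 21] := rfl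
theorem stores_round : round.stores = [2, 3, 4] := rfl

/-- The invariants record the triples examined so far: all rows after `k`, and in row `k` the
columns from `j` on. -/
theorem pass_round (h : Base G s) :
    Pass G (lists n 2 s) (lists n 2 (round.sem s)) fun _ _ _ => True := by
  set L := lists n 2 s with hL
  refine (sem_loop (fun k s' => Base G s' ∧
    Pass G L (lists n 2 s') fun u _ _ => k ≤ u) s h.size ⟨h.setReg (by simp), ?_⟩ ?_).2.mono
    fun _ _ _ _ => Nat.zero_le _
  · exact (Pass.refl G L).mono fun u _ _ hu => absurd u.2 hu.not_gt
  rintro k s1 ⟨h1, p1⟩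
  have hh := sem_loop (i := 21) (p := .seq (unit 20 21 0) (.seq (unit 20 21 1) (unit 20 21 2)))
    (fun j s' => Base G s' ∧ s'.reg 20 = k ∧
      Pass G L (lists n 2 s') fun u v _ => k + 1 ≤ (u : ℕ) ∨ (u = k ∧ j ≤ (v : ℕ))) (s1.setReg 20 k)
    (h1.setReg (by simp)).size ?_ ?_
  · refine ⟨hh.1, hh.2.2.mono fun u v _ hu => ?_⟩
    rcases (show (k : ℕ) ≤ u from hu).eq_or_lt with h' | h'
    · exact Or.inr ⟨Fin.ext h'.symm, Nat.zero_le _⟩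
    · exact Or.inl h'
  · refine ⟨(h1.setReg (by simp)).setReg (by simp), by simp, p1.mono ?_⟩
    rintro u v _ (hu | ⟨_, hv⟩)
    · exact hu
    · exact absurd v.2 hv.not_gt
  · rintro j s2 ⟨h2, r2, p2⟩
    generalize ht0 : s2.setReg 21 j = t0
    have b0 : Base G t0 := ht0 ▸ h2.setReg (by simp)
    have fr : ∀ (c : Fin 3) t, Base G t → t.reg 20 = k → t.reg 21 = j →
        Base G ((unit 20 21 c).sem t) ∧ ((unit 20 21 c).sem t).reg 20 = k ∧
          ((unit 20 21 c).sem t).reg 21 = j := fun c t hb h20 h21 =>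
      ⟨hb.sem (by simp [unit, writes, erase]) (by simp [unit, stores, erase]; omega),
        by rw [reg_sem (by simp [unit, writes, erase]), h20],
        by rw [reg_sem (by simp [unit, writes, erase]), h21]⟩
    have r0 : t0.reg 20 = k := by simp [← ht0, r2]
    have r0' : t0.reg 21 = j := by simp [← ht0]
    obtain ⟨b1, r1, r1'⟩ := fr 0 t0 b0 r0 r0'
    obtain ⟨b2, r2, r2'⟩ := fr 1 _ b1 r1 r1'
    obtain ⟨b3, r3, r3'⟩ := fr 2 _ b2 r2 r2'
    simp only [sem]
    refine ⟨b3, r3, ?_⟩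
    rw [← lists_setReg 2 s2 21 j, ht0] at p2
    have q1 := p2.step k j 0
    rw [← lists_unit b0 r0 r0'] at q1
    have q2 := q1.step k j 1
    rw [← lists_unit b1 r1 r1'] at q2
    have q3 := q2.step k j 2
    rw [← lists_unit b2 r2 r2'] at q3
    refine q3.mono fun u v c hu => ?_
    rcases hu with hu | ⟨hu, hv⟩
    · exact Or.inl (Or.inl (Or.inl (Or.inl hu)))
    rcases hv.eq_or_lt with hv | hv
    · have hv : v = j := Fin.ext hv.symm
      match c with
      | 0 => exact Or.inl (Or.inl (Or.inr ⟨hu, hv, rfl⟩))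
      | 1 => exact Or.inl (Or.inr ⟨hu, hv, rfl⟩)
      | 2 => exact Or.inr ⟨hu, hv, rfl⟩
    · exact Or.inl (Or.inl (Or.inl (Or.inr ⟨hu, hv⟩)))

/-- The number of entries of the lists. -/
noncomputable def listSize (L : Fin n → Fin 3 → Prop) : ℕ := Set.ncard {p : Fin n × Fin 3 | L p.1 p.2}

/-- `L'` arises from `L` by at least `m` passes of unit propagation. -/
structure Passes (G : SimpleGraph (Fin n)) (L L' : Fin n → Fin 3 → Prop) (m : ℕ) : Prop where
  le : ∀ v c, L' v c → L v c
  keep : ∀ f, ListColoring G L f → ListColoring G L' f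
  progress : Closed G L' ∨ listSize L' + m ≤ 3 * n

theorem Passes.refl (G : SimpleGraph (Fin n)) (L : Fin n → Fin 3 → Prop) : Passes G L L 0 := by
  refine ⟨fun _ _ h => h, fun _ h => h, Or.inr ?_⟩
  refine (Set.ncard_le_card _).trans ?_
  simp [mul_comm]

/-- A pass that changes nothing certifies closedness; any other pass removes at least one entry. -/
theorem Passes.next {L L' L'' : Fin n → Fin 3 → Prop} {m : ℕ} (h : Passes G L L' m)
    (h' : Pass G L' L'' fun _ _ _ => True) : Passes G L L'' (m + 1) := by
  refine ⟨fun v c hc => h.le v c (h'.le v c hc), fun f hf => h'.keep f (h.keep f hf), ?_⟩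
  by_cases e : L'' = L'
  · subst e
    exact Or.inl fun u v c huv h1 h2 => h'.stable rfl u v c trivial huv ⟨h1, h2⟩
  · rcases h.progress with hc | hc
    · exact absurd (h'.idle hc) e
    · right
      have : listSize L'' < listSize L' := by
        refine Set.ncard_lt_ncard ⟨fun p hp => h'.le _ _ hp, fun hs => e ?_⟩ (Set.toFinite _)
        funext v c
        exact propext ⟨h'.le v c, fun hv => hs (a := (v, c)) hv⟩
      omega

/-- There are at most `3 * n` entries. If closedness has not been reached earlier, all lists are
empty after `3 * n` passes, and empty lists are closed vacuously. -/
theorem Passes.propagated {L L' : Fin n → Fin 3 → Prop} (h : Passes G L L' (3 * n)) :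
    Propagated G L L' := by
  refine ⟨h.le, h.keep, h.progress.elim id fun hs u v c _ hu => ?_⟩
  have h0 : listSize L' = 0 := by omega
  rw [listSize, Set.ncard_eq_zero] at h0
  exact absurd (show (u, c) ∈ {p : Fin n × Fin 3 | L' p.1 p.2} from hu) (h0 ▸ Set.notMem_empty _)

/-- Unit propagation. -/
def propagate : Cmd := .loop 22 (.seq round (.seq round round))

theorem writes_propagate : propagate.writes = [22, 20, 21, 20, 21, 20, 21] := rfl
theorem stores_propagate : propagate.stores = [2, 3, 4, 2, 3, 4, 2, 3, 4] := rfl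

theorem propagated_propagate (h : Base G s) :
    Propagated G (lists n 2 s) (lists n 2 (propagate.sem s)) := by
  set L := lists n 2 s with hL
  have hh := sem_loop (i := 22) (p := .seq round (.seq round round))
    (fun k s' => Base G s' ∧ k ≤ n ∧ Passes G L (lists n 2 s') (3 * (n - k))) s h.size
    ⟨h.setReg (by simp), le_rfl, by simpa using Passes.refl G L⟩ ?_
  · exact hh.2.2.propagated
  · rintro k s1 ⟨h1, hk, p1⟩
    rw [← lists_setReg 2 s1 22 k] at p1
    have b1 : Base G (s1.setReg 22 k) := h1.setReg (by simp)
    generalize s1.setReg 22 k = t at p1 b1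
    have fr : ∀ t, Base G t → Base G (round.sem t) := fun t ht =>
      ht.sem (by simp [writes_round]) (by simp [stores_round])
    -- Three passes in each of the `n` iterations add up to `3 * n`.
    have q := ((p1.next (pass_round b1)).next (pass_round (fr _ b1))).next
      (pass_round (fr _ (fr _ b1)))
    rw [show 3 * (n - (k + 1)) + 1 + 1 + 1 = 3 * (n - k) by omega] at q
    exact ⟨fr _ (fr _ (fr _ b1)), by omega, q⟩

/-- Set register `27` to `1` if all lists are non-empty, and to `0` otherwise. -/
def nonempty : Cmd :=
  .seq (.assign 27 (.lit 1)) (.loop 21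
    (.ite (.add (.arr 2 (.reg 21)) (.add (.arr 3 (.reg 21)) (.arr 4 (.reg 21)))) .skip
      (.assign 27 (.lit 0))))

theorem writes_nonempty : nonempty.writes = [27, 21, 27] := rfl
theorem stores_nonempty : nonempty.stores = [] := rfl

theorem exists_fin_three {p : Fin 3 → Prop} : (∃ c, p c) ↔ p 0 ∨ p 1 ∨ p 2 := by
  simp [Fin.exists_fin_succ]

theorem reg_nonempty (h : Base G s) :
    (nonempty.sem s).reg 27 ≠ 0 ↔ ∀ v, ∃ c, lists n 2 s v c := by
  have hh := sem_loop (n := n) (i := 21) (p := .ite (.add (.arr 2 (.reg 21))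
    (.add (.arr 3 (.reg 21)) (.arr 4 (.reg 21)))) .skip (.assign 27 (.lit 0)))
    (fun k s' => s'.arr = s.arr ∧
      (s'.reg 27 ≠ 0 ↔ ∀ v : Fin n, k ≤ (v : ℕ) → ∃ c, lists n 2 s v c))
    (s.setReg 27 1) (by simp [h.size]) ?_ ?_
  · simp only [Nat.zero_le, true_imp_iff] at hh
    exact hh.2
  · refine ⟨rfl, ?_⟩
    simp only [Store.reg_setReg]
    simp
  · rintro k s1 ⟨a1, r1⟩
    have e : (∀ v : Fin n, (k : ℕ) ≤ v → ∃ c, lists n 2 s v c) ↔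
        (∃ c, lists n 2 s k c) ∧ ∀ v : Fin n, (k : ℕ) + 1 ≤ v → ∃ c, lists n 2 s v c := by
      constructor
      · exact fun H => ⟨H k le_rfl, fun v hv => H v (by omega)⟩
      · rintro ⟨h1, h2⟩ v hv
        rcases hv.eq_or_lt with hv | hv
        · exact Fin.ext hv ▸ h1
        · exact h2 v hv
    rw [e, ← r1, exists_fin_three]
    have ev : (Exp.add (.arr 2 (.reg 21)) (.add (.arr 3 (.reg 21)) (.arr 4 (.reg 21)))).eval
        (s1.setReg 21 k) ≠ 0 ↔ lists n 2 s k 0 ∨ lists n 2 s k 1 ∨ lists n 2 s k 2 := by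
      rw [Exp.eval_add, Exp.eval_add]
      simp [Exp.eval, lists, a1]
    simp only [sem, ev]
    split_ifs with hc
    · exact ⟨a1, by simp only [Store.reg_setReg]; tauto⟩
    · exact ⟨a1, by simp only [Store.reg_setReg, Exp.eval]; tauto⟩

/-- Copy the lists from the arrays `a`, `a + 1`, `a + 2` to `b`, `b + 1`, `b + 2`. -/
def copy (a b : ℕ) : Cmd :=
  .loop 21 (.seq (.store b (.reg 21) (.arr a (.reg 21)))
    (.seq (.store (b + 1) (.reg 21) (.arr (a + 1) (.reg 21)))
      (.store (b + 2) (.reg 21) (.arr (a + 2) (.reg 21)))))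

theorem writes_copy (a b : ℕ) : (copy a b).writes = [21] := rfl
theorem stores_copy (a b : ℕ) : (copy a b).stores = [b, b + 1, b + 2] := rfl

theorem lists_copy (h : Base G s) {a b : ℕ} (hab : a + 2 < b ∨ b + 2 < a) :
    lists n b ((copy a b).sem s) = lists n a s := by
  have hh := sem_loop (n := n) (i := 21) (p := .seq (.store b (.reg 21) (.arr a (.reg 21)))
    (.seq (.store (b + 1) (.reg 21) (.arr (a + 1) (.reg 21)))
      (.store (b + 2) (.reg 21) (.arr (a + 2) (.reg 21)))))
    (fun k s' => lists n a s' = lists n a s ∧ ∀ v : Fin n, k ≤ (v : ℕ) → ∀ c,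
      lists n b s' v c ↔ lists n a s v c) s h.size ⟨rfl, fun v hv => absurd v.2 (not_lt.2 hv)⟩ ?_
  · funext v c
    exact propext (hh.2 v (Nat.zero_le _) c)
  · rintro k s1 ⟨h1, h2⟩
    have ne : ∀ i j : ℕ, i ≤ 2 → j ≤ 2 → a + i ≠ b + j := fun i j _ _ => by omega
    refine ⟨?_, fun v hv c => ?_⟩
    · rw [← h1]
      funext v c
      have hc : (c : ℕ) ≤ 2 := by omega
      have n0 := ne c 0 hc (by simp)
      have n1 := ne c 1 hc (by simp)
      have n2 := ne c 2 hc (by simp)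
      simp only [add_zero] at n0
      simp [lists, sem, Exp.eval, n0, n1, n2]
    · have m1 := ne 1 0 (by simp) (by simp)
      have m2 := ne 2 0 (by simp) (by simp)
      have m3 := ne 2 1 (by simp) (by simp)
      simp only [add_zero] at m1 m2
      rcases hv.eq_or_lt with hv | hv
      · obtain rfl := Fin.ext hv
        rw [← h1]
        fin_cases c <;> simp [lists, sem, Exp.eval, m1, m2, m3]
      · rw [← h2 v hv c]
        have : (v : ℕ) ≠ k := by omega
        simp [lists, sem, Exp.eval, this]

/-- Set the list of the vertex in register `x` to `{c}`. -/
def setList (x : ℕ) (c : Fin 3) : Cmd :=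
  .seq (.store 2 (.reg x) (.lit 0)) (.seq (.store 3 (.reg x) (.lit 0))
    (.seq (.store 4 (.reg x) (.lit 0)) (.store (2 + c) (.reg x) (.lit 1))))

theorem writes_setList (x : ℕ) (c : Fin 3) : (setList x c).writes = [] := rfl
theorem stores_setList (x : ℕ) (c : Fin 3) : (setList x c).stores = [2, 3, 4, 2 + (c : ℕ)] := rfl

theorem lists_setList {x : ℕ} {v : Fin n} (hx : s.reg x = v) (c : Fin 3) :
    lists n 2 ((setList x c).sem s) = setTo (lists n 2 s) v c := by
  funext w c'
  by_cases hw : w = v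
  · subst hw
    fin_cases c <;> fin_cases c' <;> simp [lists, setList, sem, Exp.eval, setTo, hx]
  · have : (w : ℕ) ≠ v := fun h => hw (Fin.ext h)
    simp [lists, setList, sem, Exp.eval, setTo, hx, hw, this]

theorem lists_sem {a : ℕ} {p : Cmd} (h0 : a ∉ p.stores) (h1 : a + 1 ∉ p.stores)
    (h2 : a + 2 ∉ p.stores) : lists n a (p.sem s) = lists n a s := by
  funext v c
  match c with
  | 0 => simpa [lists] using congrArg (fun g => ¬ g (v : ℕ) = 0) (arr_sem h0 s)
  | 1 => simpa [lists] using congrArg (fun g => ¬ g (v : ℕ) = 0) (arr_sem h1 s)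
  | 2 => simpa [lists] using congrArg (fun g => ¬ g (v : ℕ) = 0) (arr_sem h2 s)

/-- Try to give the color `c` to the vertex in register `28`, and remove it from its list if unit
propagation shows that this is not possible. -/
def attempt (c : Fin 3) : Cmd :=
  .ite (.arr (2 + c) (.reg 28))
    (.seq (copy 2 5) (.seq (setList 28 c) (.seq propagate (.seq nonempty
      (.ite (.reg 27) .skip (.seq (copy 5 2) (.seq (erase 28 c) propagate)))))))
    .skip

theorem writes_attempt (c : Fin 3) : (attempt c).writes =
    [21, 22, 20, 21, 20, 21, 20, 21, 27, 21, 27, 21, 22, 20, 21, 20, 21, 20, 21] := rfl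

theorem stores_attempt (c : Fin 3) : (attempt c).stores =
    [5, 6, 7, 2, 3, 4, 2 + (c : ℕ), 2, 3, 4, 2, 3, 4, 2, 3, 4, 2, 3, 4, 2 + (c : ℕ), 2, 3, 4, 2, 3, 4,
      2, 3, 4] := rfl

/-- `L'` refines `L` without losing solvability if the lists have at most two colors. -/
structure Refines (G : SimpleGraph (Fin n)) (L L' : Fin n → Fin 3 → Prop) : Prop where
  le : ∀ v c, L' v c → L v c
  closed : Closed G L'
  keep : (∀ v, ∃ c, ¬ L v c) → (∃ f, ListColoring G L f) → ∃ f, ListColoring G L' f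

theorem Refines.refl {L : Fin n → Fin 3 → Prop} (h : Closed G L) : Refines G L L :=
  ⟨fun _ _ h => h, h, fun _ h => h⟩

theorem Refines.trans {L L' L'' : Fin n → Fin 3 → Prop} (h : Refines G L L') (h' : Refines G L' L'') :
    Refines G L L'' :=
  ⟨fun v c hc => h.le v c (h'.le v c hc), h'.closed, fun h2 hf =>
    h'.keep (fun v => (h2 v).imp fun c hc h1 => hc (h.le v c h1)) (h.keep h2 hf)⟩

/-- If propagation after choosing `c` empties no list, the choice is kept by
`exists_listColoring_of_closed`. Otherwise no list coloring gives `w` the color `c`, and deleting it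
from the saved lists loses nothing. -/
theorem refines_attempt (h : Base G s) {w : Fin n} (hw : s.reg 28 = w) (c : Fin 3)
    (hL : Closed G (lists n 2 s)) : Refines G (lists n 2 s) (lists n 2 ((attempt c).sem s)) ∧
      (¬ lists n 2 ((attempt c).sem s) w c ∨ ∀ c', lists n 2 ((attempt c).sem s) w c' → c' = c) := by
  have ev : (Exp.arr (2 + c) (.reg 28)).eval s ≠ 0 ↔ lists n 2 s w c := by
    simp [Exp.eval, lists, hw]
  rw [attempt]
  generalize hL0 : lists n 2 s = L at hL ev ⊢
  by_cases hc : L w c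
  swap
  · have hs : (Cmd.ite (.arr (2 + c) (.reg 28))
      (.seq (copy 2 5) (.seq (setList 28 c) (.seq propagate (.seq nonempty
        (.ite (.reg 27) .skip (.seq (copy 5 2) (.seq (erase 28 c) propagate)))))))
      .skip).sem s = s := by
      simp only [sem]
      rw [if_neg (by rwa [ev])]
    rw [hs, hL0]
    exact ⟨.refl hL, Or.inl hc⟩
  have b1 : Base G ((copy 2 5).sem s) := h.sem (by simp [writes_copy]) (by simp [stores_copy])
  have r1 : ((copy 2 5).sem s).reg 28 = w := by rw [reg_sem (by simp [writes_copy]), hw]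
  have l1 : lists n 2 ((copy 2 5).sem s) = L := by
    rw [lists_sem (by simp [stores_copy]) (by simp [stores_copy]) (by simp [stores_copy]), hL0]
  have m1 : lists n 5 ((copy 2 5).sem s) = L := by rw [lists_copy h (by simp), hL0]
  rw [sem, if_pos (ev.2 hc)]
  simp only [sem]
  generalize (copy 2 5).sem s = s1 at b1 r1 l1 m1 ⊢
  have nc : ∀ a : ℕ, 5 ≤ a → a ≠ 2 + (c : ℕ) := fun a ha => by omega
  have b2 : Base G ((setList 28 c).sem s1) :=
    b1.sem (by simp [writes_setList]) (by simp [stores_setList]; omega)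
  have r2 : ((setList 28 c).sem s1).reg 28 = w := by rw [reg_sem (by simp [writes_setList]), r1]
  have l2 : lists n 2 ((setList 28 c).sem s1) = setTo L w c := by rw [lists_setList r1, l1]
  have m2 : lists n 5 ((setList 28 c).sem s1) = L := by
    rw [lists_sem (by simp [stores_setList]; omega) (by simp [stores_setList]; omega)
      (by simp [stores_setList]; omega), m1]
  generalize (setList 28 c).sem s1 = s2 at b2 r2 l2 m2 ⊢
  have b3 : Base G (propagate.sem s2) :=
    b2.sem (by simp [writes_propagate]) (by simp [stores_propagate])
  have r3 : (propagate.sem s2).reg 28 = w := by rw [reg_sem (by simp [writes_propagate]), r2]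
  have l3 := propagated_propagate b2
  have m3 : lists n 5 (propagate.sem s2) = L := by
    rw [lists_sem (by simp [stores_propagate]) (by simp [stores_propagate])
      (by simp [stores_propagate]), m2]
  rw [l2] at l3
  generalize propagate.sem s2 = s3 at b3 r3 l3 m3 ⊢
  have b4 : Base G (nonempty.sem s3) := b3.sem (by simp [writes_nonempty]) (by simp [stores_nonempty])
  have r4 : (nonempty.sem s3).reg 28 = w := by rw [reg_sem (by simp [writes_nonempty]), r3]
  have n4 := reg_nonempty b3
  have l4 : lists n 2 (nonempty.sem s3) = lists n 2 s3 :=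
    lists_sem (by simp [stores_nonempty]) (by simp [stores_nonempty]) (by simp [stores_nonempty])
  have m4 : lists n 5 (nonempty.sem s3) = L := by
    rw [lists_sem (by simp [stores_nonempty]) (by simp [stores_nonempty])
      (by simp [stores_nonempty]), m3]
  rw [← l4] at l3 n4
  generalize nonempty.sem s3 = s4 at b4 r4 n4 l3 m4 ⊢
  have le : ∀ v c', setTo L w c v c' → L v c' := by
    rintro v c' (⟨rfl, rfl⟩ | ⟨-, h⟩)
    · exact hc
    · exact h
  by_cases h27 : (Exp.reg 27).eval s4 ≠ 0
  · simp only [if_pos h27]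
    refine ⟨⟨fun v c' hv => le v c' (l3.le v c' hv), l3.closed, ?_⟩, Or.inr fun c' hc' => ?_⟩
    · rintro h2 ⟨f, hf⟩
      exact exists_listColoring_of_closed hf h2 (fun v c' hv => le v c' (l3.le v c' hv)) l3.closed
        (n4.1 h27)
    · rcases l3.le w c' hc' with h | h
      · exact h.2
      · exact absurd rfl h.1
  · simp only [if_neg h27]
    have b5 : Base G ((copy 5 2).sem s4) := b4.sem (by simp [writes_copy]) (by simp [stores_copy])
    have r5 : ((copy 5 2).sem s4).reg 28 = w := by rw [reg_sem (by simp [writes_copy]), r4]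
    have l5 : lists n 2 ((copy 5 2).sem s4) = L := by rw [lists_copy b4 (by simp), m4]
    generalize (copy 5 2).sem s4 = s5 at b5 r5 l5 ⊢
    have b6 : Base G ((erase 28 c).sem s5) :=
      b5.sem (by simp [erase, writes]) (by simp [erase, stores]; omega)
    have l6 : lists n 2 ((erase 28 c).sem s5) = remove L w c := by rw [lists_erase r5, l5]
    have l7 := propagated_propagate b6
    rw [l6] at l7
    refine ⟨⟨fun v c' hv => (l7.le v c' hv).1, l7.closed, ?_⟩, Or.inl fun hh =>
      (l7.le w c hh).2 ⟨rfl, rfl⟩⟩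
    rintro - ⟨f, hf⟩
    refine ⟨f, l7.keep f ⟨fun v => ⟨hf.mem v, ?_⟩, hf.proper⟩⟩
    rintro ⟨rfl, hfc⟩
    -- A list coloring with the tried color would survive propagation and witness that no list is
    -- empty.
    refine (not_imp_not.2 n4.2) h27 fun u => ⟨f u, (l3.keep f ⟨fun u => ?_, hf.proper⟩).mem u⟩
    by_cases hu : u = v
    · exact Or.inl ⟨hu, by rw [hu, hfc]⟩
    · exact Or.inr ⟨hu, hf.mem u⟩

/-- Solve the list coloring problem when unit propagation leaves lists of at most two colors. -/
def solve : Cmd := .seq propagate (.loop 28 (.seq (attempt 0) (.seq (attempt 1) (attempt 2))))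

/-- Closedness and uniqueness hold for arbitrary initial lists; only the preservation of solvability
needs lists of at most two colors after propagation. -/
theorem solve_spec (h : Base G s) :
    Closed G (lists n 2 (solve.sem s)) ∧
    (∀ v c c', lists n 2 (solve.sem s) v c → lists n 2 (solve.sem s) v c' → c = c') ∧
    ∀ f, ListColoring G (lists n 2 s) f →
      (∀ L, Propagated G (lists n 2 s) L → ∀ v, ∃ c, ¬ L v c) →
      ∃ g, ListColoring G (lists n 2 (solve.sem s)) g := by
  have b1 : Base G (propagate.sem s) :=
    h.sem (by simp [writes_propagate]) (by simp [stores_propagate])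
  have l1 := propagated_propagate h
  have hh := sem_loop (i := 28) (p := .seq (attempt 0) (.seq (attempt 1) (attempt 2)))
    (fun k s' => Base G s' ∧ Refines G (lists n 2 (propagate.sem s)) (lists n 2 s') ∧
      ∀ v : Fin n, k ≤ (v : ℕ) → ∀ c c', lists n 2 s' v c → lists n 2 s' v c' → c = c')
    (propagate.sem s) b1.size ⟨b1.setReg (by simp), .refl l1.closed,
      fun v hv => absurd v.2 (not_lt.2 hv)⟩ ?_
  · refine ⟨hh.2.1.closed, fun v => hh.2.2 v (Nat.zero_le _), fun f hf h2 => ?_⟩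
    exact hh.2.1.keep (h2 _ l1) ⟨f, l1.keep f hf⟩
  · rintro k s1 ⟨b, q, u⟩
    rw [← lists_setReg 2 s1 28 k] at q u
    have b0 : Base G (s1.setReg 28 k) := b.setReg (by simp)
    have r0 : (s1.setReg 28 k).reg 28 = k := by simp
    generalize s1.setReg 28 k = t at q u b0 r0
    have fr : ∀ (c : Fin 3) t, Base G t → t.reg 28 = k →
        Base G ((attempt c).sem t) ∧ ((attempt c).sem t).reg 28 = k := fun c t ht hr =>
      ⟨ht.sem (by simp [writes_attempt]) (by simp [stores_attempt]; omega),
        by rw [reg_sem (by simp [writes_attempt]), hr]⟩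
    obtain ⟨q1, e1⟩ := refines_attempt b0 r0 0 q.closed
    obtain ⟨b1, r1⟩ := fr 0 t b0 r0
    obtain ⟨q2, e2⟩ := refines_attempt b1 r1 1 q1.closed
    obtain ⟨b2, r2⟩ := fr 1 _ b1 r1
    obtain ⟨q3, e3⟩ := refines_attempt b2 r2 2 q2.closed
    obtain ⟨b3, r3⟩ := fr 2 _ b2 r2
    simp only [sem]
    generalize (attempt 0).sem t = t1 at *
    generalize (attempt 1).sem t1 = t2 at *
    generalize (attempt 2).sem t2 = t3 at *
    refine ⟨b3, q.trans (q1.trans (q2.trans q3)), fun v hv c c' hc hc' => ?_⟩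
    rcases hv.eq_or_lt with hv | hv
    · obtain rfl := Fin.ext hv
      -- Later lists are smaller, so the verdict of each attempt persists; three verdicts leave at
      -- most one color.
      have one : ∀ d : Fin 3, ¬ lists n 2 t3 k d ∨ ∀ c', lists n 2 t3 k c' → c' = d := fun d =>
        match d with
        | 0 => e1.imp (fun h h' => h (q2.le _ _ (q3.le _ _ h')))
            (fun h c' h' => h c' (q2.le _ _ (q3.le _ _ h')))
        | 1 => e2.imp (fun h h' => h (q3.le _ _ h')) (fun h c' h' => h c' (q3.le _ _ h'))
        | 2 => e3
      exact (((one c).resolve_left fun h => h hc) c' hc').symm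
    · exact u v hv c c' (q1.le _ _ (q2.le _ _ (q3.le _ _ hc))) (q1.le _ _ (q2.le _ _ (q3.le _ _ hc')))

/-! ### Output -/

/-- Register `18` tells whether array `1` contains a 3-coloring. -/
def Sound (G : SimpleGraph (Fin n)) (s : Store) : Prop :=
  s.reg 18 = 0 ∨ (s.reg 18 = 1 ∧ ∃ C : G.Coloring (Fin 3), ∀ v : Fin n, s.arr 1 v = (C v : ℕ) + 1)

/-- Write the coloring. -/
def output : Cmd :=
  .loop 21 (.ite (.arr 2 (.reg 21)) (.store 1 (.reg 21) (.lit 1))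
    (.ite (.arr 3 (.reg 21)) (.store 1 (.reg 21) (.lit 2)) (.store 1 (.reg 21) (.lit 3))))

theorem writes_output : output.writes = [21] := rfl
theorem stores_output : output.stores = [1, 1, 1] := rfl

/-- With at most one color per list the first successful test is decisive. An empty list leads to
the entry `3`, about which nothing is claimed. -/
theorem arr_output (h : Base G s)
    (hu : ∀ v c c', lists n 2 s v c → lists n 2 s v c' → c = c') :
    ∀ v c, lists n 2 s v c → (output.sem s).arr 1 v = (c : ℕ) + 1 := by
  have hh := sem_loop (n := n) (i := 21) (p := .ite (.arr 2 (.reg 21))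
    (.store 1 (.reg 21) (.lit 1))
    (.ite (.arr 3 (.reg 21)) (.store 1 (.reg 21) (.lit 2)) (.store 1 (.reg 21) (.lit 3))))
    (fun k s' => lists n 2 s' = lists n 2 s ∧
      ∀ v : Fin n, k ≤ (v : ℕ) → ∀ c, lists n 2 s v c → s'.arr 1 v = (c : ℕ) + 1) s h.size
    ⟨rfl, fun v hv => absurd v.2 (not_lt.2 hv)⟩ ?_
  · exact fun v => hh.2 v (Nat.zero_le _)
  · rintro k s1 ⟨h1, h2⟩
    refine ⟨?_, fun v hv c hc => ?_⟩
    · rw [lists_sem (by simp [stores]) (by simp [stores]) (by simp [stores])]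
      exact h1
    · have e2 : (Exp.arr 2 (.reg 21)).eval (s1.setReg 21 k) ≠ 0 ↔ lists n 2 s k 0 := by
        rw [← h1]
        simp [Exp.eval, lists]
      have e3 : (Exp.arr 3 (.reg 21)).eval (s1.setReg 21 k) ≠ 0 ↔ lists n 2 s k 1 := by
        rw [← h1]
        simp [Exp.eval, lists]
      simp only [sem]
      rcases hv.eq_or_lt with hv | hv
      · obtain rfl := Fin.ext hv
        split_ifs with g1 g2
        · rw [hu k c 0 hc (e2.1 g1)]
          simp [Exp.eval]
        · rw [hu k c 1 hc (e3.1 g2)]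
          simp [Exp.eval]
        · match c with
          | 0 => exact absurd (e2.2 hc) g1
          | 1 => exact absurd (e3.2 hc) g2
          | 2 => simp [Exp.eval]
      · have hvk : (v : ℕ) ≠ k := by omega
        have := h2 v hv c hc
        split_ifs <;> simpa [Exp.eval, hvk] using this

/-- Accept the lists as a coloring if they are non-empty. -/
def finish : Cmd :=
  .seq nonempty (.ite (.reg 27) (.seq output (.assign 18 (.lit 1))) .skip)

/-- Closed, non-empty lists of one color are a proper coloring, whatever was guessed. If some list
is empty, the earlier result is left untouched. -/
theorem finish_spec (h : Base G s) (hs : Sound G s) (hc : Closed G (lists n 2 s))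
    (hu : ∀ v c c', lists n 2 s v c → lists n 2 s v c' → c = c') :
    Sound G (finish.sem s) ∧ (s.reg 18 ≠ 0 → (finish.sem s).reg 18 ≠ 0) ∧
      ((∃ g, ListColoring G (lists n 2 s) g) → (finish.sem s).reg 18 ≠ 0) := by
  have b1 : Base G (nonempty.sem s) := h.sem (by simp [writes_nonempty]) (by simp [stores_nonempty])
  have l1 : lists n 2 (nonempty.sem s) = lists n 2 s :=
    lists_sem (by simp [stores_nonempty]) (by simp [stores_nonempty]) (by simp [stores_nonempty])
  have r1 : (nonempty.sem s).reg 18 = s.reg 18 := reg_sem (by simp [writes_nonempty]) s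
  have a1 : (nonempty.sem s).arr 1 = s.arr 1 := arr_sem (by simp [stores_nonempty]) s
  have n1 := reg_nonempty h
  simp only [finish, sem]
  by_cases h27 : (Exp.reg 27).eval (nonempty.sem s) ≠ 0
  · rw [if_pos h27]
    have hne := n1.1 h27
    refine ⟨Or.inr ⟨by simp [Exp.eval], ?_⟩, fun _ => by simp [Exp.eval], fun _ => by simp [Exp.eval]⟩
    rw [← l1] at hc hne hu
    have := arr_output b1 hu
    choose C hC using hne
    refine ⟨SimpleGraph.Coloring.mk C fun {u v} uv e => ?_, fun v => this v _ (hC v)⟩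
    exact hc u v (C u) uv (hC u) (fun c' h' => hu u _ _ h' (hC u)) (e ▸ hC v)
  · rw [if_neg h27]
    refine ⟨?_, by simp [r1], fun ⟨g, hg⟩ => absurd (n1.2 fun v => ⟨g v, hg.mem v⟩) h27⟩
    unfold Sound at hs ⊢
    rwa [r1, a1]

/-! ### Precoloring -/

/-- Set register `f` to `1` if `e` holds for some values of the registers `23` and `24`, and to `0`
otherwise. -/
def exists₂ (f : ℕ) (e : Exp) : Cmd :=
  .seq (.assign f (.lit 0)) (.loop 23 (.loop 24 (.ite e (.assign f (.lit 1)) .skip)))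

theorem writes_exists₂ (f : ℕ) (e : Exp) : (exists₂ f e).writes = [f, 23, 24, f] := rfl
theorem stores_exists₂ (f : ℕ) (e : Exp) : (exists₂ f e).stores = [] := rfl

/-- The test may read whatever the loops leave alone, so it is required to be correct in every
memory that agrees with `s` up to the registers `23`, `24` and `f`. -/
theorem reg_exists₂ (h : Base G s) {f : ℕ} {e : Exp} (hf : f ≠ 23 ∧ f ≠ 24 ∧ f ≠ 0)
    {P : Fin n → Fin n → Prop}
    (he : ∀ t : Store, t.arr = s.arr → (∀ x, x ≠ 23 → x ≠ 24 → x ≠ f → t.reg x = s.reg x) →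
      ∀ x y : Fin n, t.reg 23 = x → t.reg 24 = y → (e.eval t ≠ 0 ↔ P x y)) :
    ((exists₂ f e).sem s).reg f ≠ 0 ↔ ∃ x y, P x y := by
  obtain ⟨f1, f2, f3⟩ := hf
  have hh := sem_loop (n := n) (i := 23) (p := .loop 24 (.ite e (.assign f (.lit 1)) .skip))
    (fun k t => t.arr = s.arr ∧ (∀ x, x ≠ 23 → x ≠ 24 → x ≠ f → t.reg x = s.reg x) ∧
      (t.reg f ≠ 0 ↔ ∃ x y : Fin n, k ≤ (x : ℕ) ∧ P x y)) (s.setReg f 0)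
    (by simp [f3.symm, h.size]) ?_ ?_
  · simp only [Nat.zero_le, true_and] at hh
    exact hh.2.2
  · refine ⟨rfl, fun x h1 h2 h3 => by simp [h1, h3], ?_⟩
    simp [f1]
  rintro k t ⟨a1, r1, q1⟩
  have hh := sem_loop (n := n) (i := 24) (p := .ite e (.assign f (.lit 1)) .skip)
    (fun j t => t.arr = s.arr ∧ t.reg 23 = k ∧ (∀ x, x ≠ 23 → x ≠ 24 → x ≠ f → t.reg x = s.reg x) ∧
      (t.reg f ≠ 0 ↔ ∃ x y : Fin n, ((k : ℕ) + 1 ≤ (x : ℕ) ∨ (x = k ∧ j ≤ (y : ℕ))) ∧ P x y))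
    (t.setReg 23 k)
    (by simp [r1 0 (by simp) (by simp) f3.symm, h.size]) ?_ ?_
  · refine ⟨hh.1, hh.2.2.1, hh.2.2.2.trans ?_⟩
    refine exists_congr fun x => exists_congr fun y => and_congr_left fun _ => ?_
    simp only [Nat.zero_le, and_true, Fin.ext_iff]
    omega
  · refine ⟨a1, by simp, fun x h1 h2 h3 => by simp [h1, h2, r1 x h1 h2 h3], ?_⟩
    simp only [Store.reg_setReg, if_neg f1, if_neg f2, q1]
    refine exists_congr fun x => exists_congr fun y => and_congr_left fun _ => ?_
    have := y.2
    omega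
  · rintro j u ⟨a2, k2, r2, q2⟩
    have ev := he (u.setReg 24 j) a2 (fun x h1 h2 h3 => by simp [h2, r2 x h1 h2 h3]) k j
      (by simp [k2]) (by simp)
    have split : (∃ x y : Fin n, ((k : ℕ) + 1 ≤ (x : ℕ) ∨ (x = k ∧ (j : ℕ) ≤ (y : ℕ))) ∧ P x y) ↔
        P k j ∨ ∃ x y : Fin n, ((k : ℕ) + 1 ≤ (x : ℕ) ∨ (x = k ∧ (j : ℕ) + 1 ≤ (y : ℕ))) ∧ P x y := by
      constructor
      · rintro ⟨x, y, hx | ⟨rfl, hy⟩, hP⟩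
        · exact Or.inr ⟨x, y, Or.inl hx, hP⟩
        · rcases hy.eq_or_lt with hy | hy
          · exact Or.inl (Fin.ext hy ▸ hP)
          · exact Or.inr ⟨x, y, Or.inr ⟨rfl, hy⟩, hP⟩
      · rintro (hP | ⟨x, y, hx | ⟨rfl, hy⟩, hP⟩)
        · exact ⟨k, j, Or.inr ⟨rfl, le_rfl⟩, hP⟩
        · exact ⟨x, y, Or.inl hx, hP⟩
        · exact ⟨x, y, Or.inr ⟨rfl, by omega⟩, hP⟩
    rw [split, ← q2]
    simp only [sem]
    split_ifs with hc
    · refine ⟨a2, by simp [k2, f1.symm], fun x h1 h2 h3 => by simp [h2, h3, r2 x h1 h2 h3], ?_⟩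
      simp [Exp.eval, ev.1 hc]
    · refine ⟨a2, by simp [k2], fun x h1 h2 h3 => by simp [h2, r2 x h1 h2 h3], ?_⟩
      simpa [f2] using fun hP => absurd (ev.2 hP) hc

end Cmd

namespace Exp

variable {n : ℕ} {G : SimpleGraph (Fin n)} {s : Store}

/-- Test whether the vertex in register `x` has no neighbour on a path. -/
def far (c0 c2 c3 c4 x : ℕ) : Exp :=
  .mul (.not (adj c0 x)) (.mul (.not (adj c2 x)) (.mul (.not (adj c3 x)) (.not (adj c4 x))))

theorem eval_far (h : Base G s) {c0 c2 c3 c4 x : ℕ} {p0 p2 p3 p4 v : Fin n} (h0 : s.reg c0 = p0)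
    (h2 : s.reg c2 = p2) (h3 : s.reg c3 = p3) (h4 : s.reg c4 = p4) (hx : s.reg x = v) :
    (far c0 c2 c3 c4 x).eval s ≠ 0 ↔ FarFrom G p0 p2 p3 p4 v := by
  rw [far, eval_mul, eval_mul, eval_mul, eval_not, eval_not, eval_not, eval_not, eval_adj h h0 hx,
    eval_adj h h2 hx, eval_adj h h3 hx, eval_adj h h4 hx]
  rfl

/-- Test whether registers `23` and `24` contain the ends of an edge that is seen by the vertex in
register `t`, but not by the vertex in register `u`. -/
def seenEdge (c0 c2 c3 c4 t u : ℕ) : Exp :=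
  .mul (far c0 c2 c3 c4 23) (.mul (far c0 c2 c3 c4 24) (.mul (adj 23 24)
    (.mul (.add (adj t 23) (adj t 24)) (.not (.add (adj u 23) (adj u 24))))))

theorem eval_seenEdge (h : Base G s) {c0 c2 c3 c4 t u : ℕ} {p0 p2 p3 p4 v w x y : Fin n}
    (h0 : s.reg c0 = p0) (h2 : s.reg c2 = p2) (h3 : s.reg c3 = p3) (h4 : s.reg c4 = p4)
    (ht : s.reg t = v) (hu : s.reg u = w) (hx : s.reg 23 = x) (hy : s.reg 24 = y) :
    (seenEdge c0 c2 c3 c4 t u).eval s ≠ 0 ↔ FarFrom G p0 p2 p3 p4 x ∧ FarFrom G p0 p2 p3 p4 y ∧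
      G.Adj x y ∧ Sees G v x y ∧ ¬ Sees G w x y := by
  rw [seenEdge, eval_mul, eval_mul, eval_mul, eval_mul, eval_not, eval_add, eval_add,
    eval_far h h0 h2 h3 h4 hx, eval_far h h0 h2 h3 h4 hy, eval_adj h hx hy, eval_adj h ht hx,
    eval_adj h ht hy, eval_adj h hu hx, eval_adj h hu hy]
  rfl

end Exp

/-! ### Programs for the guesses, and a single branch -/

namespace Cmd

open Exp (adj)

variable {n : ℕ} {G : SimpleGraph (Fin n)} {s : Store}

/-- Set register `25` to a non-zero value if the vertex in register `21` comes before the vertex in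
register `σ`, and to `0` otherwise. -/
def before (c0 c2 c3 c4 σ : ℕ) : Cmd :=
  .seq (exists₂ 25 (.seenEdge c0 c2 c3 c4 21 σ)) (.seq (exists₂ 26 (.seenEdge c0 c2 c3 c4 σ 21))
    (.ite (.mul (.not (.reg 26)) (.sub (.reg σ) (.reg 21))) (.assign 25 (.lit 1)) .skip))

theorem writes_before (c0 c2 c3 c4 σ : ℕ) :
    (before c0 c2 c3 c4 σ).writes = [25, 23, 24, 25, 26, 23, 24, 26, 25] := rfl
theorem stores_before (c0 c2 c3 c4 σ : ℕ) : (before c0 c2 c3 c4 σ).stores = [] := rfl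

/-- Registers `25` and `26` tell whether `v` or `w`, respectively, sees an edge that the other
misses. The truncated difference is non-zero exactly when `v < w`, which breaks ties. -/
theorem reg_before (h : Base G s) {c0 c2 c3 c4 σ : ℕ} {p0 p2 p3 p4 v w : Fin n}
    (hr : c0 < 20 ∧ c2 < 20 ∧ c3 < 20 ∧ c4 < 20 ∧ σ < 20)
    (h0 : s.reg c0 = p0) (h2 : s.reg c2 = p2) (h3 : s.reg c3 = p3) (h4 : s.reg c4 = p4)
    (hv : s.reg 21 = v) (hw : s.reg σ = w) :
    ((before c0 c2 c3 c4 σ).sem s).reg 25 ≠ 0 ↔ Before G (FarFrom G p0 p2 p3 p4) v w := by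
  obtain ⟨l0, l2, l3, l4, lσ⟩ := hr
  have e1 := reg_exists₂ (n := n) (f := 25) (e := .seenEdge c0 c2 c3 c4 21 σ) h (by simp)
    (P := fun x y => FarFrom G p0 p2 p3 p4 x ∧ FarFrom G p0 p2 p3 p4 y ∧
      G.Adj x y ∧ Sees G v x y ∧ ¬ Sees G w x y) (fun t ha hr x y hx hy => by
      refine Exp.eval_seenEdge ⟨?_, ?_⟩ ?_ ?_ ?_ ?_ ?_ ?_ hx hy
      · rw [hr 0 (by simp) (by simp) (by simp), h.size]
      · rw [ha, h.adj]
      all_goals rw [hr _ (by omega) (by omega) (by omega)]; assumption)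
  have r1 : ∀ x, x < 20 ∨ x = 21 →
      ((exists₂ 25 (.seenEdge c0 c2 c3 c4 21 σ)).sem s).reg x = s.reg x := fun x hx =>
    reg_sem (by simp only [writes_exists₂, List.mem_cons, List.not_mem_nil, or_false]; omega) s
  have b1 : Base G ((exists₂ 25 (.seenEdge c0 c2 c3 c4 21 σ)).sem s) :=
    h.sem (by simp [writes_exists₂]) (by simp [stores_exists₂])
  rw [before, sem, sem]
  generalize (exists₂ 25 (.seenEdge c0 c2 c3 c4 21 σ)).sem s = s1 at e1 r1 b1 ⊢
  have e2 := reg_exists₂ (n := n) (f := 26) (e := .seenEdge c0 c2 c3 c4 σ 21) b1 (by simp)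
    (P := fun x y => FarFrom G p0 p2 p3 p4 x ∧ FarFrom G p0 p2 p3 p4 y ∧
      G.Adj x y ∧ Sees G w x y ∧ ¬ Sees G v x y) (fun t ha hr x y hx hy => by
      refine Exp.eval_seenEdge ⟨?_, ?_⟩ ?_ ?_ ?_ ?_ ?_ ?_ hx hy
      · rw [hr 0 (by simp) (by simp) (by simp), b1.size]
      · rw [ha, b1.adj]
      all_goals rw [hr _ (by omega) (by omega) (by omega), r1 _ (by omega)]; assumption)
  have r2 : ∀ x, x < 20 ∨ x = 21 ∨ x = 25 →
      ((exists₂ 26 (.seenEdge c0 c2 c3 c4 σ 21)).sem s1).reg x = s1.reg x := fun x hx =>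
    reg_sem (by simp only [writes_exists₂, List.mem_cons, List.not_mem_nil, or_false]; omega) s1
  generalize (exists₂ 26 (.seenEdge c0 c2 c3 c4 σ 21)).sem s1 = s2 at e2 r2 ⊢
  have ev : (Exp.mul (.not (.reg 26)) (.sub (.reg σ) (.reg 21))).eval s2 ≠ 0 ↔
      (¬ s2.reg 26 ≠ 0) ∧ v < w := by
    rw [Exp.eval_mul, Exp.eval_not]
    simp only [Exp.eval]
    rw [r2 σ (by omega), r1 σ (by omega), r2 21 (by omega), r1 21 (by omega), hv, hw, Fin.lt_def]
    refine and_congr_right fun _ => ?_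
    omega
  unfold Before
  rw [← e1, ← e2, ← r2 25 (by omega)]
  simp only [sem, ev]
  split_ifs with hc
  · simp only [Store.reg_setReg, if_true, Exp.eval]
    tauto
  · tauto

/-- Precolor the common neighbours of `c0` and `c2` that come before the vertex in register `σ` with
`d`, and this vertex with `e`. -/
def mark (c0 c2 c3 c4 σ : ℕ) (d e : Fin 3) : Cmd :=
  .seq (.loop 21 (.ite (.mul (adj c0 21) (adj c2 21))
    (.seq (before c0 c2 c3 c4 σ) (.ite (.reg 25) (setList 21 d) .skip)) .skip)) (setList σ e)

theorem writes_mark (c0 c2 c3 c4 σ : ℕ) (d e : Fin 3) : (mark c0 c2 c3 c4 σ d e).writes =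
    [21, 25, 23, 24, 25, 26, 23, 24, 26, 25] := rfl

theorem stores_mark (c0 c2 c3 c4 σ : ℕ) (d e : Fin 3) : (mark c0 c2 c3 c4 σ d e).stores =
    [2, 3, 4, 2 + (d : ℕ), 2, 3, 4, 2 + (e : ℕ)] := rfl

/-- The lists `L'` are obtained from `L` by assigning colors of `f`. -/
structure Precolors (f : Fin n → Fin 3) (L L' : Fin n → Fin 3 → Prop) : Prop where
  mem : (∀ v, L v (f v)) → ∀ v, L' v (f v)
  only : ∀ v, (∀ c, L v c → c = f v) → ∀ c, L' v c → c = f v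

theorem Precolors.refl (f : Fin n → Fin 3) (L : Fin n → Fin 3 → Prop) : Precolors f L L :=
  ⟨fun h => h, fun _ h => h⟩

theorem Precolors.trans {f : Fin n → Fin 3} {L L' L'' : Fin n → Fin 3 → Prop}
    (h : Precolors f L L') (h' : Precolors f L' L'') : Precolors f L L'' :=
  ⟨fun hm => h'.mem (h.mem hm), fun v hv => h'.only v (h.only v hv)⟩

theorem precolors_setTo (f : Fin n → Fin 3) (L : Fin n → Fin 3 → Prop) (v : Fin n) :
    Precolors f L (setTo L v (f v)) ∧ ∀ c, setTo L v (f v) v c → c = f v := by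
  refine ⟨⟨fun h w => ?_, fun w h c => ?_⟩, ?_⟩
  · by_cases hw : w = v
    · exact Or.inl ⟨hw, by rw [hw]⟩
    · exact Or.inr ⟨hw, h w⟩
  · rintro (⟨rfl, h1⟩ | ⟨-, h1⟩)
    · exact h1
    · exact h c h1
  · rintro c (⟨-, h1⟩ | ⟨h1, -⟩)
    · exact h1
    · exact absurd rfl h1

/-- For a correct guess all colors written are those of `f`. So lists keep the color of `f`, and
lists already reduced to it stay so, even if a vertex is written twice. -/
theorem precolors_mark (h : Base G s) {c0 c2 c3 c4 σ : ℕ} {p0 p2 p3 p4 w : Fin n}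
    (hr : c0 < 20 ∧ c2 < 20 ∧ c3 < 20 ∧ c4 < 20 ∧ σ < 20)
    (h0 : s.reg c0 = p0) (h2 : s.reg c2 = p2) (h3 : s.reg c3 = p3) (h4 : s.reg c4 = p4)
    (hw : s.reg σ = w) {f : Fin n → Fin 3} {d e : Fin 3}
    (g : Guess G (FarFrom G p0 p2 p3 p4) (fun t => G.Adj p0 t ∧ G.Adj p2 t) f w d e) :
    Precolors f (lists n 2 s) (lists n 2 ((mark c0 c2 c3 c4 σ d e).sem s)) ∧
      (∀ v, G.Adj p0 v ∧ G.Adj p2 v → Before G (FarFrom G p0 p2 p3 p4) v w →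
        ∀ c, lists n 2 ((mark c0 c2 c3 c4 σ d e).sem s) v c → c = f v) ∧
      ∀ c, lists n 2 ((mark c0 c2 c3 c4 σ d e).sem s) w c → c = f w := by
  set body : Cmd := .ite (.mul (adj c0 21) (adj c2 21))
    (.seq (before c0 c2 c3 c4 σ) (.ite (.reg 25) (setList 21 d) .skip)) .skip with hbody
  have hh := sem_loop (n := n) (i := 21) (p := body)
    (fun k t => Base G t ∧ (∀ x < 20, t.reg x = s.reg x) ∧
      Precolors f (lists n 2 s) (lists n 2 t) ∧
      ∀ v : Fin n, k ≤ (v : ℕ) → G.Adj p0 v ∧ G.Adj p2 v → Before G (FarFrom G p0 p2 p3 p4) v w →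
        ∀ c, lists n 2 t v c → c = f v) s h.size
    ⟨h.setReg (by simp), fun x hx => by simp [show x ≠ 21 by omega], .refl _ _,
      fun v hv => absurd v.2 (not_lt.2 hv)⟩ ?_
  · obtain ⟨b1, r1, q1, k1⟩ := hh
    have e1 := lists_setList (x := σ) (s := (Cmd.loop 21 body).sem s) (v := w)
      (by rw [r1 σ hr.2.2.2.2, hw]) e
    obtain ⟨q2, k2⟩ := precolors_setTo f (lists n 2 ((Cmd.loop 21 body).sem s)) w
    rw [g.last, ← e1] at q2 k2
    refine ⟨q1.trans q2, fun v hv hb => q2.only v (k1 v (Nat.zero_le _) hv hb), fun c hc => ?_⟩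
    rw [g.last]
    exact k2 c hc
  rintro k t ⟨b1, r1, q1, k1⟩
  have r0 : ∀ x < 20, (t.setReg 21 k).reg x = s.reg x := fun x hx => by
    simp [show x ≠ 21 by omega, r1 x hx]
  have b0 : Base G (t.setReg 21 k) := b1.setReg (by simp)
  have v0 : (t.setReg 21 k).reg 21 = k := by simp
  rw [← lists_setReg 2 t 21 k] at q1 k1
  generalize t.setReg 21 k = t0 at q1 k1 r0 b0 v0
  have l0 : t0.reg c0 = p0 := by rw [r0 _ hr.1, h0]
  have l2 : t0.reg c2 = p2 := by rw [r0 _ hr.2.1, h2]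
  have ev : (Exp.mul (adj c0 21) (adj c2 21)).eval t0 ≠ 0 ↔ G.Adj p0 k ∧ G.Adj p2 k := by
    rw [Exp.eval_mul, Exp.eval_adj b0 l0 v0, Exp.eval_adj b0 l2 v0]
  have eb := reg_before b0 hr l0 l2 (by rw [r0 _ hr.2.2.1, h3]) (by rw [r0 _ hr.2.2.2.1, h4]) v0
    (by rw [r0 _ hr.2.2.2.2, hw])
  have base : Base G (body.sem t0) :=
    b0.sem (by simp [hbody, writes, writes_before, writes_setList])
      (by simp [hbody, stores, stores_before, stores_setList]; omega)
  have regs : ∀ x < 20, (body.sem t0).reg x = s.reg x := fun x hx => by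
    rw [reg_sem _ t0, r0 x hx]
    simp only [hbody, writes, writes_before, writes_setList, List.append_nil, List.mem_cons,
      List.not_mem_nil, or_false]
    omega
  refine ⟨base, regs, ?_⟩
  simp only [hbody, sem]
  split_ifs with hT hB
  · have hT := ev.1 hT
    have hB := eb.1 hB
    have lb : lists n 2 ((before c0 c2 c3 c4 σ).sem t0) = lists n 2 t0 :=
      lists_sem (by simp [stores_before]) (by simp [stores_before]) (by simp [stores_before])
    rw [lists_setList (v := k) (by rw [reg_sem (by simp [writes_before]), v0]), lb,
      ← g.before k hT hB]
    obtain ⟨q2, k2⟩ := precolors_setTo f (lists n 2 t0) k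
    refine ⟨q1.trans q2, fun v hv hT' hB' => ?_⟩
    rcases hv.eq_or_lt with hv | hv
    · obtain rfl := Fin.ext hv
      exact k2
    · exact q2.only v (k1 v hv hT' hB')
  · have hT := ev.1 hT
    have hB : ¬ _ := fun hB' => hB (eb.2 hB')
    have lb : lists n 2 ((before c0 c2 c3 c4 σ).sem t0) = lists n 2 t0 :=
      lists_sem (by simp [stores_before]) (by simp [stores_before]) (by simp [stores_before])
    rw [lb]
    refine ⟨q1, fun v hv hT' hB' => ?_⟩
    rcases hv.eq_or_lt with hv | hv
    · obtain rfl := Fin.ext hv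
      exact absurd hB' hB
    · exact k1 v hv hT' hB'
  · have hT : ¬ _ := fun hT' => hT (ev.2 hT')
    refine ⟨q1, fun v hv hT' hB' => ?_⟩
    rcases hv.eq_or_lt with hv | hv
    · obtain rfl := Fin.ext hv
      exact absurd hT' hT
    · exact k1 v hv hT' hB'

/-- Give all colors to all vertices. -/
def fill : Cmd :=
  .loop 21 (.seq (.store 2 (.reg 21) (.lit 1))
    (.seq (.store 3 (.reg 21) (.lit 1)) (.store 4 (.reg 21) (.lit 1))))

theorem writes_fill : fill.writes = [21] := rfl
theorem stores_fill : fill.stores = [2, 3, 4] := rfl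

theorem lists_fill (h : Base G s) (v : Fin n) (c : Fin 3) : lists n 2 (fill.sem s) v c := by
  have hh := sem_loop (n := n) (i := 21) (p := .seq (.store 2 (.reg 21) (.lit 1))
    (.seq (.store 3 (.reg 21) (.lit 1)) (.store 4 (.reg 21) (.lit 1))))
    (fun k t => ∀ v : Fin n, k ≤ (v : ℕ) → ∀ c, lists n 2 t v c) s h.size
    (fun v hv => absurd v.2 (not_lt.2 hv)) ?_
  · exact hh v (Nat.zero_le _) c
  · intro k t ht v hv c
    rcases hv.eq_or_lt with hv | hv
    · obtain rfl := Fin.ext hv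
      fin_cases c <;> simp [lists, sem, Exp.eval]
    · have hvk : (v : ℕ) ≠ k := by omega
      have := ht v hv c
      simpa [lists, sem, Exp.eval, hvk] using this

/-- Color the pentagon with `0, 1, 0, 1, 2`. -/
def colorPentagon (r0 r1 r2 r3 r4 : ℕ) : Cmd :=
  .seq (setList r0 0) (.seq (setList r1 1) (.seq (setList r2 0) (.seq (setList r3 1) (setList r4 2))))

theorem writes_colorPentagon (r0 r1 r2 r3 r4 : ℕ) : (colorPentagon r0 r1 r2 r3 r4).writes = [] := rfl

theorem stores_colorPentagon (r0 r1 r2 r3 r4 : ℕ) : (colorPentagon r0 r1 r2 r3 r4).stores =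
    [2, 3, 4, 2, 2, 3, 4, 3, 2, 3, 4, 2, 2, 3, 4, 3, 2, 3, 4, 4] := rfl

theorem precolors_colorPentagon {r0 r1 r2 r3 r4 : ℕ} {p0 p1 p2 p3 p4 : Fin n}
    (h0 : s.reg r0 = p0) (h1 : s.reg r1 = p1) (h2 : s.reg r2 = p2) (h3 : s.reg r3 = p3)
    (h4 : s.reg r4 = p4) {f : Fin n → Fin 3} (f0 : f p0 = 0) (f1 : f p1 = 1) (f2 : f p2 = 0)
    (f3 : f p3 = 1) (f4 : f p4 = 2) :
    Precolors f (lists n 2 s) (lists n 2 ((colorPentagon r0 r1 r2 r3 r4).sem s)) ∧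
      (∀ c, lists n 2 ((colorPentagon r0 r1 r2 r3 r4).sem s) p0 c → c = f p0) ∧
      (∀ c, lists n 2 ((colorPentagon r0 r1 r2 r3 r4).sem s) p1 c → c = f p1) ∧
      (∀ c, lists n 2 ((colorPentagon r0 r1 r2 r3 r4).sem s) p2 c → c = f p2) ∧
      (∀ c, lists n 2 ((colorPentagon r0 r1 r2 r3 r4).sem s) p3 c → c = f p3) ∧
      ∀ c, lists n 2 ((colorPentagon r0 r1 r2 r3 r4).sem s) p4 c → c = f p4 := by
  have key : ∀ (t : Store) (r : ℕ) (p : Fin n) (c : Fin 3), t.reg = s.reg → s.reg r = p → f p = c →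
      Precolors f (lists n 2 t) (lists n 2 ((setList r c).sem t)) ∧
        (∀ c', lists n 2 ((setList r c).sem t) p c' → c' = f p) ∧
        ((setList r c).sem t).reg = s.reg := by
    intro t r p c ht hr hc
    rw [lists_setList (v := p) (by rw [ht, hr]), ← hc]
    exact ⟨(precolors_setTo f _ p).1, (precolors_setTo f _ p).2, ht⟩
  obtain ⟨q0, k0, t0⟩ := key s r0 p0 0 rfl h0 f0
  obtain ⟨q1, k1, t1⟩ := key _ r1 p1 1 t0 h1 f1
  obtain ⟨q2, k2, t2⟩ := key _ r2 p2 0 t1 h2 f2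
  obtain ⟨q3, k3, t3⟩ := key _ r3 p3 1 t2 h3 f3
  obtain ⟨q4, k4, t4⟩ := key _ r4 p4 2 t3 h4 f4
  exact ⟨q0.trans (q1.trans (q2.trans (q3.trans q4))),
    q4.only _ (q3.only _ (q2.only _ (q1.only _ k0))), q4.only _ (q3.only _ (q2.only _ k1)),
    q4.only _ (q3.only _ k2), q4.only _ k3, k4⟩

/-- Try one guess. -/
def branch (r0 r1 r2 r3 r4 : ℕ) (d e d' e' : Fin 3) : Cmd :=
  .seq fill (.seq (colorPentagon r0 r1 r2 r3 r4) (.seq (mark r0 r2 r3 r4 16 d e)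
    (.seq (mark r3 r1 r0 r4 17 d' e') (.seq solve finish))))

theorem notMem_writes_branch {r0 r1 r2 r3 r4 : ℕ} {d e d' e' : Fin 3} {x : ℕ} (hx : x < 18) :
    x ∉ (branch r0 r1 r2 r3 r4 d e d' e').writes := by
  simp only [branch, writes, writes_fill, writes_colorPentagon, writes_mark, solve, finish,
    writes_propagate, writes_attempt, writes_nonempty, writes_output, List.mem_append, List.mem_cons,
    List.not_mem_nil, or_false, false_or]
  omega

/-- Only the last clause depends on the guess: a wrong one can neither produce a false coloring nor
revoke an earlier success. -/
theorem branch_spec {r0 r1 r2 r3 r4 : ℕ} {d e d' e' : Fin 3} (h : Base G s) (hs : Sound G s) :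
    Base G ((branch r0 r1 r2 r3 r4 d e d' e').sem s) ∧
    Sound G ((branch r0 r1 r2 r3 r4 d e d' e').sem s) ∧
    (s.reg 18 ≠ 0 → ((branch r0 r1 r2 r3 r4 d e d' e').sem s).reg 18 ≠ 0) ∧
    ∀ f : Fin n → Fin 3,
      ListColoring G (lists n 2 ((mark r3 r1 r0 r4 17 d' e').sem ((mark r0 r2 r3 r4 16 d e).sem
        ((colorPentagon r0 r1 r2 r3 r4).sem (fill.sem s))))) f →
      (∀ L, Propagated G (lists n 2 ((mark r3 r1 r0 r4 17 d' e').sem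
        ((mark r0 r2 r3 r4 16 d e).sem ((colorPentagon r0 r1 r2 r3 r4).sem (fill.sem s))))) L →
        ∀ v, ∃ c, ¬ L v c) → ((branch r0 r1 r2 r3 r4 d e d' e').sem s).reg 18 ≠ 0 := by
  have keep : ∀ (p : Cmd) (t : Store), 0 ∉ p.writes → 18 ∉ p.writes → 0 ∉ p.stores → 1 ∉ p.stores →
      Base G t ∧ Sound G t ∧ t.reg 18 = s.reg 18 →
      Base G (p.sem t) ∧ Sound G (p.sem t) ∧ (p.sem t).reg 18 = s.reg 18 := by
    rintro p t h1 h2 h3 h4 ⟨b, q, e⟩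
    refine ⟨b.sem h1 h3, ?_, by rw [reg_sem h2, e]⟩
    unfold Sound at q ⊢
    rwa [reg_sem h2, arr_sem h4]
  have k1 := keep fill s (by simp [writes_fill]) (by simp [writes_fill]) (by simp [stores_fill])
    (by simp [stores_fill]) ⟨h, hs, rfl⟩
  have k2 := keep (colorPentagon r0 r1 r2 r3 r4) _ (by simp [writes_colorPentagon])
    (by simp [writes_colorPentagon]) (by simp [stores_colorPentagon])
    (by simp [stores_colorPentagon]) k1
  have k3 := keep (mark r0 r2 r3 r4 16 d e) _ (by simp [writes_mark]) (by simp [writes_mark])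
    (by simp [stores_mark]; omega) (by simp [stores_mark]; omega) k2
  have k4 := keep (mark r3 r1 r0 r4 17 d' e') _ (by simp [writes_mark]) (by simp [writes_mark])
    (by simp [stores_mark]; omega) (by simp [stores_mark]; omega) k3
  simp only [branch, sem]
  generalize (mark r3 r1 r0 r4 17 d' e').sem ((mark r0 r2 r3 r4 16 d e).sem
    ((colorPentagon r0 r1 r2 r3 r4).sem (fill.sem s))) = t at k4 ⊢
  have k5 := keep solve t (by simp [solve, writes, writes_propagate, writes_attempt])
    (by simp [solve, writes, writes_propagate, writes_attempt])
    (by simp [solve, stores, stores_propagate, stores_attempt])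
    (by simp [solve, stores, stores_propagate, stores_attempt]) k4
  obtain ⟨c1, c2, c3⟩ := solve_spec k4.1
  obtain ⟨d1, d2, d3⟩ := finish_spec k5.1 k5.2.1 c1 c2
  refine ⟨k5.1.sem (by simp [finish, writes, writes_nonempty, writes_output])
    (by simp [finish, stores, stores_nonempty, stores_output]), d1, ?_, fun f hf hL => d3 (c3 f hf hL)⟩
  rwa [k5.2.2] at d2

/-- All precolored vertices follow `f`, so `f` survives every propagation, and `Excl.exists_not_mem`
yields the bound of two colors that the solver needs. -/
theorem branch_hits {r0 r1 r2 r3 r4 : ℕ} {d e d' e' : Fin 3} (h : Base G s) (hs : Sound G s)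
    {p0 p1 p2 p3 p4 w w' : Fin n} (E : Excl G) (hG : Clean G) (hconn : G.Connected)
    (C : Pentagon G p0 p1 p2 p3 p4) (hr : r0 < 18 ∧ r1 < 18 ∧ r2 < 18 ∧ r3 < 18 ∧ r4 < 18)
    (h0 : s.reg r0 = p0) (h1 : s.reg r1 = p1) (h2 : s.reg r2 = p2) (h3 : s.reg r3 = p3)
    (h4 : s.reg r4 = p4) (hw : s.reg 16 = w) (hw' : s.reg 17 = w') {f : Fin n → Fin 3}
    (hf : ∀ u v, G.Adj u v → f u ≠ f v) (f0 : f p0 = 0) (f1 : f p1 = 1) (f2 : f p2 = 0)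
    (f3 : f p3 = 1) (f4 : f p4 = 2)
    (g : Guess G (FarFrom G p0 p2 p3 p4) (fun t => G.Adj p0 t ∧ G.Adj p2 t) f w d e)
    (g' : Guess G (FarFrom G p3 p1 p0 p4) (fun t => G.Adj p3 t ∧ G.Adj p1 t) f w' d' e') :
    ((branch r0 r1 r2 r3 r4 d e d' e').sem s).reg 18 ≠ 0 := by
  obtain ⟨l0, l1, l2, l3, l4⟩ := hr
  have b1 : Base G (fill.sem s) := h.sem (by simp [writes_fill]) (by simp [stores_fill])
  have R1 : ∀ x < 18, (fill.sem s).reg x = s.reg x := fun x hx =>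
    reg_sem (by simp [writes_fill]; omega) s
  have full := lists_fill h
  refine (branch_spec h hs).2.2.2 f ?_ ?_ <;> generalize fill.sem s = s1 at b1 R1 full ⊢
  all_goals
    have b2 : Base G ((colorPentagon r0 r1 r2 r3 r4).sem s1) :=
      b1.sem (by simp [writes_colorPentagon]) (by simp [stores_colorPentagon])
    have R2 : ∀ x < 18, ((colorPentagon r0 r1 r2 r3 r4).sem s1).reg x = s.reg x := fun x hx => by
      rw [reg_sem (by simp [writes_colorPentagon]), R1 x hx]
    obtain ⟨q2, a0, a1, a2, a3, a4⟩ := precolors_colorPentagon (n := n) (s := s1)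
      ((R1 r0 l0).trans h0) ((R1 r1 l1).trans h1) ((R1 r2 l2).trans h2) ((R1 r3 l3).trans h3)
      ((R1 r4 l4).trans h4) f0 f1 f2 f3 f4
    generalize (colorPentagon r0 r1 r2 r3 r4).sem s1 = s2 at *
    have b3 : Base G ((mark r0 r2 r3 r4 16 d e).sem s2) :=
      b2.sem (by simp [writes_mark]) (by simp [stores_mark]; omega)
    have R3 : ∀ x < 18, ((mark r0 r2 r3 r4 16 d e).sem s2).reg x = s.reg x := fun x hx => by
      rw [reg_sem (by simp [writes_mark]; omega), R2 x hx]
    obtain ⟨q3, a5, a6⟩ := precolors_mark b2 (σ := 16) (by omega) ((R2 r0 l0).trans h0)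
      ((R2 r2 l2).trans h2) ((R2 r3 l3).trans h3) ((R2 r4 l4).trans h4)
      ((R2 16 (by simp)).trans hw) g
    generalize (mark r0 r2 r3 r4 16 d e).sem s2 = s3 at *
    obtain ⟨q4, a7, a8⟩ := precolors_mark b3 (σ := 17) (by omega) ((R3 r3 l3).trans h3)
      ((R3 r1 l1).trans h1) ((R3 r0 l0).trans h0) ((R3 r4 l4).trans h4)
      ((R3 17 (by simp)).trans hw') g'
    generalize (mark r3 r1 r0 r4 17 d' e').sem s3 = s4 at *
    have hm : ∀ v, lists n 2 s4 v (f v) := q4.mem (q3.mem (q2.mem fun v => full v _))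
  · exact ⟨hm, hf⟩
  · intro L hL
    have o := fun v hv => q4.only v (q3.only v hv)
    refine E.exists_not_mem hG hconn C hL.closed (hL.keep f ⟨hm, hf⟩)
      (fun c hc => f0 ▸ o p0 a0 c (hL.le _ _ hc)) (fun c hc => f1 ▸ o p1 a1 c (hL.le _ _ hc))
      (fun c hc => f2 ▸ o p2 a2 c (hL.le _ _ hc)) (fun c hc => f3 ▸ o p3 a3 c (hL.le _ _ hc))
      (fun c hc => f4 ▸ o p4 a4 c (hL.le _ _ hc)) g g'
      (fun v hv hb c hc => g.before v hv hb ▸ q4.only v (a5 v hv hb) c (hL.le _ _ hc))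
      (fun c hc => g.last ▸ q4.only w a6 c (hL.le _ _ hc))
      (fun v hv hb c hc => g'.before v hv hb ▸ a7 v hv hb c (hL.le _ _ hc))
      (fun c hc => g'.last ▸ a8 c (hL.le _ _ hc))

/-! ### Exhaustive search -/

/-- The command `p` preserves the invariant `I`, and under this invariant also the success `F`. -/
structure Tries (I F : Store → Prop) (p : Cmd) : Prop where
  keep : ∀ s, I s → I (p.sem s)
  mono : ∀ s, I s → F s → F (p.sem s)

variable {I F : Store → Prop} {p q : Cmd}

theorem Tries.seq (hp : Tries I F p) (hq : Tries I F q) : Tries I F (.seq p q) :=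
  ⟨fun s h => hq.keep _ (hp.keep s h), fun s h hF => hq.mono _ (hp.keep s h) (hp.mono s h hF)⟩

theorem Tries.and_reg (hp : Tries I F p) {x w : ℕ} (hx : x ∉ p.writes) :
    Tries (fun s => I s ∧ s.reg x = w) F p :=
  ⟨fun s h => ⟨hp.keep s h.1, by rw [reg_sem hx, h.2]⟩, fun s h => hp.mono s h.1⟩

theorem Tries.loop {i : ℕ} (hp : ∀ w : Fin n, Tries (fun s => I s ∧ s.reg i = w) F p)
    (hn : ∀ s, I s → s.reg 0 = n) (hI : ∀ s k, I s → I (s.setReg i k))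
    (hF : ∀ s k, F s → F (s.setReg i k)) : Tries I F (.loop i p) := by
  refine ⟨fun s h => ?_, fun s h hs => ?_⟩
  · exact sem_loop (n := n) (fun _ t => I t) s (hn s h) (hI s _ h) fun k t ht =>
      ((hp k).keep _ ⟨hI t _ ht, by simp⟩).1
  · exact (sem_loop (n := n) (fun _ t => I t ∧ F t) s (hn s h) ⟨hI s _ h, hF s _ hs⟩ fun k t ht =>
      ⟨((hp k).keep _ ⟨hI t _ ht.1, by simp⟩).1,
        (hp k).mono _ ⟨hI t _ ht.1, by simp⟩ (hF t _ ht.2)⟩).2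

/-- Iterations before `w` need only keep the invariant, and those after it preserve the success. -/
theorem Tries.hits_loop {i : ℕ} (hp : ∀ w : Fin n, Tries (fun s => I s ∧ s.reg i = w) F p)
    (hn : ∀ s, I s → s.reg 0 = n) (hI : ∀ s k, I s → I (s.setReg i k))
    (hF : ∀ s k, F s → F (s.setReg i k)) (w : Fin n)
    (hw : ∀ s, I s ∧ s.reg i = w → F (p.sem s)) (hs : I s) : F ((Cmd.loop i p).sem s) := by
  refine (sem_loop (n := n) (fun k t => I t ∧ (k ≤ (w : ℕ) → F t)) s (hn s hs)
    ⟨hI s _ hs, fun h => absurd w.2 (not_lt.2 h)⟩ fun k t ht => ?_).2 (Nat.zero_le _)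
  refine ⟨((hp k).keep _ ⟨hI t _ ht.1, by simp⟩).1, fun hk => ?_⟩
  rcases hk.eq_or_lt with hk | hk
  · exact hw _ ⟨hI t _ ht.1, by simp [hk]⟩
  · exact (hp k).mono _ ⟨hI t _ ht.1, by simp⟩ (hF t _ (ht.2 hk))

/-- Run a command for each color. -/
def colors (p : Fin 3 → Cmd) : Cmd := .seq (p 0) (.seq (p 1) (p 2))

theorem Tries.colors {p : Fin 3 → Cmd} (hp : ∀ c, Tries I F (p c)) : Tries I F (colors p) :=
  (hp 0).seq ((hp 1).seq (hp 2))

theorem Tries.hits_colors {p : Fin 3 → Cmd} (hp : ∀ c, Tries I F (p c)) (c : Fin 3)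
    (hc : ∀ s, I s → F ((p c).sem s)) (hs : I s) : F ((Cmd.colors p).sem s) := by
  simp only [Cmd.colors, sem]
  match c with
  | 0 => exact ((hp 1).seq (hp 2)).mono _ ((hp 0).keep s hs) (hc s hs)
  | 1 => exact (hp 2).mono _ ((hp 1).keep _ ((hp 0).keep s hs)) (hc _ ((hp 0).keep s hs))
  | 2 => exact hc _ ((hp 1).keep _ ((hp 0).keep s hs))

theorem notMem_writes_colors {p : Fin 3 → Cmd} {x : ℕ} (h : ∀ c, x ∉ (p c).writes) :
    x ∉ (colors p).writes := by
  simp [Cmd.colors, writes, h]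

/-- Try all guesses of colors. -/
def branches (r0 r1 r2 r3 r4 : ℕ) : Cmd :=
  colors fun d => colors fun e => colors fun d' => colors fun e' => branch r0 r1 r2 r3 r4 d e d' e'

/-- Try all guesses. -/
def search (r0 r1 r2 r3 r4 : ℕ) : Cmd := .loop 16 (.loop 17 (branches r0 r1 r2 r3 r4))

/-- The invariant of the search: the registers `11, …, 15` contain a pentagon. -/
structure Ready (G : SimpleGraph (Fin n)) (p : ℕ → Fin n) (s : Store) : Prop where
  base : Base G s
  sound : Sound G s
  regs : ∀ x, 11 ≤ x → x ≤ 15 → s.reg x = p x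

theorem Ready.setReg {p : ℕ → Fin n} (h : Ready G p s) {x w : ℕ} (hx : 16 ≤ x) (hx' : x ≠ 18) :
    Ready G p (s.setReg x w) := by
  refine ⟨h.base.setReg (by omega), ?_, fun y h1 h2 => ?_⟩
  · have := h.sound
    unfold Sound at this ⊢
    simpa [hx'.symm] using this
  · simp [show y ≠ x by omega, h.regs y h1 h2]

theorem tries_branch (p : ℕ → Fin n) (r0 r1 r2 r3 r4 : ℕ) (d e d' e' : Fin 3) :
    Tries (Ready G p) (fun s => s.reg 18 ≠ 0) (branch r0 r1 r2 r3 r4 d e d' e') := by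
  have nw : ∀ x < 18, x ∉ (branch r0 r1 r2 r3 r4 d e d' e').writes :=
    fun x hx => notMem_writes_branch hx
  have sp : ∀ s, Ready G p s → _ := fun s h =>
    branch_spec (r0 := r0) (r1 := r1) (r2 := r2) (r3 := r3) (r4 := r4) (d := d) (e := e) (d' := d')
      (e' := e') h.base h.sound
  generalize branch r0 r1 r2 r3 r4 d e d' e' = b at nw sp ⊢
  exact ⟨fun s h => ⟨(sp s h).1, (sp s h).2.1, fun x h1 h2 => by
    rw [reg_sem (nw x (by omega)), h.regs x h1 h2]⟩, fun s h => (sp s h).2.2.1⟩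

theorem tries_branches (p : ℕ → Fin n) (r0 r1 r2 r3 r4 : ℕ) :
    Tries (Ready G p) (fun s => s.reg 18 ≠ 0) (branches r0 r1 r2 r3 r4) :=
  .colors fun d => .colors fun e => .colors fun d' => .colors fun e' =>
    tries_branch p r0 r1 r2 r3 r4 d e d' e'

theorem notMem_writes_branches {r0 r1 r2 r3 r4 : ℕ} {x : ℕ} (hx : x < 18) :
    x ∉ (branches r0 r1 r2 r3 r4).writes :=
  notMem_writes_colors fun _ => notMem_writes_colors fun _ => notMem_writes_colors fun _ =>
    notMem_writes_colors fun _ => notMem_writes_branch hx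

theorem tries_inner (p : ℕ → Fin n) (r0 r1 r2 r3 r4 : ℕ) (w : Fin n) :
    Tries (fun s => Ready G p s ∧ s.reg 16 = w) (fun s => s.reg 18 ≠ 0)
      (.loop 17 (branches r0 r1 r2 r3 r4)) := by
  have T := tries_branches (G := G) p r0 r1 r2 r3 r4
  have n16 := notMem_writes_branches (r0 := r0) (r1 := r1) (r2 := r2) (r3 := r3) (r4 := r4)
    (x := 16) (by simp)
  have n17 := notMem_writes_branches (r0 := r0) (r1 := r1) (r2 := r2) (r3 := r3) (r4 := r4)
    (x := 17) (by simp)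
  generalize branches r0 r1 r2 r3 r4 = b at T n16 n17 ⊢
  exact .loop (fun w' => (T.and_reg n16).and_reg n17) (fun _ h => h.1.base.size)
    (fun _ _ h => ⟨h.1.setReg (by simp) (by simp), by simp [h.2]⟩) (fun s k h => by simpa using h)

theorem tries_search (p : ℕ → Fin n) (r0 r1 r2 r3 r4 : ℕ) :
    Tries (Ready G p) (fun s => s.reg 18 ≠ 0) (search r0 r1 r2 r3 r4) :=
  .loop (tries_inner p r0 r1 r2 r3 r4) (fun _ h => h.base.size)
    (fun _ _ h => h.setReg (by simp) (by simp)) (fun s k h => by simpa using h)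

theorem branches_hits {p : ℕ → Fin n} {w w' : Fin n} {r0 r1 r2 r3 r4 : ℕ} (d e d' e' : Fin 3)
    (hits : ∀ s, (Ready G p s ∧ s.reg 16 = w) ∧ s.reg 17 = w' →
      ((branch r0 r1 r2 r3 r4 d e d' e').sem s).reg 18 ≠ 0)
    (hs : (Ready G p s ∧ s.reg 16 = w) ∧ s.reg 17 = w') :
    ((branches r0 r1 r2 r3 r4).sem s).reg 18 ≠ 0 := by
  have T : ∀ d e d' e', Tries (fun s => (Ready G p s ∧ s.reg 16 = w) ∧ s.reg 17 = w')
      (fun s => s.reg 18 ≠ 0) (branch r0 r1 r2 r3 r4 d e d' e') := fun d e d' e' =>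
    ((tries_branch p r0 r1 r2 r3 r4 d e d' e').and_reg
      (notMem_writes_branch (x := 16) (by simp))).and_reg (notMem_writes_branch (x := 17) (by simp))
  rw [branches]
  generalize branch r0 r1 r2 r3 r4 = b at hits T ⊢
  have T1 := fun d e d' => Tries.colors (T d e d')
  have T2 := fun d e => Tries.colors (T1 d e)
  have T3 := fun d => Tries.colors (T2 d)
  have h1 := fun s hs => Tries.hits_colors (s := s) (T d e d') e' hits hs
  have h2 := fun s hs => Tries.hits_colors (s := s) (T1 d e) d' h1 hs
  have h3 := fun s hs => Tries.hits_colors (s := s) (T2 d) e h2 hs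
  exact Tries.hits_colors T3 d h3 hs

/-- The pentagon vertices `p r1` and `p r2` show that the two classes are non-empty, so
`exists_guess` supplies a right guess for each, and the exhaustive loops meet both. -/
theorem search_hits {p : ℕ → Fin n} {r0 r1 r2 r3 r4 : ℕ} (hs : Ready G p s) (E : Excl G)
    (hG : Clean G) (hconn : G.Connected) (C : Pentagon G (p r0) (p r1) (p r2) (p r3) (p r4))
    (hr : (11 ≤ r0 ∧ r0 ≤ 15) ∧ (11 ≤ r1 ∧ r1 ≤ 15) ∧ (11 ≤ r2 ∧ r2 ≤ 15) ∧ (11 ≤ r3 ∧ r3 ≤ 15) ∧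
      (11 ≤ r4 ∧ r4 ≤ 15)) {f : Fin n → Fin 3} (hf : ∀ u v, G.Adj u v → f u ≠ f v)
    (f0 : f (p r0) = 0) (f1 : f (p r1) = 1) (f2 : f (p r2) = 0) (f3 : f (p r3) = 1)
    (f4 : f (p r4) = 2) : ((search r0 r1 r2 r3 r4).sem s).reg 18 ≠ 0 := by
  obtain ⟨⟨a0, b0⟩, ⟨a1, b1⟩, ⟨a2, b2⟩, ⟨a3, b3⟩, ⟨a4, b4⟩⟩ := hr
  obtain ⟨w, d, e, g⟩ := exists_guess (G := G) (Y := FarFrom G (p r0) (p r2) (p r3) (p r4))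
    (T := fun t => G.Adj (p r0) t ∧ G.Adj (p r2) t)
    (fun ht ht' hx hy xy hx' hy' xy' => E.sees_nested hG hconn C ht.1 ht'.1 hx hy xy hx' hy' xy')
    ⟨p r1, C.adj01, C.adj12.symm⟩ f
  obtain ⟨w', d', e', g'⟩ := exists_guess (G := G) (Y := FarFrom G (p r3) (p r1) (p r0) (p r4))
    (T := fun t => G.Adj (p r3) t ∧ G.Adj (p r1) t)
    (fun ht ht' hx hy xy hx' hy' xy' =>
      E.sees_nested hG hconn C.reflect ht.1 ht'.1 hx hy xy hx' hy' xy')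
    ⟨p r2, C.adj23.symm, C.adj12⟩ f
  have hits : ∀ s, (Ready G p s ∧ s.reg 16 = w) ∧ s.reg 17 = w' →
      ((branches r0 r1 r2 r3 r4).sem s).reg 18 ≠ 0 := fun s hs =>
    branches_hits d e d' e' (fun s ⟨⟨hR, h16⟩, h17⟩ =>
      branch_hits hR.base hR.sound E hG hconn C (by omega) (hR.regs _ a0 b0) (hR.regs _ a1 b1)
        (hR.regs _ a2 b2) (hR.regs _ a3 b3) (hR.regs _ a4 b4) h16 h17 hf f0 f1 f2 f3 f4 g g') hs
  have T := tries_branches (G := G) p r0 r1 r2 r3 r4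
  have Ti := tries_inner (G := G) p r0 r1 r2 r3 r4
  have n16 := notMem_writes_branches (r0 := r0) (r1 := r1) (r2 := r2) (r3 := r3) (r4 := r4)
    (x := 16) (by simp)
  have n17 := notMem_writes_branches (r0 := r0) (r1 := r1) (r2 := r2) (r3 := r3) (r4 := r4)
    (x := 17) (by simp)
  rw [search]
  generalize branches r0 r1 r2 r3 r4 = b at hits T Ti n16 n17 ⊢
  exact Tries.hits_loop Ti (fun _ h => h.base.size)
    (fun _ _ h => h.setReg (by simp) (by simp)) (fun s k h => by simpa using h) w
    (fun s1 h1 => Tries.hits_loop (fun w' => (T.and_reg n16).and_reg n17)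
      (fun _ h => h.1.base.size)
      (fun _ _ h => ⟨h.1.setReg (by simp) (by simp), by simp [h.2]⟩)
      (fun s k h => by simpa using h) w' hits h1) hs

/-! ### The main program -/

/-- Test whether the registers `1, …, 5` contain a pentagon, and copy it. -/
def testPentagon : Cmd :=
  .ite (.mul (adj 1 2) (.mul (adj 2 3) (.mul (adj 3 4) (.mul (adj 4 5) (adj 5 1)))))
    (.seq (.assign 11 (.reg 1)) (.seq (.assign 12 (.reg 2)) (.seq (.assign 13 (.reg 3))
      (.seq (.assign 14 (.reg 4)) (.assign 15 (.reg 5)))))) .skip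

/-- Find a pentagon. -/
def findPentagon : Cmd := .loop 1 (.loop 2 (.loop 3 (.loop 4 (.loop 5 testPentagon))))

theorem writes_testPentagon : testPentagon.writes = [11, 12, 13, 14, 15] := rfl
theorem writes_findPentagon : findPentagon.writes = [1, 2, 3, 4, 5, 11, 12, 13, 14, 15] := rfl
theorem stores_findPentagon : findPentagon.stores = [] := rfl

/-- The registers `11, …, 15` contain a pentagon. -/
def HasPentagon (G : SimpleGraph (Fin n)) (s : Store) : Prop :=
  ∃ p : ℕ → Fin n, (∀ x, 11 ≤ x → x ≤ 15 → s.reg x = p x) ∧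
    Pentagon G (p 11) (p 12) (p 13) (p 14) (p 15)

theorem HasPentagon.setReg (h : HasPentagon G s) {x w : ℕ} (hx : x < 11) :
    HasPentagon G (s.setReg x w) := by
  obtain ⟨p, hp, C⟩ := h
  exact ⟨p, fun y h1 h2 => by simp [show y ≠ x by omega, hp y h1 h2], C⟩

theorem testPentagon_spec (h : Base G s) {w1 w2 w3 w4 w5 : Fin n} (h1 : s.reg 1 = w1)
    (h2 : s.reg 2 = w2) (h3 : s.reg 3 = w3) (h4 : s.reg 4 = w4) (h5 : s.reg 5 = w5) :
    Base G (testPentagon.sem s) ∧ (HasPentagon G s → HasPentagon G (testPentagon.sem s)) ∧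
      (Pentagon G w1 w2 w3 w4 w5 → HasPentagon G (testPentagon.sem s)) := by
  have ev : (Exp.mul (adj 1 2) (.mul (adj 2 3) (.mul (adj 3 4) (.mul (adj 4 5) (adj 5 1))))).eval s ≠ 0
      ↔ Pentagon G w1 w2 w3 w4 w5 := by
    rw [Exp.eval_mul, Exp.eval_mul, Exp.eval_mul, Exp.eval_mul, Exp.eval_adj h h1 h2,
      Exp.eval_adj h h2 h3, Exp.eval_adj h h3 h4, Exp.eval_adj h h4 h5, Exp.eval_adj h h5 h1]
    exact ⟨fun ⟨a, b, c, d, e⟩ => ⟨a, b, c, d, e⟩, fun ⟨a, b, c, d, e⟩ => ⟨a, b, c, d, e⟩⟩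
  refine ⟨h.sem (by simp [writes_testPentagon]) (by simp [testPentagon, stores]), ?_⟩
  have pos : Pentagon G w1 w2 w3 w4 w5 → HasPentagon G (testPentagon.sem s) := by
    intro C
    refine ⟨fun x => if x = 11 then w1 else if x = 12 then w2 else if x = 13 then w3 else
      if x = 14 then w4 else w5, fun x hx hx' => ?_, by simpa using C⟩
    rw [testPentagon, sem, if_pos (ev.2 C)]
    interval_cases x <;> simp [sem, Exp.eval, h1, h2, h3, h4, h5]
  by_cases hc : Pentagon G w1 w2 w3 w4 w5
  · exact ⟨fun _ => pos hc, pos⟩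
  · refine ⟨fun hp => ?_, pos⟩
    rw [testPentagon, sem, if_neg (fun h' => hc (ev.1 h'))]
    exact hp

/-- Success persists, since a later test either overwrites the registers with another pentagon or
leaves them alone. -/
theorem hasPentagon_findPentagon (h : Base G s) {w1 w2 w3 w4 w5 : Fin n}
    (C : Pentagon G w1 w2 w3 w4 w5) : HasPentagon G (findPentagon.sem s) := by
  have T : ∀ w1 w2 w3 w4 w5 : Fin n, Tries (fun s => ((((Base G s ∧ s.reg 1 = w1) ∧ s.reg 2 = w2) ∧
      s.reg 3 = w3) ∧ s.reg 4 = w4) ∧ s.reg 5 = w5) (HasPentagon G) testPentagon := by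
    intro w1 w2 w3 w4 w5
    refine ⟨fun s hs => ?_, fun s ⟨⟨⟨⟨⟨h, h1⟩, h2⟩, h3⟩, h4⟩, h5⟩ =>
      (testPentagon_spec h h1 h2 h3 h4 h5).2.1⟩
    obtain ⟨⟨⟨⟨⟨h, h1⟩, h2⟩, h3⟩, h4⟩, h5⟩ := hs
    refine ⟨⟨⟨⟨⟨(testPentagon_spec h h1 h2 h3 h4 h5).1, ?_⟩, ?_⟩, ?_⟩, ?_⟩, ?_⟩ <;>
      rwa [reg_sem (by simp [writes_testPentagon])]
  have H : ∀ s, (((((Base G s ∧ s.reg 1 = w1) ∧ s.reg 2 = w2) ∧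
      s.reg 3 = w3) ∧ s.reg 4 = w4) ∧ s.reg 5 = w5) → HasPentagon G (testPentagon.sem s) :=
    fun s ⟨⟨⟨⟨⟨h, h1⟩, h2⟩, h3⟩, h4⟩, h5⟩ => (testPentagon_spec h h1 h2 h3 h4 h5).2.2 C
  have F : ∀ i < 11, ∀ (s : Store) (k : ℕ), HasPentagon G s → HasPentagon G (s.setReg i k) :=
    fun i hi s k h => h.setReg hi
  rw [findPentagon]
  generalize testPentagon = t at T H ⊢
  have i4 : ∀ (w1 w2 w3 w4 : Fin n) (s : Store) (k : ℕ), ((((Base G s ∧ s.reg 1 = w1) ∧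
      s.reg 2 = w2) ∧ s.reg 3 = w3) ∧ s.reg 4 = w4) → ((((Base G (s.setReg 5 k) ∧
      (s.setReg 5 k).reg 1 = w1) ∧ (s.setReg 5 k).reg 2 = w2) ∧ (s.setReg 5 k).reg 3 = w3) ∧
      (s.setReg 5 k).reg 4 = w4) := fun _ _ _ _ s k ⟨⟨⟨⟨h, h1⟩, h2⟩, h3⟩, h4⟩ =>
    ⟨⟨⟨⟨h.setReg (by simp), by simpa using h1⟩, by simpa using h2⟩, by simpa using h3⟩,
      by simpa using h4⟩
  have i3 : ∀ (w1 w2 w3 : Fin n) (s : Store) (k : ℕ), (((Base G s ∧ s.reg 1 = w1) ∧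
      s.reg 2 = w2) ∧ s.reg 3 = w3) → (((Base G (s.setReg 4 k) ∧
      (s.setReg 4 k).reg 1 = w1) ∧ (s.setReg 4 k).reg 2 = w2) ∧ (s.setReg 4 k).reg 3 = w3) :=
    fun _ _ _ s k ⟨⟨⟨h, h1⟩, h2⟩, h3⟩ =>
    ⟨⟨⟨h.setReg (by simp), by simpa using h1⟩, by simpa using h2⟩, by simpa using h3⟩
  have i2 : ∀ (w1 w2 : Fin n) (s : Store) (k : ℕ), ((Base G s ∧ s.reg 1 = w1) ∧
      s.reg 2 = w2) → ((Base G (s.setReg 3 k) ∧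
      (s.setReg 3 k).reg 1 = w1) ∧ (s.setReg 3 k).reg 2 = w2) := fun _ _ s k ⟨⟨h, h1⟩, h2⟩ =>
    ⟨⟨h.setReg (by simp), by simpa using h1⟩, by simpa using h2⟩
  have i1 : ∀ (w1 : Fin n) (s : Store) (k : ℕ), (Base G s ∧ s.reg 1 = w1) →
      (Base G (s.setReg 2 k) ∧ (s.setReg 2 k).reg 1 = w1) := fun _ s k ⟨h, h1⟩ =>
    ⟨h.setReg (by simp), by simpa using h1⟩
  have i0 : ∀ (s : Store) (k : ℕ), Base G s → Base G (s.setReg 1 k) := fun s k h =>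
    h.setReg (by simp)
  have T4 := fun w1 w2 w3 w4 => Tries.loop (T w1 w2 w3 w4) (fun _ h => h.1.1.1.1.size)
    (i4 w1 w2 w3 w4) (F 5 (by simp))
  have T3 := fun w1 w2 w3 => Tries.loop (T4 w1 w2 w3) (fun _ h => h.1.1.1.size) (i3 w1 w2 w3)
    (F 4 (by simp))
  have T2 := fun w1 w2 => Tries.loop (T3 w1 w2) (fun _ h => h.1.1.size) (i2 w1 w2) (F 3 (by simp))
  have T1 := fun w1 => Tries.loop (T2 w1) (fun _ h => h.1.size) (i1 w1) (F 2 (by simp))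
  have H4 := fun s hs => Tries.hits_loop (s := s) (T w1 w2 w3 w4) (fun _ h => h.1.1.1.1.size)
    (i4 w1 w2 w3 w4) (F 5 (by simp)) w5 H hs
  have H3 := fun s hs => Tries.hits_loop (s := s) (T4 w1 w2 w3) (fun _ h => h.1.1.1.size)
    (i3 w1 w2 w3) (F 4 (by simp)) w4 H4 hs
  have H2 := fun s hs => Tries.hits_loop (s := s) (T3 w1 w2) (fun _ h => h.1.1.size) (i2 w1 w2)
    (F 3 (by simp)) w3 H3 hs
  have H1 := fun s hs => Tries.hits_loop (s := s) (T2 w1) (fun _ h => h.1.size) (i1 w1)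
    (F 2 (by simp)) w2 H2 hs
  exact Tries.hits_loop T1 (fun _ h => h.size) i0 (F 1 (by simp)) w1 H1 h

/-- Search for a 3-coloring, starting from all rotations of the pentagon. -/
def searchAll : Cmd :=
  .seq (search 11 12 13 14 15) (.seq (search 12 13 14 15 11) (.seq (search 13 14 15 11 12)
    (.seq (search 14 15 11 12 13) (search 15 11 12 13 14))))

/-- The main program. -/
def main : Cmd := .seq findPentagon searchAll

theorem ok_colors {p : Fin 3 → Cmd} (h : ∀ c, (p c).ok) : (colors p).ok := by
  simp [colors, ok, h]

theorem ok_search {r0 r1 r2 r3 r4 : ℕ} (hb : ∀ d e d' e', (branch r0 r1 r2 r3 r4 d e d' e').ok) :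
    (search r0 r1 r2 r3 r4).ok := by
  have h1 : (branches r0 r1 r2 r3 r4).ok :=
    ok_colors fun d => ok_colors fun e => ok_colors fun d' => ok_colors fun e' => hb d e d' e'
  have h2 := fun x hx => notMem_writes_branches (r0 := r0) (r1 := r1) (r2 := r2) (r3 := r3)
    (r4 := r4) (x := x) hx
  rw [search]
  generalize branches r0 r1 r2 r3 r4 = b at h1 h2 ⊢
  simp [ok, h1, h2, writes, Exp.tempBase]

/-- The program is explicit, so the check is an evaluation. The largest exponent of an expression is
12, in `Exp.seenEdge`, within `maxDeg`. -/
theorem ok_main : main.ok := by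
  simp only [main, searchAll, ok, Bool.and_eq_true]
  exact ⟨rfl, ok_search fun _ _ _ _ => rfl, ok_search fun _ _ _ _ => rfl,
    ok_search fun _ _ _ _ => rfl, ok_search fun _ _ _ _ => rfl, ok_search fun _ _ _ _ => rfl⟩

theorem deg_colors {p : Fin 3 → Cmd} {k : ℕ} (h : ∀ c, (p c).deg = k) : (colors p).deg = k := by
  simp [colors, deg, h]

/-- The guessed vertices contribute two. A branch contributes four through `solve`: a loop over
vertices, around the loop of `propagate`, around the two loops of `round`. -/
theorem deg_search {r0 r1 r2 r3 r4 : ℕ} : (search r0 r1 r2 r3 r4).deg = 6 := by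
  have : (branches r0 r1 r2 r3 r4).deg = 4 :=
    deg_colors fun d => deg_colors fun e => deg_colors fun d' => deg_colors fun e' => rfl
  simp [search, deg, this]

theorem deg_main : main.deg = 6 := by
  simp [main, searchAll, deg, deg_search, show findPentagon.deg = 5 from rfl]

/-- Colors can be renamed such that a coloring of a pentagon is `0, 1, 0, 1, 2` after a rotation. -/
theorem exists_rename {a b : Fin 3} (h : a ≠ b) : ∃ σ : Fin 3 → Fin 3, Function.Injective σ ∧
    σ a = 0 ∧ σ b = 1 ∧ ∀ c, c ≠ a → c ≠ b → σ c = 2 := by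
  refine ⟨fun x => if x = a then 0 else if x = b then 1 else 2, ?_, ?_, ?_, ?_⟩
  · intro x y
    revert a b x y
    decide
  · simp
  · simp [h.symm]
  · intro c h1 h2
    simp [h1, h2]

/-- One color occurs exactly once, and the other four vertices, which are consecutive, alternate
between two colors. -/
theorem pentagon_coloring : ∀ a b c d e : Fin 3, a ≠ b → b ≠ c → c ≠ d → d ≠ e → e ≠ a →
    (a = c ∧ b = d) ∨ (b = d ∧ c = e) ∨ (c = e ∧ d = a) ∨ (d = a ∧ e = b) ∨ (e = b ∧ a = c) := by
  decide

theorem Tries.hits_seq (hp : Tries I F p) (hq : Tries I F q)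
    (h : (∀ s, I s → F (p.sem s)) ∨ ∀ s, I s → F (q.sem s)) (s : Store) (hs : I s) :
    F ((Cmd.seq p q).sem s) :=
  h.elim (fun h => hq.mono _ (hp.keep s hs) (h s hs)) fun h => h _ (hp.keep s hs)

theorem hits_of_coloring {p : ℕ → Fin n} (E : Excl G) (hG : Clean G) (hconn : G.Connected)
    {r0 r1 r2 r3 r4 : ℕ} (C : Pentagon G (p r0) (p r1) (p r2) (p r3) (p r4))
    (hr : (11 ≤ r0 ∧ r0 ≤ 15) ∧ (11 ≤ r1 ∧ r1 ≤ 15) ∧ (11 ≤ r2 ∧ r2 ≤ 15) ∧ (11 ≤ r3 ∧ r3 ≤ 15) ∧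
      (11 ≤ r4 ∧ r4 ≤ 15)) (f : G.Coloring (Fin 3))
    (hf : f (p r0) = f (p r2) ∧ f (p r1) = f (p r3)) (s : Store) (hs : Ready G p s) :
    ((search r0 r1 r2 r3 r4).sem s).reg 18 ≠ 0 := by
  obtain ⟨σ, inj, h0, h1, h2⟩ := exists_rename (f.valid C.adj01)
  refine search_hits hs E hG hconn C hr (f := fun v => σ (f v))
    (fun u v uv e => f.valid uv (inj e)) h0 h1 (hf.1 ▸ h0) (hf.2 ▸ h1) (h2 _ (f.valid C.adj40) ?_)
  rw [hf.2]
  exact (f.valid C.adj34).symm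

/-- Each coloring fits one of the five rotations, and the other runs keep the invariant and the
success. -/
theorem searchAll_spec {p : ℕ → Fin n} (hs : Ready G p s) (E : Excl G) (hG : Clean G)
    (hconn : G.Connected) (C : Pentagon G (p 11) (p 12) (p 13) (p 14) (p 15)) :
    Sound G (searchAll.sem s) ∧ (G.Colorable 3 → (searchAll.sem s).reg 18 ≠ 0) := by
  have t1 := tries_search (G := G) p 11 12 13 14 15
  have t2 := tries_search (G := G) p 12 13 14 15 11
  have t3 := tries_search (G := G) p 13 14 15 11 12
  have t4 := tries_search (G := G) p 14 15 11 12 13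
  have t5 := tries_search (G := G) p 15 11 12 13 14
  have hit := fun f : G.Coloring (Fin 3) =>
    (pentagon_coloring _ _ _ _ _ (f.valid C.adj01) (f.valid C.adj12) (f.valid C.adj23)
      (f.valid C.adj34) (f.valid C.adj40)).imp (hits_of_coloring E hG hconn C (by simp) f)
      (Or.imp (hits_of_coloring E hG hconn C.rotate (by simp) f)
      (Or.imp (hits_of_coloring E hG hconn C.rotate.rotate (by simp) f)
      (Or.imp (hits_of_coloring E hG hconn C.rotate.rotate.rotate (by simp) f)
        (hits_of_coloring E hG hconn C.rotate.rotate.rotate.rotate (by simp) f))))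
  rw [searchAll]
  generalize search 11 12 13 14 15 = q1 at t1 hit ⊢
  generalize search 12 13 14 15 11 = q2 at t2 hit ⊢
  generalize search 13 14 15 11 12 = q3 at t3 hit ⊢
  generalize search 14 15 11 12 13 = q4 at t4 hit ⊢
  generalize search 15 11 12 13 14 = q5 at t5 hit ⊢
  have t45 := t4.seq t5
  have t345 := t3.seq t45
  have t2345 := t2.seq t345
  refine ⟨((t1.seq t2345).keep s hs).sound, fun ⟨f⟩ => ?_⟩
  exact t1.hits_seq t2345 ((hit f).imp_right fun h => t2.hits_seq t345 (h.imp_right fun h =>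
    t3.hits_seq t45 (h.imp_right fun h => t4.hits_seq t5 h))) s hs

end Cmd

/-! ### The initial memory and the final program -/

theorem base_input {n : ℕ} (G : SimpleGraph (Fin n)) : Base G (input G) := ⟨by simp [input], rfl⟩

theorem bounded_input {n : ℕ} (hn : 5 ≤ n) (G : SimpleGraph (Fin n)) : (input G).Bounded n := by
  constructor
  · intro x _
    simp only [input]
    split <;> omega
  · intro a i
    simp only [input]
    split <;> omega

end ThreeCol

theorem mainTheorem8 :
    ∃ (P : ThreeCol.Prog) (c k : ℕ), ∀ (n : ℕ) (G : SimpleGraph (Fin n)),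
      ThreeCol.Clean G → G.Connected →
      ThreeCol.InducedFree (SimpleGraph.pathGraph 7) G →
      ThreeCol.InducedFree (SimpleGraph.cycleGraph 3) G →
      ThreeCol.InducedFree (SimpleGraph.cycleGraph 7) G →
      ThreeCol.InducedFree ThreeCol.shell G →
      (SimpleGraph.cycleGraph 5) ⊴ G →
      ∃ (t : ℕ) (s : ThreeCol.Store),
        ThreeCol.HaltsIn (n ^ k) P (ThreeCol.input G) t s ∧
        t ≤ c * n ^ 6 ∧
        ThreeCol.CorrectOutput G s := by
  open ThreeCol in
  -- Commands never write register `0`, the length of all loops, so the answer is kept in register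
  -- `18` and moved at the end. The move and its sequencing cost the two extra steps.
  refine ⟨.seq Cmd.main.compile (.move 0 18), Cmd.main.coef + 2, Exp.maxDeg, ?_⟩
  intro n G hG hconn h7 h3 hc hs ⟨φ⟩
  have hn : 5 ≤ n := by simpa using Fintype.card_le_of_injective φ φ.injective
  have E := Excl.of_inducedFree h7 h3 hc hs
  have adj : ∀ i j : Fin 5, (SimpleGraph.cycleGraph 5).Adj i j → G.Adj (φ i) (φ j) :=
    fun i j h => φ.map_rel_iff.2 h
  have C0 : Pentagon G (φ 0) (φ 1) (φ 2) (φ 3) (φ 4) := by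
    constructor <;> refine adj _ _ ?_ <;> rw [SimpleGraph.cycleGraph_adj] <;> decide
  obtain ⟨p, hp, C⟩ := Cmd.hasPentagon_findPentagon (base_input G) C0
  have r18 : (Cmd.findPentagon.sem (input G)).reg 18 = 0 := by
    rw [Cmd.reg_sem (by simp [Cmd.writes_findPentagon])]
    simp [input]
  have ready : Cmd.Ready G p (Cmd.findPentagon.sem (input G)) :=
    ⟨(base_input G).sem (by simp [Cmd.writes_findPentagon]) (by simp [Cmd.stores_findPentagon]),
      Or.inl r18, hp⟩
  obtain ⟨sound, complete⟩ := Cmd.searchAll_spec ready E hG hconn C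
  obtain ⟨t, s, ht, hx, agree, bd⟩ := Cmd.exec_compile hn Cmd.ok_main (bounded_input hn G)
    (base_input G).size ⟨fun _ _ => rfl, rfl⟩
  have e18 : s.reg 18 = (Cmd.searchAll.sem (Cmd.findPentagon.sem (input G))).reg 18 :=
    (agree.reg 18 (by simp [Exp.tempBase])).symm
  have earr : s.arr = (Cmd.searchAll.sem (Cmd.findPentagon.sem (input G))).arr := agree.arr.symm
  have le18 : s.reg 18 ≤ n ^ Exp.maxDeg := by
    rw [e18]
    exact (bd.reg 18 (by simp [Exp.tempBase])).trans (Nat.le_self_pow (by simp [Exp.maxDeg]) n)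
  -- Execution in front of the empty continuation is proper halting.
  refine ⟨_, _, hx.seq (.move le18) [], ?_, ?_⟩
  · rw [Cmd.deg_main] at ht
    have : 1 ≤ n ^ 6 := Nat.one_le_pow _ _ (by omega)
    rw [add_mul]
    omega
  · unfold CorrectOutput
    simp only [Store.reg_setReg, if_true, Store.arr_setReg, e18, earr]
    rcases sound with h | h
    · exact Or.inr ⟨h, fun hcol => complete hcol h⟩
    · exact Or.inl h
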